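/- Let $X$ be a smooth manifold of dimension $2n$ with a symplectic form $\omega$ and a B-field $B$, i.e. a real closed 2-form, and put $\omega_{\mathbb C}=B+i\omega$. Consider objects $(L,\mathcal L,\nabla)$, where $L\subset X$ is an embedded Lagrangian submanifold and $\mathcal L$ is a $C^\infty$ complex line bundle on $L$ with a unitary connection $\nabla$ of curvature $F_\nabla=2\pi i\,B|_L$. Let $\mathcal D(X,L)$ be the set of piecewise smooth continuous maps $u:(\mathbb D,\partial\mathbb D)\to(X,L)$ whose boundary $\partial u:=u|_{\partial\mathbb D}$ is a piecewise smooth loop in $L$. The weight of $u\in\mathcal D(X,L)$ is $$\rho(u)=e^{2\pi i\int_{\mathbb D}u^*\omega_{\mathbb C}}\,\mathrm{Hol}_\nabla(\partial u),$$ where $\mathbb D$ has its complex orientation and $\mathrm{Hol}_\nabla(\partial u)\in\mathbb C^*$ is parallel transport of $\nabla$ once around $\partial u$ counterclockwise. An isotopy from $(L,\mathcal L,\nabla)$ to $(L',\mathcal L',\nabla')$ consists of a smooth map $\psi:L\times[0,1]\to X$, $\psi_t(p)=\psi(p,t)$, such that $(p,t)\mapsto(\psi_t(p),t)$ is a smooth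 embedding into $X\times[0,1]$, every $\psi_t(L)$ is Lagrangian, $\psi_0$ is the inclusion of $L$ and $\psi_1$ is a diffeomorphism onto $L'$; and of a complex line bundle $\tilde{\mathcal L}$ on $L\times[0,1]$ with a unitary connection $\tilde\nabla$ of curvature $F_{\tilde\nabla}=2\pi i\,\psi^*B$ whose restrictions to $L\times\{0\}$ and $L\times\{1\}$ are $(\mathcal L,\nabla)$ and $\psi_1^*(\mathcal L',\nabla')$. Write $\psi^*\omega=b\wedge dt$, where $b_t$ is a 1-form on $L$ for each $t$, and put $\theta_\psi=\int_0^1 b_t\,dt\in\Omega^1(L)$. The isotopy is exact if $\psi^*\omega=d(H\,dt)$ for some smooth $H:L\times[0,1]\to\mathbb R$. For $u\in\mathcal D(X,L)$ define $u'$ by attaching the annulus swept out by $\partial u$: $$u'(re^{i\theta})=\begin{cases}u(2re^{i\theta}),&0\le r\le\tfrac12,\\ \psi_{2r-1}(u(e^{i\theta})),&\tfrac12\le r\le1.\end{cases}$$ Then $u'\in\mathcal D(X,L')$, the 1-form $\theta_\psi$ is smooth and closed, and $$\rho(u')=\rho(u)\,e^{2\pi\int_{\partial\mathbb D}(\partial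 u)^*\theta_\psi}=\rho(u)\,e^{2\pi\langle[\theta_\psi],[\partial u]\rangle},$$ where $[\theta_\psi]\in H^1(L;\mathbb R)$ is the de Rham class, $[\partial u]\in H_1(L;\mathbb Z)$, and $[\partial u]$ lies in the kernel of $H_1(L;\mathbb Z)\to H_1(X;\mathbb Z)$. In particular, if the isotopy is exact, then $[\theta_\psi]=0$ and $\rho(u')=\rho(u)$. -/

import Mathlib

open Set Filter Topology Manifold Bundle
open scoped ContDiff

noncomputable section

/-! ### Differential forms on manifolds without boundary -/

/-- A (not necessarily smooth) real `k`-form on an `m`-dimensional manifold. -/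
abbrev DForm (m : ℕ) (M : Type*) [TopologicalSpace M]
    [ChartedSpace (EuclideanSpace ℝ (Fin m)) M] (k : ℕ) : Type _ :=
  ∀ x : M, TangentSpace (𝓡 m) x [⋀^Fin k]→L[ℝ] ℝ

namespace DForm

section

variable {m : ℕ} {M : Type*} [TopologicalSpace M] [ChartedSpace (EuclideanSpace ℝ (Fin m)) M]
  {k : ℕ}

/-- The coordinate expression of a `k`-form in the preferred chart at `x₀`: the pullback of the form
under the inverse of the chart, a form on the open subset `(extChartAt (𝓡 m) x₀).target`. -/
def inChart (α : DForm m M k) (x₀ : M) (y : EuclideanSpace ℝ (Fin m)) :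
    EuclideanSpace ℝ (Fin m) [⋀^Fin k]→L[ℝ] ℝ :=
  (α ((extChartAt (𝓡 m) x₀).symm y)).compContinuousLinearMap
    (mfderiv 𝓘(ℝ, EuclideanSpace ℝ (Fin m)) (𝓡 m) (extChartAt (𝓡 m) x₀).symm y)

/-- A form is smooth if all its coordinate expressions are smooth. -/
def IsSmooth (α : DForm m M k) : Prop :=
  ∀ x₀ : M, ContDiffOn ℝ ∞ (α.inChart x₀) (extChartAt (𝓡 m) x₀).target

/-- A form is closed if the exterior derivative of each coordinate expression vanishes. -/
def IsClosed (α : DForm m M k) : Prop :=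
  ∀ x₀ : M, ∀ y ∈ (extChartAt (𝓡 m) x₀).target, extDeriv (α.inChart x₀) y = 0

lemma inChart_add (α β : DForm m M k) (x₀ : M) :
    (α + β).inChart x₀ = α.inChart x₀ + β.inChart x₀ := by
  funext y; rfl

lemma inChart_smul (c : ℝ) (α : DForm m M k) (x₀ : M) :
    (c • α).inChart x₀ = c • α.inChart x₀ := by
  funext y; rfl

lemma inChart_zero (x₀ : M) : (0 : DForm m M k).inChart x₀ = 0 := by
  funext y; rfl

lemma IsSmooth.differentiableAt {α : DForm m M k} (h : α.IsSmooth) (x₀ : M)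
    {y : EuclideanSpace ℝ (Fin m)} (hy : y ∈ (extChartAt (𝓡 m) x₀).target) :
    DifferentiableAt ℝ (α.inChart x₀) y :=
  ((h x₀).contDiffAt ((isOpen_extChartAt_target x₀).mem_nhds hy)).differentiableAt (by simp)

end

end DForm

section DeRham

variable (m : ℕ) (M : Type*) [TopologicalSpace M] [ChartedSpace (EuclideanSpace ℝ (Fin m)) M]

/-- The space of smooth closed 1-forms. -/
def closedOneForms : Submodule ℝ (DForm m M 1) where
  carrier := {α | α.IsSmooth ∧ α.IsClosed}
  zero_mem' := by
    refine ⟨fun x₀ => ?_, fun x₀ y _ => ?_⟩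
    · rw [DForm.inChart_zero]; exact contDiffOn_const
    · rw [DForm.inChart_zero]
      have := extDeriv_smul (𝕜 := ℝ) (x := y) (0 : ℝ)
        (0 : EuclideanSpace ℝ (Fin m) → EuclideanSpace ℝ (Fin m) [⋀^Fin 1]→L[ℝ] ℝ)
      simpa using this
  add_mem' := by
    rintro α β ⟨hα, hα'⟩ ⟨hβ, hβ'⟩
    refine ⟨fun x₀ => ?_, fun x₀ y hy => ?_⟩
    · rw [DForm.inChart_add]; exact (hα x₀).add (hβ x₀)
    · rw [DForm.inChart_add,
        extDeriv_add (hα.differentiableAt x₀ hy) (hβ.differentiableAt x₀ hy),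
        hα' x₀ y hy, hβ' x₀ y hy, add_zero]
  smul_mem' := by
    rintro c α ⟨hα, hα'⟩
    refine ⟨fun x₀ => ?_, fun x₀ y hy => ?_⟩
    · rw [DForm.inChart_smul]; exact contDiffOn_const.smul (hα x₀)
    · rw [DForm.inChart_smul, extDeriv_smul, hα' x₀ y hy, smul_zero]

/-- The space of exact 1-forms `df`, with `f` a smooth real function. -/
def exactOneForms : Submodule ℝ (DForm m M 1) where
  carrier := {α | ∃ f : M → ℝ, ContMDiff (𝓡 m) 𝓘(ℝ, ℝ) ∞ f ∧
    ∀ (x : M) (v : TangentSpace (𝓡 m) x), α x ![v] = mfderiv (𝓡 m) 𝓘(ℝ, ℝ) f x v}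
  zero_mem' := ⟨fun _ => 0, contMDiff_const, fun x v => by
    rw [mfderiv_const]; rfl⟩
  add_mem' := by
    rintro α β ⟨f, hf, hf'⟩ ⟨g, hg, hg'⟩
    refine ⟨f + g, hf.add hg, fun x v => ?_⟩
    have h1 : MDifferentiableAt (𝓡 m) 𝓘(ℝ, ℝ) f x := hf.mdifferentiable (by simp) x
    have h2 : MDifferentiableAt (𝓡 m) 𝓘(ℝ, ℝ) g x := hg.mdifferentiable (by simp) x
    have h3 := mfderiv_add h1 h2
    rw [Pi.add_apply, ContinuousAlternatingMap.add_apply, hf' x v, hg' x v]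
    exact (congrArg (fun T : EuclideanSpace ℝ (Fin m) →L[ℝ] ℝ => T v) h3).symm
  smul_mem' := by
    rintro c α ⟨f, hf, hf'⟩
    refine ⟨c • f, (contDiff_const_smul c).contMDiff.comp hf, fun x v => ?_⟩
    have h1 : MDifferentiableAt (𝓡 m) 𝓘(ℝ, ℝ) f x := hf.mdifferentiable (by simp) x
    have h3 := const_smul_mfderiv h1 c
    rw [Pi.smul_apply, ContinuousAlternatingMap.smul_apply, hf' x v]
    exact (congrArg (fun T : EuclideanSpace ℝ (Fin m) →L[ℝ] ℝ => T v) h3).symm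

/-- The first de Rham cohomology group `H¹(M; ℝ)`: closed 1-forms modulo exact 1-forms. -/
abbrev H1dR : Type _ :=
  (closedOneForms m M).toAddSubgroup ⧸
    (exactOneForms m M).toAddSubgroup.addSubgroupOf (closedOneForms m M).toAddSubgroup

variable {m M}

/-- The de Rham class of a closed 1-form. -/
def deRhamClass (α : DForm m M 1) (hα : α ∈ closedOneForms m M) : H1dR m M :=
  QuotientAddGroup.mk ⟨α, hα⟩

end DeRham

/-! ### Singular homology and the de Rham pairing in degree one -/

section Homology

open CategoryTheory AlgebraicTopology Simplicial

universe w

/-- The coefficient group `ℤ`. -/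
abbrev coeffZ : ModuleCat.{w} ℤ := ModuleCat.of ℤ (ULift.{w} ℤ)

/-- The functor `H₁(-; ℤ)` (singular homology). -/
abbrev singularH1Functor : TopCat.{w} ⥤ ModuleCat.{w} ℤ :=
  (singularHomologyFunctor (ModuleCat.{w} ℤ) 1).obj coeffZ.{w}

/-- The singular homology group `H₁(Y; ℤ)`. -/
abbrev SingularH1 (Y : Type w) [TopologicalSpace Y] : Type w :=
  singularH1Functor.{w}.obj (TopCat.of Y)

/-- The map on `H₁(-; ℤ)` induced by a continuous map. -/
def singularH1Map {Y Z : Type w} [TopologicalSpace Y] [TopologicalSpace Z] (f : C(Y, Z)) :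
    SingularH1 Y →ₗ[ℤ] SingularH1 Z :=
  (singularH1Functor.{w}.map (TopCat.ofHom f)).hom

variable {Y : Type w} [TopologicalSpace Y]

/-- A loop `γ : S¹ → Y` as a singular 1-simplex: `(x₀, x₁) ↦ γ (exp (2 π i x₁))`. -/
def loopSimplex (γ : C(Circle, Y)) : (TopCat.toSSet.obj (TopCat.of Y)) _⦋1⦌ :=
  (TopCat.toSSetObjEquiv (TopCat.of Y) (Opposite.op ⦋1⦌)).symm
    ⟨fun x => γ (Circle.exp (2 * Real.pi * x 1)), by
      refine γ.continuous.comp (Circle.exp.continuous.comp ?_)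
      exact continuous_const.mul ((continuous_apply 1).comp continuous_subtype_val)⟩

/-- The singular chain complex of `Y` with integer coefficients. -/
abbrev singularChains (Y : Type w) [TopologicalSpace Y] : ChainComplex (ModuleCat.{w} ℤ) ℕ :=
  ((singularChainComplexFunctor (ModuleCat.{w} ℤ)).obj coeffZ.{w}).obj (TopCat.of Y)

/-- The generator of the singular 1-chains given by a loop. -/
def loopChain (γ : C(Circle, Y)) : coeffZ.{w} ⟶ (singularChains Y).X 1 :=
  (TopCat.toSSet.obj (TopCat.of Y)).ιChainComplex (loopSimplex γ)

lemma loopChain_d (γ : C(Circle, Y)) :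
    CategoryStruct.comp (loopChain γ) ((singularChains Y).d 1 0) = 0 := by
  have h : (TopCat.toSSet.obj (TopCat.of Y)).δ 0 (loopSimplex γ) =
      (TopCat.toSSet.obj (TopCat.of Y)).δ 1 (loopSimplex γ) := by
    apply (TopCat.toSSetObjEquiv (TopCat.of Y) (Opposite.op ⦋0⦌)).injective
    ext x
    change γ (Circle.exp (2 * Real.pi *
        (stdSimplex.map (SimplexCategory.δ (n := 0) 0).toOrderHom x) 1)) =
      γ (Circle.exp (2 * Real.pi *
        (stdSimplex.map (SimplexCategory.δ (n := 0) 1).toOrderHom x) 1))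
    have hx : x = (stdSimplex.vertex 0 : stdSimplex ℝ (Fin 1)) :=
      Subsingleton.elim (α := stdSimplex ℝ (Fin 1)) _ _
    subst hx
    rw [stdSimplex.map_vertex, stdSimplex.map_vertex]
    have h0 : (SimplexCategory.δ (n := 0) 0).toOrderHom 0 = 1 := rfl
    have h1 : (SimplexCategory.δ (n := 0) 1).toOrderHom 0 = 0 := rfl
    have e1 : (stdSimplex.vertex (1 : Fin 2) : stdSimplex ℝ (Fin 2)) 1 = 1 := by
      simp [stdSimplex.vertex_coe]
    have e0 : (stdSimplex.vertex (0 : Fin 2) : stdSimplex ℝ (Fin 2)) 1 = 0 := by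
      simp [stdSimplex.vertex_coe]
    rw [h0, h1]
    refine (congrArg (fun r : ℝ => γ (Circle.exp (2 * Real.pi * r))) e1).trans
      (Eq.trans ?_ (congrArg (fun r : ℝ => γ (Circle.exp (2 * Real.pi * r))) e0).symm)
    simp
  refine (SSet.ιChainComplex_d (TopCat.toSSet.obj (TopCat.of Y)) coeffZ.{w} (loopSimplex γ)).trans ?_
  simp [Fin.sum_univ_two, h]
  rfl

/-- The class `[γ] ∈ H₁(Y; ℤ)` of a loop. -/
def loopClass (γ : C(Circle, Y)) : SingularH1 Y :=
  (CategoryStruct.comp ((singularChains Y).liftCycles (loopChain γ) 0 (by simp) (loopChain_d γ))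
    ((singularChains Y).homologyπ 1)).hom ⟨1⟩

end Homology

/-! ### Loops, integrals of 1-forms along loops, de Rham pairing -/

section Loops

variable {E : Type*} [NormedAddCommGroup E] [NormedSpace ℝ E] {H : Type*} [TopologicalSpace H]
  (J : ModelWithCorners ℝ E H) {M : Type*} [TopologicalSpace M] [ChartedSpace H M]

/-- A loop is piecewise smooth if, as a function of the angle in `[0, 2π]`, it is smooth on each
closed interval of some finite partition. -/
def IsPiecewiseSmoothLoop (γ : C(Circle, M)) : Prop :=
  ∃ (N : ℕ) (a : ℕ → ℝ), a 0 = 0 ∧ a N = 2 * Real.pi ∧ (∀ i < N, a i < a (i + 1)) ∧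
    ∀ i < N, ContMDiffOn 𝓘(ℝ, ℝ) J ∞ (fun s : ℝ => γ (Circle.exp s)) (Icc (a i) (a (i + 1)))

/-- The velocity of a loop at the angle `s`. -/
def loopVelocity (γ : C(Circle, M)) (s : ℝ) : TangentSpace J (γ (Circle.exp s)) :=
  mfderiv 𝓘(ℝ, ℝ) J (fun r : ℝ => γ (Circle.exp r)) s (1 : ℝ)

end Loops

section Pairing

universe w

variable {m : ℕ} {M : Type w} [TopologicalSpace M] [ChartedSpace (EuclideanSpace ℝ (Fin m)) M]

/-- The integral `∫_{S¹} γ^* α` of a 1-form along a loop. -/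
def loopIntegral (α : DForm m M 1) (γ : C(Circle, M)) : ℝ :=
  ∫ s in (0 : ℝ)..(2 * Real.pi), α (γ (Circle.exp s)) ![loopVelocity (𝓡 m) γ s]

open Classical in
/-- The de Rham pairing `⟨a, ·⟩ : H₁(M; ℤ) → ℝ` with a class `a ∈ H¹(M; ℝ)`: the homomorphism whose
value at the class of any piecewise smooth loop is the integral along this loop of any closed
1-form that represents `a`. -/
def deRhamPairing (a : H1dR m M) : SingularH1 M →+ ℝ :=
  Classical.epsilon fun φ : SingularH1 M →+ ℝ =>
    ∀ (α : DForm m M 1) (hα : α ∈ closedOneForms m M), deRhamClass α hα = a →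
      ∀ γ : C(Circle, M), IsPiecewiseSmoothLoop (𝓡 m) γ → φ (loopClass γ) = loopIntegral α γ

end Pairing

/-! ### Complex line bundles with unitary connection -/

section LineBundles

universe v

variable {E : Type*} [NormedAddCommGroup E] [NormedSpace ℝ E] {H : Type*} [TopologicalSpace H]
  (J : ModelWithCorners ℝ E H) (M : Type*) [TopologicalSpace M] [ChartedSpace H M]
  [IsManifold J ∞ M]

/-- A smooth complex line bundle on `M` with a smooth Hermitian metric and a smooth unitary
connection. In `conn s x v` the argument `s` is a section, and the value is `(∇_v s)(x)`. -/
structure UnitaryLineBundle where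
  /-- The fibres. -/
  fiber : M → Type v
  [normedFiber : ∀ x, NormedAddCommGroup (fiber x)]
  [innerFiber : ∀ x, InnerProductSpace ℂ (fiber x)]
  [topTotal : TopologicalSpace (TotalSpace ℂ fiber)]
  [fiberBundle : FiberBundle ℂ fiber]
  [complexBundle : VectorBundle ℂ ℂ fiber]
  [realBundle : VectorBundle ℝ ℂ fiber]
  [smoothBundle : ContMDiffVectorBundle ∞ ℂ fiber J]
  inner_smooth : ∀ (s t : ∀ x, fiber x) (x : M),
    ContMDiffAt J (J.prod 𝓘(ℝ, ℂ)) ∞ (fun y => (⟨y, s y⟩ : TotalSpace ℂ fiber)) x →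
    ContMDiffAt J (J.prod 𝓘(ℝ, ℂ)) ∞ (fun y => (⟨y, t y⟩ : TotalSpace ℂ fiber)) x →
    ContMDiffAt J 𝓘(ℝ, ℂ) ∞ (fun y => inner ℂ (s y) (t y)) x
  /-- The connection. -/
  conn : CovariantDerivative J ℂ fiber
  conn_smooth : ∀ U : Set M, IsOpen U → ContMDiffCovariantDerivativeOn ℂ ∞ conn.toFun U
  conn_complexLinear : ∀ (s : ∀ x, fiber x) (x : M),
    ContMDiffAt J (J.prod 𝓘(ℝ, ℂ)) ∞ (fun y => (⟨y, s y⟩ : TotalSpace ℂ fiber)) x →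
    ∀ v : TangentSpace J x, conn (fun y => Complex.I • s y) x v = Complex.I • conn s x v
  conn_unitary : ∀ (s t : ∀ x, fiber x) (x : M),
    ContMDiffAt J (J.prod 𝓘(ℝ, ℂ)) ∞ (fun y => (⟨y, s y⟩ : TotalSpace ℂ fiber)) x →
    ContMDiffAt J (J.prod 𝓘(ℝ, ℂ)) ∞ (fun y => (⟨y, t y⟩ : TotalSpace ℂ fiber)) x →
    ∀ v : TangentSpace J x, mfderiv J 𝓘(ℝ, ℂ) (fun y => inner ℂ (s y) (t y)) x v =
      inner ℂ (conn s x v) (t x) + inner ℂ (s x) (conn t x v)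

attribute [instance] UnitaryLineBundle.normedFiber UnitaryLineBundle.innerFiber
  UnitaryLineBundle.topTotal UnitaryLineBundle.fiberBundle UnitaryLineBundle.complexBundle
  UnitaryLineBundle.realBundle UnitaryLineBundle.smoothBundle

namespace UnitaryLineBundle

variable {J M}

/-- A section is smooth near `x`. -/
def SmoothSectionAt (Λ : UnitaryLineBundle J M) (s : ∀ x, Λ.fiber x) (x : M) : Prop :=
  ContMDiffAt J (J.prod 𝓘(ℝ, ℂ)) ∞ (fun y => (⟨y, s y⟩ : TotalSpace ℂ Λ.fiber)) x

/-- The curvature `F(V, W) s = ∇_V ∇_W s - ∇_W ∇_V s - ∇_[V,W] s`. -/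
def curvature (Λ : UnitaryLineBundle J M) (V W : ∀ x : M, TangentSpace J x)
    (s : ∀ x, Λ.fiber x) (x : M) : Λ.fiber x :=
  Λ.conn (fun y => Λ.conn s y (W y)) x (V x) - Λ.conn (fun y => Λ.conn s y (V y)) x (W x) -
    Λ.conn s x (VectorField.mlieBracket J V W x)

/-- The curvature is `2 π i β`, for a real 2-form `β`. -/
def HasCurvature (Λ : UnitaryLineBundle J M)
    (β : ∀ x : M, TangentSpace J x [⋀^Fin 2]→L[ℝ] ℝ) : Prop :=
  ∀ (x : M) (V W : ∀ y : M, TangentSpace J y) (s : ∀ y, Λ.fiber y),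
    ContMDiffAt J J.tangent ∞ (fun y => (⟨y, V y⟩ : TangentBundle J M)) x →
    ContMDiffAt J J.tangent ∞ (fun y => (⟨y, W y⟩ : TangentBundle J M)) x →
    Λ.SmoothSectionAt s x →
    Λ.curvature V W s x = (2 * Real.pi * Complex.I * (β x ![V x, W x] : ℂ)) • s x

/-- `τ` is a continuous section of `Λ` along the curve `c` on `[a, b]` that is parallel except at
finitely many parameters. At a parameter `t` we write `τ = f • (s ∘ c)` near `t`, with `s` a
local frame of `Λ` near `c t`; then `D τ / dt = f' • s + f • ∇_{c'} s`. -/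
def IsParallelAlong (Λ : UnitaryLineBundle J M) (c : ℝ → M) (a b : ℝ)
    (τ : ∀ t, Λ.fiber (c t)) : Prop :=
  ContinuousOn (fun t => (⟨c t, τ t⟩ : TotalSpace ℂ Λ.fiber)) (Icc a b) ∧
  ∃ S : Set ℝ, S.Finite ∧ ∀ t ∈ Ioo a b, t ∉ S →
    ∃ (s : ∀ x, Λ.fiber x) (f : ℝ → ℂ) (f' : ℂ),
      Λ.SmoothSectionAt s (c t) ∧ s (c t) ≠ 0 ∧ (∀ᶠ r in 𝓝 t, τ r = f r • s (c r)) ∧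
      HasDerivAt f f' t ∧
      f' • s (c t) + f t • Λ.conn s (c t) (mfderiv 𝓘(ℝ, ℝ) J c t (1 : ℝ)) = 0

/-- The holonomy of the connection around a loop, as a complex number: parallel transport around
the loop, starting at angle `0`, is multiplication by this number. -/
def holonomy (Λ : UnitaryLineBundle J M) (γ : C(Circle, M)) : ℂ :=
  Classical.epsilon fun h : ℂ =>
    ∃ τ : ∀ t : ℝ, Λ.fiber (γ (Circle.exp t)),
      Λ.IsParallelAlong (fun t => γ (Circle.exp t)) 0 (2 * Real.pi) τ ∧ τ 0 ≠ 0 ∧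
      (⟨γ (Circle.exp (2 * Real.pi)), τ (2 * Real.pi)⟩ : TotalSpace ℂ Λ.fiber) =
        ⟨γ (Circle.exp 0), h • τ 0⟩

end UnitaryLineBundle

variable {J M}
variable {E' : Type*} [NormedAddCommGroup E'] [NormedSpace ℝ E'] {H' : Type*} [TopologicalSpace H']
  {J' : ModelWithCorners ℝ E' H'} {M' : Type*} [TopologicalSpace M'] [ChartedSpace H' M']
  [IsManifold J' ∞ M']

/-- An isomorphism of `Λ` with the pullback `f^* Λ'`, as line bundles with connection: a smooth
fibrewise complex linear isomorphism `Φ` over `f` such that the pullback `y ↦ Φ_y⁻¹ (s' (f y))` of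
a section `s'` has covariant derivative `∇_v (f^* s') = Φ⁻¹ (∇'_{df(v)} s')`. -/
structure PullbackIso (Λ : UnitaryLineBundle J M) (Λ' : UnitaryLineBundle J' M') (f : M → M') where
  /-- The isomorphisms of the fibres. -/
  toEquiv : ∀ x, Λ.fiber x ≃ₗ[ℂ] Λ'.fiber (f x)
  smooth : ContMDiff (J.prod 𝓘(ℝ, ℂ)) (J'.prod 𝓘(ℝ, ℂ)) ∞
    (fun w : TotalSpace ℂ Λ.fiber => (⟨f w.1, toEquiv w.1 w.2⟩ : TotalSpace ℂ Λ'.fiber))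
  conn_eq : ∀ (s' : ∀ x, Λ'.fiber x) (x : M), Λ'.SmoothSectionAt s' (f x) →
    ∀ v : TangentSpace J x,
      Λ.conn (fun y => (toEquiv y).symm (s' (f y))) x v =
        (toEquiv x).symm (Λ'.conn s' (f x) (mfderiv J J' f x v))

end LineBundles

/-! ### Symplectic manifolds with a B-field, Lagrangians, discs -/

section Pullback

variable {E : Type*} [NormedAddCommGroup E] [NormedSpace ℝ E] {H : Type*} [TopologicalSpace H]
  (J : ModelWithCorners ℝ E H) {M : Type*} [TopologicalSpace M] [ChartedSpace H M]
  {m : ℕ} {X : Type*} [TopologicalSpace X] [ChartedSpace (EuclideanSpace ℝ (Fin m)) X] {k : ℕ}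

/-- The pullback `f^* α` of a form. -/
def DForm.pullback (α : DForm m X k) (f : M → X) (x : M) : TangentSpace J x [⋀^Fin k]→L[ℝ] ℝ :=
  (α (f x)).compContinuousLinearMap (mfderiv J (𝓡 m) f x)

end Pullback

/-- A symplectic form and a B-field on a manifold of dimension `2n`. -/
structure SymplecticBField (n : ℕ) (X : Type*) [TopologicalSpace X]
    [ChartedSpace (EuclideanSpace ℝ (Fin (2 * n))) X] where
  /-- The symplectic form. -/
  symp : DForm (2 * n) X 2
  symp_smooth : symp.IsSmooth
  symp_closed : symp.IsClosed
  symp_nondegenerate : ∀ (x : X) (v : TangentSpace (𝓡 (2 * n)) x), (∀ w, symp x ![v, w] = 0) → v = 0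
  /-- The B-field. -/
  B : DForm (2 * n) X 2
  B_smooth : B.IsSmooth
  B_closed : B.IsClosed

section Discs

variable {m : ℕ} {X : Type*} [TopologicalSpace X] [ChartedSpace (EuclideanSpace ℝ (Fin m)) X]

/-- The closed unit square. -/
def unitSquare : Set (ℝ × ℝ) := Icc 0 1 ×ˢ Icc 0 1

/-- A smoothly embedded closed square in the plane. -/
structure IsSmoothCell (σ : ℝ × ℝ → ℂ) : Prop where
  smooth : ContDiffOn ℝ ∞ σ unitSquare
  injOn : InjOn σ unitSquare
  immersion : ∀ q ∈ unitSquare, Function.Injective (fderivWithin ℝ σ unitSquare q)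

/-- A map on the closed unit disc is piecewise smooth if the disc is a finite union of smoothly
embedded closed squares with disjoint interiors, on each of which the map is smooth (up to the
boundary of the square). -/
def IsPiecewiseSmoothOnDisc (u : ℂ → X) : Prop :=
  ∃ (N : ℕ) (σ : Fin N → ℝ × ℝ → ℂ), (∀ i, IsSmoothCell (σ i)) ∧
    (⋃ i, σ i '' unitSquare) = Metric.closedBall (0 : ℂ) 1 ∧
    Pairwise (fun i j => Disjoint (σ i '' interior unitSquare) (σ j '' interior unitSquare)) ∧
    ∀ i, ContMDiffOn 𝓘(ℝ, ℝ × ℝ) (𝓡 m) ∞ (u ∘ σ i) unitSquare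

/-- The integral `∫_𝔻 u^* β` of a 2-form over the unit disc with its complex orientation. -/
def discIntegral (β : DForm m X 2) (u : ℂ → X) : ℝ :=
  ∫ z in Metric.ball (0 : ℂ) 1, β (u z)
    ![mfderiv 𝓘(ℝ, ℂ) (𝓡 m) u z (1 : ℂ), mfderiv 𝓘(ℝ, ℂ) (𝓡 m) u z Complex.I]

/-- The set `𝒟(X, L)` of discs with boundary on the submanifold `ι : L → X`: maps `u` on the closed
unit disc (the values of `u` elsewhere are irrelevant), with their boundary loop `∂u : S¹ → L`. -/
structure LagDisc (n m : ℕ) {X : Type*} [TopologicalSpace X]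
    [ChartedSpace (EuclideanSpace ℝ (Fin m)) X] {L : Type*} [TopologicalSpace L] [ChartedSpace (EuclideanSpace ℝ (Fin n)) L]
    (ι : L → X) where
  /-- The map on the disc. -/
  toFun : ℂ → X
  continuousOn : ContinuousOn toFun (Metric.closedBall 0 1)
  piecewiseSmooth : IsPiecewiseSmoothOnDisc (m := m) toFun
  /-- The boundary loop. -/
  bdry : C(Circle, L)
  bdry_eq : ∀ z : Circle, ι (bdry z) = toFun (z : ℂ)
  bdry_piecewiseSmooth : IsPiecewiseSmoothLoop (𝓡 n) bdry

end Discs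

/-! ### Objects, weights and isotopies -/

section Objects

universe v

variable {n : ℕ} {X : Type*} [TopologicalSpace X]
  [ChartedSpace (EuclideanSpace ℝ (Fin (2 * n))) X]

/-- A Lagrangian submanifold `ι : L → X` with a complex line bundle and a unitary connection of
curvature `2 π i B|_L`. -/
structure LagObject (S : SymplecticBField n X) (L : Type*) [TopologicalSpace L]
    [ChartedSpace (EuclideanSpace ℝ (Fin n)) L] [IsManifold (𝓡 n) ∞ L] where
  /-- The inclusion of the Lagrangian. -/
  ι : L → X
  embedding : IsSmoothEmbedding (𝓡 n) (𝓡 (2 * n)) ∞ ι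
  lagrangian : ∀ p : L, S.symp.pullback (𝓡 n) ι p = 0
  /-- The line bundle with connection. -/
  bundle : UnitaryLineBundle.{v} (𝓡 n) L
  curvature_eq : bundle.HasCurvature (S.B.pullback (𝓡 n) ι)

variable {S : SymplecticBField n X} {L : Type*} [TopologicalSpace L]
  [ChartedSpace (EuclideanSpace ℝ (Fin n)) L] [IsManifold (𝓡 n) ∞ L]

/-- The weight `ρ(u) = exp (2 π i ∫_𝔻 u^* (B + i ω)) Hol_∇ (∂u)`. -/
def LagObject.weight (O : LagObject S L) (u : LagDisc n (2 * n) O.ι) : ℂ :=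
  Complex.exp (2 * Real.pi * Complex.I *
    (discIntegral S.B u.toFun + Complex.I * discIntegral S.symp u.toFun)) *
    O.bundle.holonomy u.bdry

/-- The model with corners of `L × [0,1]`. -/
abbrev cylModel (n : ℕ) := (𝓡 n).prod (𝓡∂ 1)

/-- An isotopy between two objects: a Lagrangian isotopy `ψ : L × [0,1] → X` from `L` to `L'`
together with a line bundle with unitary connection on `L × [0,1]`, of curvature `2 π i ψ^* B`,
that restricts to the given bundles with connection at both ends. -/
structure LagIsotopy {L' : Type*} [TopologicalSpace L']
    [ChartedSpace (EuclideanSpace ℝ (Fin n)) L'] [IsManifold (𝓡 n) ∞ L']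
    (O : LagObject S L) (O' : LagObject S L') where
  /-- The isotopy. -/
  ψ : L × Icc (0 : ℝ) 1 → X
  smooth : ContMDiff (cylModel n) (𝓡 (2 * n)) ∞ ψ
  track_embedding : IsSmoothEmbedding (cylModel n) ((𝓡 (2 * n)).prod (𝓡∂ 1)) ∞
    (fun q : L × Icc (0 : ℝ) 1 => ((ψ q, q.2) : X × Icc (0 : ℝ) 1))
  lagrangian : ∀ (t : Icc (0 : ℝ) 1) (p : L), S.symp.pullback (𝓡 n) (fun p => ψ (p, t)) p = 0
  start_eq : ∀ p, ψ (p, 0) = O.ι p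
  /-- The diffeomorphism `ψ₁ : L → L'`. -/
  endDiffeo : L ≃ₘ⟮𝓡 n, 𝓡 n⟯ L'
  end_eq : ∀ p, ψ (p, 1) = O'.ι (endDiffeo p)
  /-- The line bundle with connection on `L × [0,1]`. -/
  bundle : UnitaryLineBundle.{v} (cylModel n) (L × Icc (0 : ℝ) 1)
  curvature_eq : bundle.HasCurvature (S.B.pullback (cylModel n) ψ)
  restrict_start : Nonempty (PullbackIso O.bundle bundle (fun p => (p, 0)))
  restrict_end : Nonempty (PullbackIso O'.bundle bundle (fun p' => (endDiffeo.symm p', 1)))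

namespace LagIsotopy

variable {L' : Type*} [TopologicalSpace L']
    [ChartedSpace (EuclideanSpace ℝ (Fin n)) L'] [IsManifold (𝓡 n) ∞ L']
    {O : LagObject S L} {O' : LagObject S L'}

/-- The vector `∂/∂t` at a point of `L × [0,1]`. -/
def timeVector (q : L × Icc (0 : ℝ) 1) : TangentSpace (cylModel n) q :=
  ((0 : EuclideanSpace ℝ (Fin n)), oneTangentSpaceIcc q.2)

/-- The 1-form `b_t` on `L`, determined by `ψ^* ω = b ∧ dt`, i.e. `b_t(v) = (ψ^* ω)(v, ∂/∂t)`
(see `b_apply`). -/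
def b (Ψ : LagIsotopy O O') (t : Icc (0 : ℝ) 1) : DForm n L 1 := fun p =>
  let β : (EuclideanSpace ℝ (Fin n) × EuclideanSpace ℝ (Fin 1)) [⋀^Fin 2]→L[ℝ] ℝ :=
    S.symp.pullback (cylModel n) Ψ.ψ (p, t);
  -((β.curryLeft (timeVector (p, t))).compContinuousLinearMap
    (ContinuousLinearMap.inl ℝ (EuclideanSpace ℝ (Fin n)) (EuclideanSpace ℝ (Fin 1))))

lemma b_apply (Ψ : LagIsotopy O O') (t : Icc (0 : ℝ) 1) (p : L) (v : TangentSpace (𝓡 n) p) :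
    Ψ.b t p ![v] = S.symp.pullback (cylModel n) Ψ.ψ (p, t)
      ![((v, (0 : EuclideanSpace ℝ (Fin 1))) : TangentSpace (cylModel n) (p, t)),
        timeVector (p, t)] := by
  let β : (EuclideanSpace ℝ (Fin n) × EuclideanSpace ℝ (Fin 1)) [⋀^Fin 2]→L[ℝ] ℝ :=
    S.symp.pullback (cylModel n) Ψ.ψ (p, t)
  let e : EuclideanSpace ℝ (Fin n) × EuclideanSpace ℝ (Fin 1) := timeVector (p, t)
  let w : EuclideanSpace ℝ (Fin n) × EuclideanSpace ℝ (Fin 1) := (v, 0)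
  let v' : EuclideanSpace ℝ (Fin n) := v
  change -(β (Matrix.vecCons e (fun i => ContinuousLinearMap.inl ℝ (EuclideanSpace ℝ (Fin n))
    (EuclideanSpace ℝ (Fin 1)) (![v'] i)))) = β ![w, e]
  have h0 : (fun i => ContinuousLinearMap.inl ℝ (EuclideanSpace ℝ (Fin n))
      (EuclideanSpace ℝ (Fin 1)) (![v'] i)) = ![w] := by
    funext i; fin_cases i; rfl
  rw [h0]
  have h := β.toAlternatingMap.map_swap ![w, e] (i := 0) (j := 1) (by decide)
  have h2 : (![w, e] ∘ Equiv.swap (0 : Fin 2) 1) = ![e, w] := by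
    funext i; fin_cases i <;> simp
  rw [h2] at h
  change β ![e, w] = -(β ![w, e]) at h
  rw [h, neg_neg]

/-- The value of `θ_ψ` at `p`, as an alternating form on the model space. -/
def thetaAt (Ψ : LagIsotopy O O') (p : L) : EuclideanSpace ℝ (Fin n) [⋀^Fin 1]→L[ℝ] ℝ :=
  ∫ t in (0 : ℝ)..1, (Ψ.b (projIcc 0 1 zero_le_one t) p : _)

/-- The 1-form `θ_ψ = ∫₀¹ b_t dt` on `L`. -/
def theta (Ψ : LagIsotopy O O') : DForm n L 1 := Ψ.thetaAt

/-- The isotopy is exact: `ψ^* ω = d(h dt) = dh ∧ dt` for a smooth function `h` on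
`L × [0,1]`. -/
def IsExact (Ψ : LagIsotopy O O') : Prop :=
  ∃ h : L × Icc (0 : ℝ) 1 → ℝ, ContMDiff (cylModel n) 𝓘(ℝ, ℝ) ∞ h ∧
    ∀ (q : L × Icc (0 : ℝ) 1) (v w : TangentSpace (cylModel n) q),
      S.symp.pullback (cylModel n) Ψ.ψ q ![v, w] =
        mvfderiv (cylModel n) h q v * mvfderiv (cylModel n) (fun q => (q.2 : ℝ)) q w -
          mvfderiv (cylModel n) h q w * mvfderiv (cylModel n) (fun q => (q.2 : ℝ)) q v

/-- The map `u'` obtained from the disc `u` by attaching the annulus swept out by `∂u`: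
`u'(r e^{iθ}) = u(2 r e^{iθ})` for `r ≤ 1/2`, and `ψ_{2r-1}(u(e^{iθ}))` for `1/2 ≤ r ≤ 1`. -/
def attach (Ψ : LagIsotopy O O') (u : LagDisc n (2 * n) O.ι) (z : ℂ) : X :=
  if ‖z‖ ≤ 1 / 2 then u.toFun (2 * z)
  else Ψ.ψ (u.bdry (Circle.exp (Complex.arg z)), projIcc 0 1 zero_le_one (2 * ‖z‖ - 1))

end LagIsotopy

end Objects

end

universe w

/-!
The disc `u'` consists of a copy of `u` on the disc of radius `1/2` and of the annulus swept out by
the boundary loop `γ`. Polar coordinates, with the angle first and the radius second, reverse the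
orientation of the plane, so for every 2-form `β`
`∫ u'^* β = ∫ u^* β - ∫∫ (ψ^* β)(γ', ∂/∂t) dt ds` (`LagIsotopy.discIntegral_attach`).

For `β = ω` the inner integral over `t` is `θ_ψ(γ')`, and the annulus contributes the integral of
`θ_ψ` along `γ`. For `β = B` the annulus contributes a phase, which is cancelled by the change of
holonomy (`LagIsotopy.holonomy_end`). Indeed let `G(s, t)` be the integral of `(ψ^* B)(γ', ∂/∂t)`
over `[0, s] × [0, t]`. The bundle of the isotopy has curvature `2πi ψ^* B`, so over the cylinder of
`γ` it has a nowhere vanishing section `τ` which is parallel in the direction of `t` and for which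
`exp(2πi G) τ` is parallel along each `γ × {t}`. Comparing `τ` at the angles `0` and `2π` shows that
the holonomy of `γ × {t}` is `exp(2πi G(2π, t))` times that of `γ × {0}`. Over a small rectangle,
contained in the domain of a frame and of a chart, `τ` is the exponential of integrals of the
connection form, and the condition on `exp(2πi G) τ` is the structure equation
(`UnitaryLineBundle.HasCurvature.pullConn`, `UnitaryLineBundle.exists_isTransport_of_mapsTo`).
Sections over adjacent rectangles are proportional along the common side by uniqueness of parallel
transport, and can therefore be glued (`UnitaryLineBundle.IsTransport.glue`). Uniqueness needs no
theory of differential equations: the inner product of two parallel sections is constant because the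
connection is unitary (`UnitaryLineBundle.inner_eq_of_isParallelAlong`), and fibres are
one-dimensional.

The form `θ_ψ` is closed because `ω` is: in the coordinates of a chart and `t`, the equation
`dω = 0` evaluated on two vectors tangent to `L` and `∂/∂t` says that each `b_t` is closed, up to
the derivative of `ψ_t^* ω`, which vanishes as `ψ_t(L)` is Lagrangian (`LagIsotopy.theta_isClosed`).
If `ψ^* ω = d(h dt)`, then `θ_ψ` is the differential of `∫ h dt`.

For the topological form of the result, a closed 1-form `α` has a primitive along every map from a
contractible space: primitives of `α` form a covering space, to which such maps lift
(`exists_isPrimitiveAlong`). Differences of values of primitives along singular 1-simplices define a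
cochain which vanishes on boundaries, hence a homomorphism on `H₁` (`periodHom`), and by the
fundamental theorem of calculus its value on the class of a piecewise smooth loop is the integral
along the loop (`deRhamPairing_loopClass`). A loop that bounds a disc is the boundary of a singular
2-simplex, the disc being a cone over the loop (`loopClass_eq_zero_of_disc`).
-/

/-! ### Forms along maps, and integrals with parameters -/

noncomputable section

lemma two_le_infty : (2 : WithTop ℕ∞) ≤ ∞ := by
  exact WithTop.coe_le_coe.2 (le_top : (2 : ℕ∞) ≤ ⊤)

section Alternating
variable {E V : Type*} [NormedAddCommGroup E] [NormedSpace ℝ E]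
  [NormedAddCommGroup V] [NormedSpace ℝ V]

lemma contDiff_alternating_apply {ι : Type*} [Fintype ι] {r : WithTop ℕ∞} :
    ContDiff ℝ r (fun p : (E [⋀^ι]→L[ℝ] ℝ) × (ι → E) => p.1 p.2) := by
  refine contDiff_iff_contDiffAt.2 fun p => ?_
  exact ((ContinuousAlternatingMap.toContinuousMultilinearMapCLM (ι := ι) (E := E) (F := ℝ)
    (𝕜 := ℝ) ℝ).analyticAt_uncurry_of_multilinear (x := p)).contDiffAt

end Alternating

section PullWithin

variable {V : Type*} [NormedAddCommGroup V] [NormedSpace ℝ V]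
  {m : ℕ} {X : Type*} [TopologicalSpace X] [ChartedSpace (EuclideanSpace ℝ (Fin m)) X] {k : ℕ}

/-- A form, as a family of alternating forms on the model space. -/
abbrev DForm.toModel (α : DForm m X k) (x : X) : EuclideanSpace ℝ (Fin m) [⋀^Fin k]→L[ℝ] ℝ := α x

/-- The derivative, relative to `K`, of a map from a subset `K` of a normed space to a manifold,
with values in the model space. -/
def derivOn (c : V → X) (K : Set V) (q : V) : V →L[ℝ] EuclideanSpace ℝ (Fin m) :=
  mfderivWithin 𝓘(ℝ, V) (𝓡 m) c K q

/-- The pullback of a form on `X` along a map defined on a subset `K` of a normed space. -/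
def DForm.pullOn (α : DForm m X k) (c : V → X) (K : Set V) (q : V) : V [⋀^Fin k]→L[ℝ] ℝ :=
  (α.toModel (c q)).compContinuousLinearMap (derivOn c K q)

variable [IsManifold (𝓡 m) ∞ X]

/-- A form is recovered from its expression in a chart. -/
lemma DForm.inChart_extChartAt (α : DForm m X k) {x₀ x : X}
    (hx : x ∈ (extChartAt (𝓡 m) x₀).source) :
    (α.inChart x₀ (extChartAt (𝓡 m) x₀ x)).compContinuousLinearMap
      (mfderiv (𝓡 m) 𝓘(ℝ, EuclideanSpace ℝ (Fin m)) (extChartAt (𝓡 m) x₀) x) = α.toModel x := by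
  have h := mfderivWithin_extChartAt_symm_comp_mfderiv_extChartAt' (I := 𝓡 m) hx
  rw [ModelWithCorners.range_eq_univ, mfderivWithin_univ] at h
  ext v
  change α.toModel ((extChartAt (𝓡 m) x₀).symm
    (extChartAt (𝓡 m) x₀ x)) (fun i => (mfderiv 𝓘(ℝ, EuclideanSpace ℝ (Fin m)) (𝓡 m)
      (extChartAt (𝓡 m) x₀).symm (extChartAt (𝓡 m) x₀ x) ∘L mfderiv (𝓡 m)
        𝓘(ℝ, EuclideanSpace ℝ (Fin m)) (extChartAt (𝓡 m) x₀) x) (v i)) = _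
  rw [h, (extChartAt (𝓡 m) x₀).left_inv hx]
  rfl

/-- The pullback computed in a chart. -/
lemma DForm.pullOn_eq (α : DForm m X k) {c : V → X} {K : Set V} {q : V} {x₀ : X}
    (hK : UniqueDiffWithinAt ℝ K q) (hc : MDifferentiableWithinAt 𝓘(ℝ, V) (𝓡 m) c K q)
    (hx : c q ∈ (extChartAt (𝓡 m) x₀).source) :
    α.pullOn c K q = (α.inChart x₀ (extChartAt (𝓡 m) x₀ (c q))).compContinuousLinearMap
      (fderivWithin ℝ (extChartAt (𝓡 m) x₀ ∘ c) K q) := by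
  have h1 : fderivWithin ℝ (extChartAt (𝓡 m) x₀ ∘ c) K q =
      (mfderiv (𝓡 m) 𝓘(ℝ, EuclideanSpace ℝ (Fin m)) (extChartAt (𝓡 m) x₀) (c q)).comp
        (mfderivWithin 𝓘(ℝ, V) (𝓡 m) c K q) := by
    rw [← mfderivWithin_eq_fderivWithin]
    refine mfderiv_comp_mfderivWithin _ (mdifferentiableAt_extChartAt ?_) hc
      hK.uniqueMDiffWithinAt
    rwa [extChartAt_source] at hx
  rw [h1]
  unfold DForm.pullOn
  rw [← α.inChart_extChartAt hx]
  rfl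

/-- Smoothness of a map from a subset of a normed space, read in a chart. -/
lemma contDiffWithinAt_extChartAt_comp {c : V → X} {K : Set V} {q : V} {x₀ : X}
    (hc : ContMDiffWithinAt 𝓘(ℝ, V) (𝓡 m) ∞ c K q)
    (hx : c q ∈ (extChartAt (𝓡 m) x₀).source) :
    ContDiffWithinAt ℝ ∞ (extChartAt (𝓡 m) x₀ ∘ c) K q := by
  rw [← contMDiffWithinAt_iff_contDiffWithinAt]
  refine ContMDiffAt.comp_contMDiffWithinAt q ?_ hc
  refine contMDiffAt_extChartAt' ?_
  rwa [extChartAt_source] at hx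

lemma DForm.contDiffOn_pullOn_apply {α : DForm m X k} (hα : α.IsSmooth) {c : V → X} {K : Set V}
    (hK : UniqueDiffOn ℝ K) (hc : ContMDiffOn 𝓘(ℝ, V) (𝓡 m) ∞ c K) (v : Fin k → V) :
    ContDiffOn ℝ ∞ (fun q => α.pullOn c K q v) K := by
  intro q hq
  set x₀ := c q
  have hsrc : ∀ᶠ q' in 𝓝[K] q, c q' ∈ (extChartAt (𝓡 m) x₀).source :=
    (hc q hq).continuousWithinAt.preimage_mem_nhdsWithin (extChartAt_source_mem_nhds x₀)
  have hcd : ContDiffWithinAt ℝ ∞ (extChartAt (𝓡 m) x₀ ∘ c) K q :=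
    contDiffWithinAt_extChartAt_comp (hc q hq) (mem_extChartAt_source x₀)
  have hd : ContDiffWithinAt ℝ ∞ (fderivWithin ℝ (extChartAt (𝓡 m) x₀ ∘ c) K) K q :=
    hcd.fderivWithin_right hK (by simp) hq
  have h1 : ContDiffWithinAt ℝ ∞ (fun q' => α.inChart x₀ (extChartAt (𝓡 m) x₀ (c q'))) K q := by
    have := ((hα x₀).contDiffAt (extChartAt_target_mem_nhds (I := 𝓡 m) x₀))
    exact ContDiffAt.comp_contDiffWithinAt q this hcd
  have h2 : ContDiffWithinAt ℝ ∞ (fun q' => (α.inChart x₀ (extChartAt (𝓡 m) x₀ (c q')))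
      (fun i => fderivWithin ℝ (extChartAt (𝓡 m) x₀ ∘ c) K q' (v i))) K q := by
    refine ContDiffAt.comp_contDiffWithinAt (g := fun p : (EuclideanSpace ℝ (Fin m)
      [⋀^Fin k]→L[ℝ] ℝ) × (Fin k → EuclideanSpace ℝ (Fin m)) => p.1 p.2) (f := fun q' =>
      (α.inChart x₀ (extChartAt (𝓡 m) x₀ (c q')), fun i => fderivWithin ℝ
        (extChartAt (𝓡 m) x₀ ∘ c) K q' (v i))) q contDiff_alternating_apply.contDiffAt ?_
    exact h1.prodMk (contDiffWithinAt_pi.2 fun i => hd.clm_apply contDiffWithinAt_const)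
  refine h2.congr_of_eventuallyEq_of_mem ?_ hq
  filter_upwards [hsrc, self_mem_nhdsWithin] with q' h3 h4
  rw [α.pullOn_eq (hK q' h4) ((hc q' h4).mdifferentiableWithinAt (by simp)) h3]
  rfl

/-- The pullback of a closed form is closed. -/
lemma DForm.extDeriv_pullOn {α : DForm m X k} (hα : α.IsSmooth) (hα' : α.IsClosed) {c : V → X}
    {K : Set V} (hK : IsOpen K) (hc : ContMDiffOn 𝓘(ℝ, V) (𝓡 m) ∞ c K) {q : V} (hq : q ∈ K) :
    DifferentiableAt ℝ (α.pullOn c K) q ∧ extDeriv (α.pullOn c K) q = 0 := by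
  set x₀ := c q
  have hKq := hK.mem_nhds hq
  have hsrc : ∀ᶠ q' in 𝓝 q, c q' ∈ (extChartAt (𝓡 m) x₀).source :=
    ((hc q hq).contMDiffAt hKq).continuousAt.preimage_mem_nhds (extChartAt_source_mem_nhds x₀)
  have hcd : ContDiffAt ℝ ∞ (extChartAt (𝓡 m) x₀ ∘ c) q :=
    (contDiffWithinAt_extChartAt_comp (hc q hq) (mem_extChartAt_source x₀)).contDiffAt hKq
  have he : α.pullOn c K =ᶠ[𝓝 q] fun q' => (α.inChart x₀ ((extChartAt (𝓡 m) x₀ ∘ c)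
      q')).compContinuousLinearMap (fderiv ℝ (extChartAt (𝓡 m) x₀ ∘ c) q') := by
    filter_upwards [hsrc, hKq] with q' h3 h4
    rw [α.pullOn_eq (hK.uniqueDiffOn q' h4) ((hc q' h4).mdifferentiableWithinAt (by simp)) h3,
      fderivWithin_of_isOpen hK h4]
    rfl
  have hdα := hα.differentiableAt x₀ (mem_extChartAt_target (I := 𝓡 m) x₀)
  constructor
  · refine DifferentiableAt.congr_of_eventuallyEq ?_ he
    refine DifferentiableAt.continuousAlternatingMapCompContinuousLinearMap ?_ ?_
    · exact DifferentiableAt.comp q hdα (hcd.differentiableAt (by simp))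
    · exact (hcd.fderiv_right (m := 1)
        (by rw [one_add_one_eq_two]; exact two_le_infty)).differentiableAt (by simp)
  · rw [he.extDeriv_eq, extDeriv_pullback (f := extChartAt (𝓡 m) x₀ ∘ c) (r := ∞) hdα hcd
      (by simpa using two_le_infty)]
    change (extDeriv (α.inChart x₀) (extChartAt (𝓡 m) x₀ x₀)).compContinuousLinearMap _ = 0
    rw [hα' x₀ _ (mem_extChartAt_target (I := 𝓡 m) x₀)]
    rfl

end PullWithin

section Parametric

universe u

variable {E F : Type*} [NormedAddCommGroup E] [NormedSpace ℝ E] [FiniteDimensional ℝ E]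
  [NormedAddCommGroup F] [NormedSpace ℝ F]

open MeasureTheory

/-- Differentiation under the integral sign, for integrands that are `C¹` up to the boundary. -/
lemma hasFDerivAt_intervalIntegral_param {U : Set E} (hU : IsOpen U) {a b : ℝ} (hab : a < b)
    {g : E × ℝ → F} (hg : ContDiffOn ℝ 1 g (U ×ˢ Icc a b)) {y : E} (hy : y ∈ U) :
    HasFDerivAt (fun y => ∫ t in a..b, g (y, t))
      (∫ t in a..b, (fderivWithin ℝ g (U ×ˢ Icc a b) (y, t)).comp (.inl ℝ E ℝ)) y := by
  have hud : UniqueDiffOn ℝ (U ×ˢ Icc a b) := hU.uniqueDiffOn.prod (uniqueDiffOn_Icc hab)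
  set g' : E × ℝ → (E →L[ℝ] F) :=
    fun p => (fderivWithin ℝ g (U ×ˢ Icc a b) p).comp (.inl ℝ E ℝ)
  have hg'c : ContinuousOn g' (U ×ˢ Icc a b) :=
    (hg.continuousOn_fderivWithin hud le_rfl).clm_comp continuousOn_const
  obtain ⟨ε, hε, hεU⟩ := Metric.nhds_basis_closedBall.mem_iff.1 (hU.mem_nhds hy)
  obtain ⟨C, hC⟩ := ((isCompact_closedBall y ε).prod (isCompact_Icc (a := a) (b := b))
    ).exists_bound_of_continuousOn (hg'c.mono (prod_mono hεU subset_rfl))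
  have hslice : ∀ z ∈ U, ContinuousOn (fun t => g (z, t)) (Icc a b) := fun z hz =>
    hg.continuousOn.comp (by fun_prop) (fun t ht => ⟨hz, ht⟩)
  have hslice' : ContinuousOn (fun t => g' (y, t)) (Icc a b) :=
    hg'c.comp (by fun_prop) (fun t ht => ⟨hy, ht⟩)
  have hI : uIoc a b ⊆ Icc a b := by rw [uIoc_of_le hab.le]; exact Ioc_subset_Icc_self
  refine intervalIntegral.hasFDerivAt_integral_of_dominated_of_fderiv_le
    (F := fun z t => g (z, t)) (F' := fun z t => g' (z, t)) (bound := fun _ => C)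
    (Metric.ball_mem_nhds y hε) ?_ ?_ ?_ ?_ ?_ ?_
  · filter_upwards [hU.mem_nhds hy] with z hz
    exact ((hslice z hz).aestronglyMeasurable measurableSet_Icc).mono_measure
      (Measure.restrict_mono hI le_rfl)
  · exact (ContinuousOn.intervalIntegrable (by rw [uIcc_of_le hab.le]; exact hslice y hy))
  · exact (hslice'.aestronglyMeasurable measurableSet_Icc).mono_measure
      (Measure.restrict_mono hI le_rfl)
  · refine Eventually.of_forall fun t ht z hz => hC (z, t) ⟨Metric.ball_subset_closedBall hz, hI ht⟩
  · exact intervalIntegrable_const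
  · refine Eventually.of_forall fun t ht z hz => ?_
    have hzU : z ∈ U := hεU (Metric.ball_subset_closedBall hz)
    have h1 : HasFDerivWithinAt g (fderivWithin ℝ g (U ×ˢ Icc a b) (z, t)) (U ×ˢ Icc a b) (z, t) :=
      ((hg.differentiableOn (by simp)) (z, t) ⟨hzU, hI ht⟩).hasFDerivWithinAt
    have h2 : HasFDerivWithinAt (fun z : E => (z, t)) (.inl ℝ E ℝ) U z :=
      (hasFDerivAt_prodMk_left z t).hasFDerivWithinAt
    exact (h1.comp z h2 (fun w (hw : w ∈ U) => mk_mem_prod hw (hI ht))).hasFDerivAt (hU.mem_nhds hzU)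

/-- Smoothness of integrals with parameters. The two spaces share a universe because the induction
replaces `F` by `E →L[ℝ] F`. -/
lemma contDiffOn_intervalIntegral_param {E F : Type u} [NormedAddCommGroup E] [NormedSpace ℝ E]
    [FiniteDimensional ℝ E] [NormedAddCommGroup F] [NormedSpace ℝ F] [CompleteSpace F]
    {U : Set E} (hU : IsOpen U) {a b : ℝ} (hab : a < b)
    {g : E × ℝ → F} (hg : ContDiffOn ℝ ∞ g (U ×ˢ Icc a b)) :
    ContDiffOn ℝ ∞ (fun y => ∫ t in a..b, g (y, t)) U := by
  have hud : UniqueDiffOn ℝ (U ×ˢ Icc a b) := hU.uniqueDiffOn.prod (uniqueDiffOn_Icc hab)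
  rw [contDiffOn_infty]
  intro k
  induction k generalizing F with
  | zero =>
    rw [Nat.cast_zero, contDiffOn_zero]
    intro y hy
    exact (hasFDerivAt_intervalIntegral_param hU hab (hg.of_le (by simp))
      hy).continuousAt.continuousWithinAt
  | succ k ih =>
    have hg1 : ContDiffOn ℝ 1 g (U ×ˢ Icc a b) := hg.of_le (by simp)
    rw [Nat.cast_add, Nat.cast_one, contDiffOn_succ_iff_fderiv_of_isOpen hU]
    refine ⟨fun y hy => (hasFDerivAt_intervalIntegral_param hU hab hg1
      hy).differentiableAt.differentiableWithinAt, by simp, ?_⟩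
    have hg' : ContDiffOn ℝ ∞ (fun p => (fderivWithin ℝ g (U ×ˢ Icc a b) p).comp (.inl ℝ E ℝ))
        (U ×ˢ Icc a b) :=
      (hg.fderivWithin hud (by simp)).clm_comp contDiffOn_const
    refine (ih hg').congr fun y hy => ?_
    exact (hasFDerivAt_intervalIntegral_param hU hab hg1 hy).fderiv

end Parametric
end

/-! ### Maps to the cylinder -/

noncomputable section

section Sweep

variable {V : Type*} [NormedAddCommGroup V] [NormedSpace ℝ V]
  {n m : ℕ} {X : Type*} [TopologicalSpace X] [ChartedSpace (EuclideanSpace ℝ (Fin m)) X]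
  {L : Type*} [TopologicalSpace L] [ChartedSpace (EuclideanSpace ℝ (Fin n)) L]

/-- The map `(q, t) ↦ (f q, t)` to the cylinder `L × [0,1]`; times outside `[0,1]` are projected to
the nearest end. -/
def sweep (f : V → L) (q : V × ℝ) : L × Icc (0 : ℝ) 1 := (f q.1, projIcc 0 1 zero_le_one q.2)

lemma hasMFDerivWithinAt_projIcc {t : ℝ} (ht : t ∈ Icc (0 : ℝ) 1) :
    HasMFDerivWithinAt 𝓘(ℝ, ℝ) (𝓡∂ 1) (projIcc (0 : ℝ) 1 zero_le_one) (Icc 0 1) t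
      (ContinuousLinearMap.toSpanSingleton ℝ
        (oneTangentSpaceIcc (projIcc (0 : ℝ) 1 zero_le_one t) : EuclideanSpace ℝ (Fin 1))) := by
  have h := ((contMDiffOn_projIcc (x := (0 : ℝ)) (y := 1) (n := ∞) t ht).mdifferentiableWithinAt
    (by simp)).hasMFDerivWithinAt
  have h1 := mfderivWithin_projIcc_one (x := (0 : ℝ)) (y := 1) ht
  have he : ContinuousLinearMap.toSpanSingleton ℝ
      (oneTangentSpaceIcc (projIcc (0 : ℝ) 1 zero_le_one t) : EuclideanSpace ℝ (Fin 1)) =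
        (mfderivWithin 𝓘(ℝ, ℝ) (𝓡∂ 1) (projIcc (0 : ℝ) 1 zero_le_one) (Icc 0 1) t :
          ℝ →L[ℝ] EuclideanSpace ℝ (Fin 1)) :=
    ContinuousLinearMap.ext_ring ((one_smul ℝ _).trans h1.symm)
  rw [he]
  exact h

lemma hasMFDerivWithinAt_sweep {f : V → L} {K : Set V} {q : V} {t : ℝ}
    {f' : V →L[ℝ] EuclideanSpace ℝ (Fin n)}
    (hf : HasMFDerivWithinAt 𝓘(ℝ, V) (𝓡 n) f K q f') (ht : t ∈ Icc (0 : ℝ) 1) :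
    HasMFDerivWithinAt 𝓘(ℝ, V × ℝ) (cylModel n) (sweep f) (K ×ˢ Icc 0 1) (q, t)
      (f'.prodMap (ContinuousLinearMap.toSpanSingleton ℝ
        (oneTangentSpaceIcc (projIcc (0 : ℝ) 1 zero_le_one t) : EuclideanSpace ℝ (Fin 1)))) := by
  have h1 : HasMFDerivWithinAt 𝓘(ℝ, V × ℝ) 𝓘(ℝ, V) (Prod.fst : V × ℝ → V) (K ×ˢ Icc 0 1) (q, t)
      (ContinuousLinearMap.fst ℝ V ℝ) := hasFDerivWithinAt_fst.hasMFDerivWithinAt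
  have h2 : HasMFDerivWithinAt 𝓘(ℝ, V × ℝ) 𝓘(ℝ, ℝ) (Prod.snd : V × ℝ → ℝ) (K ×ˢ Icc 0 1) (q, t)
      (ContinuousLinearMap.snd ℝ V ℝ) := hasFDerivWithinAt_snd.hasMFDerivWithinAt
  have h3 := HasMFDerivWithinAt.comp (q, t) (u := K) hf h1 (fun p hp => hp.1)
  have h4 := HasMFDerivWithinAt.comp (q, t) (u := Icc (0 : ℝ) 1) (hasMFDerivWithinAt_projIcc ht) h2
    (fun p hp => hp.2)
  exact h3.prodMk h4

lemma contMDiffOn_sweep {f : V → L} {K : Set V} (hf : ContMDiffOn 𝓘(ℝ, V) (𝓡 n) ∞ f K) :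
    ContMDiffOn 𝓘(ℝ, V × ℝ) (cylModel n) ∞ (sweep f) (K ×ˢ Icc 0 1) := by
  refine ContMDiffOn.prodMk ?_ ?_
  · exact hf.comp contDiff_fst.contMDiff.contMDiffOn (fun p hp => hp.1)
  · exact (contMDiffOn_projIcc (x := (0 : ℝ)) (y := 1) (n := ∞)).comp
      contDiff_snd.contMDiff.contMDiffOn (fun p hp => hp.2)

/-- The derivative of the map swept out by `f` under a homotopy `ψ`. -/
lemma derivOn_comp_sweep {ψ : L × Icc (0 : ℝ) 1 → X} {f : V → L} {K : Set V} {q : V} {t : ℝ}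
    {f' : V →L[ℝ] EuclideanSpace ℝ (Fin n)}
    (hf : HasMFDerivWithinAt 𝓘(ℝ, V) (𝓡 n) f K q f') (hK : UniqueDiffWithinAt ℝ K q)
    (ht : t ∈ Icc (0 : ℝ) 1)
    (hψ : MDifferentiableAt (cylModel n) (𝓡 m) ψ (sweep f (q, t))) (v : V) (r : ℝ) :
    derivOn (ψ ∘ sweep f) (K ×ˢ Icc 0 1) (q, t) (v, r) =
      mfderiv (cylModel n) (𝓡 m) ψ (sweep f (q, t)) ((f' v, r •
        (oneTangentSpaceIcc (projIcc (0 : ℝ) 1 zero_le_one t) : EuclideanSpace ℝ (Fin 1))) :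
        EuclideanSpace ℝ (Fin n) × EuclideanSpace ℝ (Fin 1)) := by
  have h := hψ.hasMFDerivAt.comp_hasMFDerivWithinAt (q, t) (hasMFDerivWithinAt_sweep hf ht)
  have hu : UniqueDiffWithinAt ℝ (K ×ˢ Icc (0 : ℝ) 1) (q, t) :=
    hK.prod (uniqueDiffOn_Icc zero_lt_one t ht)
  unfold derivOn
  rw [h.mfderivWithin hu.uniqueMDiffWithinAt]
  rfl

end Sweep
end

/-! ### The form `θ_ψ` -/

noncomputable section

open MeasureTheory

section OneForms

variable {E : Type*} [NormedAddCommGroup E] [NormedSpace ℝ E]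

lemma apply_fin_one (α : E [⋀^Fin 1]→L[ℝ] ℝ) (v : Fin 1 → E) :
    α v = (ContinuousAlternatingMap.ofSubsingletonLIE (𝕜 := ℝ) (E := E) (F := ℝ)
      (0 : Fin 1)).symm α (v 0) := by
  have : v = fun _ => v 0 := by funext i; rw [Subsingleton.elim i 0]
  conv_lhs => rw [this]
  rfl

lemma contDiffOn_oneForm {D : Type*} [NormedAddCommGroup D] [NormedSpace ℝ D]
    [FiniteDimensional ℝ E] {r : WithTop ℕ∞} {α : D → E [⋀^Fin 1]→L[ℝ] ℝ} {s : Set D}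
    (h : ∀ v : E, ContDiffOn ℝ r (fun x => α x ![v]) s) : ContDiffOn ℝ r α s := by
  set e := ContinuousAlternatingMap.ofSubsingletonLIE (𝕜 := ℝ) (E := E) (F := ℝ) (0 : Fin 1)
  have h1 : ContDiffOn ℝ r (fun x => e.symm (α x)) s := by
    rw [contDiffOn_clm_apply]
    intro v
    refine (h v).congr fun x _ => ?_
    rw [apply_fin_one]
    rfl
  have h2 := e.contDiff (n := r).comp_contDiffOn h1
  refine h2.congr fun x _ => ?_
  exact (e.apply_symm_apply (α x)).symm

lemma extDeriv_oneForm_apply {α : E → E [⋀^Fin 1]→L[ℝ] ℝ} {x : E}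
    (h : DifferentiableAt ℝ α x) (v : Fin 2 → E) :
    extDeriv α x v = fderiv ℝ (fun y => α y ![v 1]) x (v 0) -
      fderiv ℝ (fun y => α y ![v 0]) x (v 1) := by
  have e0 : Fin.removeNth 0 v = ![v 1] := by funext i; fin_cases i; rfl
  have e1 : Fin.removeNth 1 v = ![v 0] := by funext i; fin_cases i; rfl
  rw [extDeriv_apply h, Fin.sum_univ_two, e0, e1]
  simp [sub_eq_add_neg]

lemma extDeriv_twoForm_apply {α : E → E [⋀^Fin 2]→L[ℝ] ℝ} {x : E}
    (h : DifferentiableAt ℝ α x) (v : Fin 3 → E) :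
    extDeriv α x v = fderiv ℝ (fun y => α y ![v 1, v 2]) x (v 0) -
      fderiv ℝ (fun y => α y ![v 0, v 2]) x (v 1) + fderiv ℝ (fun y => α y ![v 0, v 1]) x (v 2) := by
  have e0 : Fin.removeNth 0 v = ![v 1, v 2] := by funext i; fin_cases i <;> rfl
  have e1 : Fin.removeNth 1 v = ![v 0, v 2] := by funext i; fin_cases i <;> rfl
  have e2 : Fin.removeNth 2 v = ![v 0, v 1] := by funext i; fin_cases i <;> rfl
  rw [extDeriv_apply h, Fin.sum_univ_three, e0, e1, e2]
  simp [sub_eq_add_neg]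

end OneForms

section Theta

variable {n : ℕ} {X : Type*} [TopologicalSpace X]
  [ChartedSpace (EuclideanSpace ℝ (Fin (2 * n))) X] [IsManifold (𝓡 (2 * n)) ∞ X]
  {S : SymplecticBField n X} {L : Type*} [TopologicalSpace L]
  [ChartedSpace (EuclideanSpace ℝ (Fin n)) L] [IsManifold (𝓡 n) ∞ L]
  {L' : Type*} [TopologicalSpace L']
  [ChartedSpace (EuclideanSpace ℝ (Fin n)) L'] [IsManifold (𝓡 n) ∞ L']
  {O : LagObject S L} {O' : LagObject S L'}

namespace LagIsotopy

/-- The cylinder over the chart at `x₀`. -/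
def chartCyl (n : ℕ) {L : Type*} [TopologicalSpace L] [ChartedSpace (EuclideanSpace ℝ (Fin n)) L]
    (x₀ : L) : Set (EuclideanSpace ℝ (Fin n) × ℝ) :=
  (extChartAt (𝓡 n) x₀).target ×ˢ Icc 0 1

omit [IsManifold (𝓡 n) ∞ L] in
lemma uniqueDiffOn_chartCyl (x₀ : L) : UniqueDiffOn ℝ (chartCyl n x₀) :=
  (isOpen_extChartAt_target x₀).uniqueDiffOn.prod (uniqueDiffOn_Icc zero_lt_one)

/-- The symplectic form pulled back to the cylinder over a chart. -/
def cylForm (Ψ : LagIsotopy O O') (x₀ : L) :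
    EuclideanSpace ℝ (Fin n) × ℝ → (EuclideanSpace ℝ (Fin n) × ℝ) [⋀^Fin 2]→L[ℝ] ℝ :=
  S.symp.pullOn (Ψ.ψ ∘ sweep (extChartAt (𝓡 n) x₀).symm) (chartCyl n x₀)

omit [IsManifold (𝓡 (2 * n)) ∞ X] in
lemma contMDiffOn_chartSweep (Ψ : LagIsotopy O O') (x₀ : L) :
    ContMDiffOn 𝓘(ℝ, EuclideanSpace ℝ (Fin n) × ℝ) (𝓡 (2 * n)) ∞
      (Ψ.ψ ∘ sweep (extChartAt (𝓡 n) x₀).symm) (chartCyl n x₀) :=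
  Ψ.smooth.comp_contMDiffOn (contMDiffOn_sweep (contMDiffOn_extChartAt_symm x₀))

lemma contDiffOn_cylForm (Ψ : LagIsotopy O O') (x₀ : L)
    (v : Fin 2 → EuclideanSpace ℝ (Fin n) × ℝ) :
    ContDiffOn ℝ ∞ (fun q => Ψ.cylForm x₀ q v) (chartCyl n x₀) :=
  DForm.contDiffOn_pullOn_apply S.symp_smooth (uniqueDiffOn_chartCyl x₀)
    (Ψ.contMDiffOn_chartSweep x₀) v

/-- The derivative of the inverse of the chart at `x₀`, as a map of model spaces. -/
def chartSymmDeriv (x₀ : L) (y : EuclideanSpace ℝ (Fin n)) :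
    EuclideanSpace ℝ (Fin n) →L[ℝ] EuclideanSpace ℝ (Fin n) :=
  mfderiv 𝓘(ℝ, EuclideanSpace ℝ (Fin n)) (𝓡 n) (extChartAt (𝓡 n) x₀).symm y

omit [IsManifold (𝓡 (2 * n)) ∞ X] in
lemma cylForm_apply (Ψ : LagIsotopy O O') (x₀ : L) {y : EuclideanSpace ℝ (Fin n)} {t : ℝ}
    (hy : y ∈ (extChartAt (𝓡 n) x₀).target) (ht : t ∈ Icc (0 : ℝ) 1)
    (v w : EuclideanSpace ℝ (Fin n)) (r r' : ℝ) :
    Ψ.cylForm x₀ (y, t) ![(v, r), (w, r')] =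
      S.symp.pullback (cylModel n) Ψ.ψ ((extChartAt (𝓡 n) x₀).symm y, projIcc 0 1 zero_le_one t)
        ![((chartSymmDeriv x₀ y v,
          r • (oneTangentSpaceIcc (projIcc (0 : ℝ) 1 zero_le_one t) : EuclideanSpace ℝ (Fin 1))) :
            EuclideanSpace ℝ (Fin n) × EuclideanSpace ℝ (Fin 1)),
          ((chartSymmDeriv x₀ y w,
          r' • (oneTangentSpaceIcc (projIcc (0 : ℝ) 1 zero_le_one t) : EuclideanSpace ℝ (Fin 1))) :
            EuclideanSpace ℝ (Fin n) × EuclideanSpace ℝ (Fin 1))] := by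
  have hf : HasMFDerivWithinAt 𝓘(ℝ, EuclideanSpace ℝ (Fin n)) (𝓡 n) (extChartAt (𝓡 n) x₀).symm
      (extChartAt (𝓡 n) x₀).target y (mfderiv 𝓘(ℝ, EuclideanSpace ℝ (Fin n)) (𝓡 n)
        (extChartAt (𝓡 n) x₀).symm y) :=
    (((contMDiffOn_extChartAt_symm (n := ∞) x₀).contMDiffAt ((isOpen_extChartAt_target x₀).mem_nhds
      hy)).mdifferentiableAt (by simp)).hasMFDerivAt.hasMFDerivWithinAt
  have key := fun v r => derivOn_comp_sweep hf ((isOpen_extChartAt_target x₀).uniqueDiffOn y hy) ht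
    (Ψ.smooth.mdifferentiable (by simp) _) v r
  refine congrArg (S.symp.toModel (Ψ.ψ (sweep (extChartAt (𝓡 n) x₀).symm (y, t)))) ?_
  funext i
  fin_cases i
  · exact key v r
  · exact key w r'

omit [IsManifold (𝓡 (2 * n)) ∞ X] in
lemma b_inChart (Ψ : LagIsotopy O O') (x₀ : L) {y : EuclideanSpace ℝ (Fin n)} {t : ℝ}
    (hy : y ∈ (extChartAt (𝓡 n) x₀).target) (ht : t ∈ Icc (0 : ℝ) 1)
    (v : EuclideanSpace ℝ (Fin n)) :
    (Ψ.b (projIcc 0 1 zero_le_one t)).inChart x₀ y ![v] = Ψ.cylForm x₀ (y, t) ![(v, 0), (0, 1)] := by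
  rw [Ψ.cylForm_apply x₀ hy ht]
  have h := Ψ.b_apply (projIcc 0 1 zero_le_one t) ((extChartAt (𝓡 n) x₀).symm y)
    (chartSymmDeriv x₀ y v)
  rw [zero_smul, one_smul, map_zero]
  refine Eq.trans ?_ h
  refine congrArg (DForm.toModel (Ψ.b (projIcc 0 1 zero_le_one t)) ((extChartAt (𝓡 n) x₀).symm y)) ?_
  funext i
  fin_cases i
  rfl

/-- The forms `b_t` depend continuously on `t`. -/
lemma continuousOn_b (Ψ : LagIsotopy O O') (p : L) :
    ContinuousOn (fun t : ℝ => (Ψ.b (projIcc 0 1 zero_le_one t)).toModel p) (Icc 0 1) := by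
  rw [← contDiffOn_zero (𝕜 := ℝ)]
  refine contDiffOn_oneForm fun v => ?_
  rw [contDiffOn_zero]
  have h := ((Ψ.contDiffOn_cylForm p ![(mfderiv (𝓡 n) 𝓘(ℝ, EuclideanSpace ℝ (Fin n))
    (extChartAt (𝓡 n) p) p v, 0), (0, 1)]).continuousOn).comp
      (f := fun t : ℝ => (extChartAt (𝓡 n) p p, t)) (s := Icc 0 1) (by fun_prop)
      (fun t ht => ⟨mem_extChartAt_target p, ht⟩)
  refine h.congr fun t ht => ?_
  have h1 := (Ψ.b (projIcc 0 1 zero_le_one t)).inChart_extChartAt (mem_extChartAt_source p)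
  rw [← h1]
  refine Eq.trans ?_ (Ψ.b_inChart p (mem_extChartAt_target p) ht _)
  refine congrArg ((Ψ.b (projIcc 0 1 zero_le_one t)).inChart p (extChartAt (𝓡 n) p p)) ?_
  funext i
  fin_cases i
  rfl

lemma intervalIntegrable_b (Ψ : LagIsotopy O O') (p : L) :
    IntervalIntegrable (fun t : ℝ => (Ψ.b (projIcc 0 1 zero_le_one t)).toModel p) volume 0 1 :=
  ContinuousOn.intervalIntegrable (by rw [uIcc_of_le zero_le_one]; exact Ψ.continuousOn_b p)

lemma theta_apply (Ψ : LagIsotopy O O') (p : L) (v : Fin 1 → EuclideanSpace ℝ (Fin n)) :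
    Ψ.theta.toModel p v = ∫ t in (0 : ℝ)..1, (Ψ.b (projIcc 0 1 zero_le_one t)).toModel p v :=
  ((ContinuousAlternatingMap.apply ℝ (EuclideanSpace ℝ (Fin n)) ℝ v).intervalIntegral_comp_comm
    (Ψ.intervalIntegrable_b p)).symm

lemma theta_inChart (Ψ : LagIsotopy O O') (x₀ : L) {y : EuclideanSpace ℝ (Fin n)}
    (hy : y ∈ (extChartAt (𝓡 n) x₀).target) (v : EuclideanSpace ℝ (Fin n)) :
    Ψ.theta.inChart x₀ y ![v] = ∫ t in (0 : ℝ)..1, Ψ.cylForm x₀ (y, t) ![(v, 0), (0, 1)] := by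
  refine (Ψ.theta_apply ((extChartAt (𝓡 n) x₀).symm y) _).trans ?_
  refine intervalIntegral.integral_congr fun t ht => ?_
  rw [uIcc_of_le zero_le_one] at ht
  exact Ψ.b_inChart x₀ hy ht v

lemma theta_isSmooth (Ψ : LagIsotopy O O') : Ψ.theta.IsSmooth := by
  intro x₀
  refine contDiffOn_oneForm fun v => ?_
  refine (contDiffOn_intervalIntegral_param (isOpen_extChartAt_target x₀) zero_lt_one
    (Ψ.contDiffOn_cylForm x₀ ![(v, 0), (0, 1)])).congr fun y hy => ?_
  exact Ψ.theta_inChart x₀ hy v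

omit [IsManifold (𝓡 (2 * n)) ∞ X] in
/-- Since every `ψ_t(L)` is Lagrangian, `ψ^* ω` vanishes on pairs of vectors tangent to `L`. -/
lemma cylForm_horizontal (Ψ : LagIsotopy O O') (x₀ : L) {q : EuclideanSpace ℝ (Fin n) × ℝ}
    (hq : q ∈ chartCyl n x₀) (v w : EuclideanSpace ℝ (Fin n)) :
    Ψ.cylForm x₀ q ![(v, 0), (w, 0)] = 0 := by
  obtain ⟨y, t⟩ := q
  rw [Ψ.cylForm_apply x₀ hq.1 hq.2]
  set p := (extChartAt (𝓡 n) x₀).symm y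
  set τ : Icc (0 : ℝ) 1 := projIcc 0 1 zero_le_one t
  have h1 : HasMFDerivAt (𝓡 n) (cylModel n) (fun p' : L => (p', τ)) p
      (ContinuousLinearMap.inl ℝ (EuclideanSpace ℝ (Fin n)) (EuclideanSpace ℝ (Fin 1))) :=
    (hasMFDerivAt_id p).prodMk (hasMFDerivAt_const τ p)
  have h2 := ((Ψ.smooth.mdifferentiable (by simp) (p, τ)).hasMFDerivAt.comp p h1).mfderiv
  have h3 := Ψ.lagrangian τ p
  have h4 := congrArg (fun T : EuclideanSpace ℝ (Fin n) [⋀^Fin 2]→L[ℝ] ℝ =>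
    T ![chartSymmDeriv x₀ y v, chartSymmDeriv x₀ y w]) h3
  refine Eq.trans ?_ h4
  rw [zero_smul]
  refine congrArg (S.symp.toModel (Ψ.ψ (p, τ))) ?_
  have h5 : ∀ a : EuclideanSpace ℝ (Fin n), mfderiv (cylModel n) (𝓡 (2 * n)) Ψ.ψ (p, τ)
      ((a, 0) : EuclideanSpace ℝ (Fin n) × EuclideanSpace ℝ (Fin 1)) =
        mfderiv (𝓡 n) (𝓡 (2 * n)) (fun p' => Ψ.ψ (p', τ)) p a := fun a =>
    (congrArg (fun T : EuclideanSpace ℝ (Fin n) →L[ℝ] EuclideanSpace ℝ (Fin (2 * n)) => T a)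
      h2).symm
  funext i
  fin_cases i
  · exact h5 _
  · exact h5 _

/-- In the coordinates of a chart and `t`, differentiation under the integral sign reduces the claim
to the identity `∂_v ω(w, ∂_t) - ∂_w ω(v, ∂_t) = 0` for vectors `v`, `w` tangent to `L`. It is the
equation `dω = 0` on `v`, `w`, `∂_t`, whose third term `∂_t ω(v, w)` vanishes since every `ψ_t(L)`
is Lagrangian. -/
lemma theta_isClosed (Ψ : LagIsotopy O O') : Ψ.theta.IsClosed := by
  intro x₀ y hy
  have hU : IsOpen (extChartAt (𝓡 n) x₀).target := isOpen_extChartAt_target x₀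
  have hd : DifferentiableAt ℝ (Ψ.theta.inChart x₀) y :=
    ((Ψ.theta_isSmooth x₀).contDiffAt (hU.mem_nhds hy)).differentiableAt (by simp)
  have hint' : ∀ v, IntervalIntegrable (fun t : ℝ => (fderivWithin ℝ (fun q =>
      Ψ.cylForm x₀ q ![(v, 0), (0, 1)]) (chartCyl n x₀) (y, t)).comp (.inl ℝ _ ℝ)) volume 0 1 := by
    intro v
    refine ContinuousOn.intervalIntegrable ?_
    rw [uIcc_of_le zero_le_one]
    refine ContinuousOn.clm_comp ?_ continuousOn_const
    exact (((Ψ.contDiffOn_cylForm x₀ ![(v, 0), (0, 1)]).of_le (m := 1)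
      (by simp)).continuousOn_fderivWithin (uniqueDiffOn_chartCyl x₀) le_rfl).comp (by fun_prop)
        (fun t ht => ⟨hy, ht⟩)
  have hder : ∀ v u, fderiv ℝ (fun y => Ψ.theta.inChart x₀ y ![v]) y u =
      ∫ t in (0 : ℝ)..1, fderivWithin ℝ (fun q => Ψ.cylForm x₀ q ![(v, 0), (0, 1)])
        (chartCyl n x₀) (y, t) (u, 0) := by
    intro v u
    have hg := (Ψ.contDiffOn_cylForm x₀ ![(v, 0), (0, 1)]).of_le (m := 1) (by simp)
    have h1 := hasFDerivAt_intervalIntegral_param hU zero_lt_one hg hy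
    have h2 : (fun y => Ψ.theta.inChart x₀ y ![v]) =ᶠ[𝓝 y]
        fun y => ∫ t in (0 : ℝ)..1, Ψ.cylForm x₀ (y, t) ![(v, 0), (0, 1)] := by
      filter_upwards [hU.mem_nhds hy] with z hz using Ψ.theta_inChart x₀ hz v
    rw [h2.fderiv_eq, h1.fderiv]
    exact ContinuousLinearMap.intervalIntegral_apply (hint' v) u
  ext v
  have hint : ∀ v u, IntervalIntegrable (fun t : ℝ => fderivWithin ℝ (fun q =>
      Ψ.cylForm x₀ q ![(v, 0), (0, 1)]) (chartCyl n x₀) (y, t) (u, 0)) volume 0 1 := fun v u =>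
    ⟨(ContinuousLinearMap.apply ℝ ℝ u).integrable_comp (hint' v).1,
      (ContinuousLinearMap.apply ℝ ℝ u).integrable_comp (hint' v).2⟩
  rw [extDeriv_oneForm_apply hd, hder, hder,
    ← intervalIntegral.integral_sub (hint (v 1) (v 0)) (hint (v 0) (v 1))]
  refine (intervalIntegral.integral_congr_ae (g := fun _ => 0) ?_).trans (by simp)
  -- the exterior derivative is taken on the open cylinder; its ends are a null set of times
  filter_upwards [compl_mem_ae_iff.2 (measure_singleton (1 : ℝ))] with t ht1 ht
  rw [uIoc_of_le zero_le_one] at ht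
  have ht' : t ∈ Ioo (0 : ℝ) 1 := ⟨ht.1, lt_of_le_of_ne ht.2 ht1⟩
  set K₀ := (extChartAt (𝓡 n) x₀).target ×ˢ Ioo (0 : ℝ) 1
  have hK₀ : IsOpen K₀ := hU.prod isOpen_Ioo
  have hsub : K₀ ⊆ chartCyl n x₀ := prod_mono subset_rfl Ioo_subset_Icc_self
  have hq : (y, t) ∈ K₀ := ⟨hy, ht'⟩
  have hnhds : ∀ q ∈ K₀, chartCyl n x₀ ∈ 𝓝 q := fun q hq =>
    mem_of_superset (hK₀.mem_nhds hq) hsub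
  -- the same form, with derivatives relative to the open cylinder
  set Ω := S.symp.pullOn (Ψ.ψ ∘ sweep (extChartAt (𝓡 n) x₀).symm) K₀
  have hΩ : ∀ q ∈ K₀, Ψ.cylForm x₀ q = Ω q := by
    intro q hq
    have : derivOn (m := 2 * n) (Ψ.ψ ∘ sweep (extChartAt (𝓡 n) x₀).symm) (chartCyl n x₀) q =
        derivOn (Ψ.ψ ∘ sweep (extChartAt (𝓡 n) x₀).symm) K₀ q :=
      (mfderivWithin_of_mem_nhds (hnhds q hq)).trans
        (mfderivWithin_of_mem_nhds (hK₀.mem_nhds hq)).symm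
    simp only [cylForm, Ω, DForm.pullOn, this]
  have hΩ' : ∀ u : Fin 2 → EuclideanSpace ℝ (Fin n) × ℝ,
      fderivWithin ℝ (fun q => Ψ.cylForm x₀ q u) (chartCyl n x₀) (y, t) =
        fderiv ℝ (fun q => Ω q u) (y, t) := by
    intro u
    rw [fderivWithin_of_mem_nhds (hnhds _ hq)]
    refine Filter.EventuallyEq.fderiv_eq ?_
    filter_upwards [hK₀.mem_nhds hq] with q hq
    rw [hΩ q hq]
  obtain ⟨hdΩ, hclosed⟩ := DForm.extDeriv_pullOn S.symp_smooth S.symp_closed hK₀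
    ((Ψ.contMDiffOn_chartSweep x₀).mono hsub) hq
  have h3 := extDeriv_twoForm_apply hdΩ ![(v 0, 0), (v 1, 0), (0, 1)]
  have h4 : fderiv ℝ (fun q => Ω q ![(v 0, 0), (v 1, 0)]) (y, t) = 0 := by
    have : (fun q => Ω q ![(v 0, 0), (v 1, 0)]) =ᶠ[𝓝 (y, t)] fun _ => 0 := by
      filter_upwards [hK₀.mem_nhds hq] with q hq
      rw [← hΩ q hq, Ψ.cylForm_horizontal x₀ (hsub hq)]
    rw [this.fderiv_eq, fderiv_fun_const]
    rfl
  change _ = fderiv ℝ (fun q => Ω q ![(v 1, 0), (0, 1)]) (y, t) (v 0, 0) -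
    fderiv ℝ (fun q => Ω q ![(v 0, 0), (0, 1)]) (y, t) (v 1, 0) +
      fderiv ℝ (fun q => Ω q ![(v 0, 0), (v 1, 0)]) (y, t) (0, 1) at h3
  rw [hclosed, h4] at h3
  rw [hΩ', hΩ']
  change 0 = _ + 0 at h3
  rw [add_zero] at h3
  exact h3.symm

lemma theta_mem_closedOneForms (Ψ : LagIsotopy O O') : Ψ.theta ∈ closedOneForms n L :=
  ⟨Ψ.theta_isSmooth, Ψ.theta_isClosed⟩

/-- If `ψ^* ω = d(h dt)` then `θ_ψ` is the differential of `∫₀¹ h dt`. -/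
lemma IsExact.theta_mem_exactOneForms {Ψ : LagIsotopy O O'} (h : Ψ.IsExact) :
    Ψ.theta ∈ exactOneForms n L := by
  obtain ⟨h, hh, hdh⟩ := h
  set f : L → ℝ := fun p => ∫ t in (0 : ℝ)..1, h (p, projIcc 0 1 zero_le_one t)
  have hsm : ∀ x₀ : L, ContDiffOn ℝ ∞ (h ∘ sweep (extChartAt (𝓡 n) x₀).symm) (chartCyl n x₀) :=
    fun x₀ => contMDiffOn_iff_contDiffOn.1
      (hh.comp_contMDiffOn (contMDiffOn_sweep (contMDiffOn_extChartAt_symm x₀)))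
  have hfx : ∀ x₀ : L, f =ᶠ[𝓝 x₀] (fun y => ∫ t in (0 : ℝ)..1,
      (h ∘ sweep (extChartAt (𝓡 n) x₀).symm) (y, t)) ∘ extChartAt (𝓡 n) x₀ := by
    intro x₀
    filter_upwards [extChartAt_source_mem_nhds (I := 𝓡 n) x₀] with p hp
    simp only [f, sweep, Function.comp_apply, (extChartAt (𝓡 n) x₀).left_inv hp]
  have hcd : ∀ x₀ : L, ContDiffAt ℝ ∞ (fun y => ∫ t in (0 : ℝ)..1,
      (h ∘ sweep (extChartAt (𝓡 n) x₀).symm) (y, t)) (extChartAt (𝓡 n) x₀ x₀) := fun x₀ =>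
    (contDiffOn_intervalIntegral_param (isOpen_extChartAt_target x₀) zero_lt_one
      (hsm x₀)).contDiffAt (extChartAt_target_mem_nhds x₀)
  refine ⟨f, fun x₀ => ?_, fun x₀ v => ?_⟩
  · exact ((hcd x₀).contMDiffAt.comp x₀ contMDiffAt_extChartAt).congr_of_eventuallyEq (hfx x₀)
  set φ := extChartAt (𝓡 n) x₀
  set h' : L × Icc (0 : ℝ) 1 → (EuclideanSpace ℝ (Fin n) × EuclideanSpace ℝ (Fin 1)) →L[ℝ] ℝ :=
    fun q => mfderiv (cylModel n) 𝓘(ℝ, ℝ) h q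
  set v₀ : EuclideanSpace ℝ (Fin n) := v
  set dφ : EuclideanSpace ℝ (Fin n) →L[ℝ] EuclideanSpace ℝ (Fin n) :=
    mfderiv (𝓡 n) 𝓘(ℝ, EuclideanSpace ℝ (Fin n)) φ x₀
  have hy : φ x₀ ∈ φ.target := mem_extChartAt_target x₀
  have hg := (hsm x₀).of_le (m := 1) (by simp)
  have hG := hasFDerivAt_intervalIntegral_param (isOpen_extChartAt_target x₀) zero_lt_one hg hy
  have hmf : mfderiv (𝓡 n) 𝓘(ℝ, ℝ) f x₀ v =
      ∫ t in (0 : ℝ)..1, fderivWithin ℝ (h ∘ sweep φ.symm) (chartCyl n x₀) (φ x₀, t)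
        (dφ v₀, 0) := by
    have hφ : HasMFDerivAt (𝓡 n) 𝓘(ℝ, EuclideanSpace ℝ (Fin n)) φ x₀ dφ :=
      (mdifferentiableAt_extChartAt (mem_chart_source _ x₀)).hasMFDerivAt
    have hint : IntervalIntegrable (fun t : ℝ => (fderivWithin ℝ (h ∘ sweep φ.symm)
        (chartCyl n x₀) (φ x₀, t)).comp (.inl ℝ _ ℝ)) volume 0 1 := by
      refine ContinuousOn.intervalIntegrable ?_
      rw [uIcc_of_le zero_le_one]
      refine ContinuousOn.clm_comp ?_ continuousOn_const
      exact (hg.continuousOn_fderivWithin (uniqueDiffOn_chartCyl x₀) le_rfl).comp (by fun_prop)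
        (fun t ht => ⟨hy, ht⟩)
    rw [((HasMFDerivAt.comp x₀ hG.hasMFDerivAt hφ).congr_of_eventuallyEq (hfx x₀)).mfderiv]
    exact ContinuousLinearMap.intervalIntegral_apply hint (dφ v₀)
  rw [hmf]
  refine (Ψ.theta_apply x₀ ![v₀]).trans (intervalIntegral.integral_congr fun t ht => ?_)
  rw [uIcc_of_le zero_le_one] at ht
  set τ : Icc (0 : ℝ) 1 := projIcc 0 1 zero_le_one t
  set dval : EuclideanSpace ℝ (Fin 1) →L[ℝ] ℝ :=
    mfderiv (𝓡∂ 1) 𝓘(ℝ, ℝ) (Subtype.val : Icc (0 : ℝ) 1 → ℝ) τ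
  have hdval : dval (oneTangentSpaceIcc τ) = 1 := mfderiv_subtypeVal_Icc_one τ
  have hsnd : HasMFDerivAt (cylModel n) 𝓘(ℝ, ℝ) (fun q : L × Icc (0 : ℝ) 1 => (q.2 : ℝ)) (x₀, τ)
      (dval.comp
        (ContinuousLinearMap.snd ℝ (EuclideanSpace ℝ (Fin n)) (EuclideanSpace ℝ (Fin 1)))) :=
    ((contMDiff_subtypeVal_Icc (n := ∞)).mdifferentiable (by simp) τ).hasMFDerivAt.comp (x₀, τ)
      (hasMFDerivAt_snd (x₀, τ))
  have h1 : (Ψ.b τ).toModel x₀ ![v₀] = h' (x₀, τ) (v₀, 0) := by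
    refine (Ψ.b_apply τ x₀ v₀).trans ((hdh _ _ _).trans ?_)
    simp only [mvfderiv, hsnd.mfderiv]
    change h' (x₀, τ) (v₀, 0) * dval (oneTangentSpaceIcc τ) -
      h' (x₀, τ) (timeVector (x₀, τ)) * dval 0 = _
    rw [hdval, map_zero, mul_one, mul_zero, sub_zero]
  refine h1.trans ?_
  have hf : HasMFDerivWithinAt 𝓘(ℝ, EuclideanSpace ℝ (Fin n)) (𝓡 n) φ.symm φ.target (φ x₀)
      (chartSymmDeriv x₀ (φ x₀)) :=
    (((contMDiffOn_extChartAt_symm (n := ∞) x₀).contMDiffAt (extChartAt_target_mem_nhds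
      x₀)).mdifferentiableAt (by simp)).hasMFDerivAt.hasMFDerivWithinAt
  have h2 := ((hh.mdifferentiable (by simp) (sweep φ.symm (φ x₀, t))).hasMFDerivAt
    ).comp_hasMFDerivWithinAt (φ x₀, t) (hasMFDerivWithinAt_sweep hf ht)
  have h3 : fderivWithin ℝ (h ∘ sweep φ.symm) (chartCyl n x₀) (φ x₀, t) (dφ v₀, 0) =
      h' (sweep φ.symm (φ x₀, t)) (chartSymmDeriv x₀ (φ x₀) (dφ v₀), (0 : ℝ) •
        (oneTangentSpaceIcc τ : EuclideanSpace ℝ (Fin 1))) := by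
    rw [← mfderivWithin_eq_fderivWithin]
    exact congrArg (fun T : EuclideanSpace ℝ (Fin n) × ℝ →L[ℝ] ℝ => T (dφ v₀, 0))
      (h2.mfderivWithin (uniqueDiffOn_chartCyl x₀ _ ⟨hy, ht⟩).uniqueMDiffWithinAt)
  have h4 : chartSymmDeriv x₀ (φ x₀) (dφ v₀) = v₀ := by
    have := mfderivWithin_extChartAt_symm_comp_mfderiv_extChartAt' (I := 𝓡 n)
      (mem_extChartAt_source x₀)
    rw [ModelWithCorners.range_eq_univ, mfderivWithin_univ] at this
    exact congrArg (fun T : EuclideanSpace ℝ (Fin n) →L[ℝ] EuclideanSpace ℝ (Fin n) => T v₀) this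
  have h5 : sweep φ.symm (φ x₀, t) = (x₀, τ) := by simp only [sweep, φ, τ, extChartAt_to_inv]
  rw [h3, h4, h5, zero_smul]
  rfl

end LagIsotopy

end Theta
end

/-! ### Integrals over smooth cells -/

noncomputable section

section PlaneIntegrand

open MeasureTheory

variable {m : ℕ} {X : Type*} [TopologicalSpace X] [ChartedSpace (EuclideanSpace ℝ (Fin m)) X]

/-- The value of the 2-form `u^* β` on the standard frame `(1, i)` of the plane. -/
def planeIntegrand (β : DForm m X 2) (u : ℂ → X) (z : ℂ) : ℝ :=
  β (u z) ![mfderiv 𝓘(ℝ, ℂ) (𝓡 m) u z (1 : ℂ), mfderiv 𝓘(ℝ, ℂ) (𝓡 m) u z Complex.I]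

lemma discIntegral_eq (β : DForm m X 2) (u : ℂ → X) :
    discIntegral β u = ∫ z in Metric.ball (0 : ℂ) 1, planeIntegrand β u z := rfl

/-- An alternating 2-form on a plane is multiplied by the determinant under a linear map. -/
lemma alternating_two_comp {V : Type*} [NormedAddCommGroup V] [NormedSpace ℝ V]
    (α : V [⋀^Fin 2]→L[ℝ] ℝ) (T : ℂ →L[ℝ] V) (A : ℂ →L[ℝ] ℂ) :
    α ![T (A 1), T (A Complex.I)] = A.det * α ![T 1, T Complex.I] := by
  have hb : ∀ B : ℂ →ₗ[ℝ] ℂ, α ![T (B 1), T (B Complex.I)] =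
      (α.toAlternatingMap.compLinearMap (T : ℂ →ₗ[ℝ] V)) (B ∘ Complex.basisOneI) := by
    intro B
    change _ = α (fun i => T (B (Complex.basisOneI i)))
    congr 1
    funext i
    fin_cases i <;> simp
  have h := (α.toAlternatingMap.compLinearMap (T : ℂ →ₗ[ℝ] V)).eq_smul_basis_det Complex.basisOneI
  have h1 := hb (A : ℂ →ₗ[ℝ] ℂ)
  have h2 := hb LinearMap.id
  rw [h] at h1
  rw [AlternatingMap.smul_apply, Module.Basis.det_comp, Module.Basis.det_self, mul_one, smul_eq_mul,
    mul_comm] at h1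
  exact h1.trans (congrArg _ h2.symm)

/-- Differentiability may be tested after composition with a local diffeomorphism. -/
lemma mdifferentiableAt_of_comp {u : ℂ → X} {σ : ℂ → ℂ} {q : ℂ} {A : ℂ ≃L[ℝ] ℂ}
    (hσ : HasStrictFDerivAt σ (A : ℂ →L[ℝ] ℂ) q)
    (hu : MDifferentiableAt 𝓘(ℝ, ℂ) (𝓡 m) (u ∘ σ) q) :
    MDifferentiableAt 𝓘(ℝ, ℂ) (𝓡 m) u (σ q) := by
  have hg := hσ.to_localInverse
  have hq := hσ.localInverse_apply_image
  have h1 : MDifferentiableAt 𝓘(ℝ, ℂ) 𝓘(ℝ, ℂ) (hσ.localInverse σ A q) (σ q) :=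
    hg.hasFDerivAt.differentiableAt.mdifferentiableAt
  have h2 : MDifferentiableAt 𝓘(ℝ, ℂ) (𝓡 m) ((u ∘ σ) ∘ hσ.localInverse σ A q) (σ q) := by
    refine MDifferentiableAt.comp (σ q) ?_ h1
    rw [hq]; exact hu
  refine h2.congr_of_eventuallyEq ?_
  filter_upwards [hσ.eventually_right_inverse] with y hy
  simp [hy]

/-- A change of variables multiplies the integrand by its Jacobian. Only the composition is assumed
to be differentiable: a piecewise smooth map is smooth in the parameters of its cells. -/
lemma planeIntegrand_comp (β : DForm m X 2) {u : ℂ → X} {σ : ℂ → ℂ} {q : ℂ} {A : ℂ →L[ℝ] ℂ}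
    (hσ : HasStrictFDerivAt σ A q) (hA : Function.Injective A)
    (hu : MDifferentiableAt 𝓘(ℝ, ℂ) (𝓡 m) (u ∘ σ) q) :
    planeIntegrand β (u ∘ σ) q = A.det * planeIntegrand β u (σ q) := by
  let A' : ℂ ≃L[ℝ] ℂ := (LinearEquiv.ofInjectiveEndo (A : ℂ →ₗ[ℝ] ℂ) hA).toContinuousLinearEquiv
  have hA' : (A' : ℂ →L[ℝ] ℂ) = A := by ext <;> rfl
  have h1 : MDifferentiableAt 𝓘(ℝ, ℂ) (𝓡 m) u (σ q) :=
    mdifferentiableAt_of_comp (A := A') (by rw [hA']; exact hσ) hu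
  have h2 : HasMFDerivAt 𝓘(ℝ, ℂ) 𝓘(ℝ, ℂ) σ q A := hσ.hasFDerivAt.hasMFDerivAt
  have h3 := (HasMFDerivAt.comp q h1.hasMFDerivAt h2).mfderiv
  let T : ℂ →L[ℝ] EuclideanSpace ℝ (Fin m) := mfderiv 𝓘(ℝ, ℂ) (𝓡 m) u (σ q)
  let T' : ℂ →L[ℝ] EuclideanSpace ℝ (Fin m) := mfderiv 𝓘(ℝ, ℂ) (𝓡 m) (u ∘ σ) q
  have h4 : T' = T.comp A := h3
  change β.toModel (u (σ q)) ![T' 1, T' Complex.I] = A.det * β.toModel (u (σ q)) ![T 1, T Complex.I]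
  rw [h4]
  exact alternating_two_comp _ T A

/-- Change of variables for integrals of pulled back 2-forms, for an orientation reversing change
of variables. -/
lemma planeIntegrand_change_of_variables (β : DForm m X 2) {u : ℂ → X} {σ : ℂ → ℂ} {U : Set ℂ}
    (hU : IsOpen U) {A : ℂ → ℂ →L[ℝ] ℂ} (hσ : ∀ q ∈ U, HasStrictFDerivAt σ (A q) q)
    (hA : ∀ q ∈ U, (A q).det < 0) (hi : InjOn σ U)
    (hu : ∀ q ∈ U, MDifferentiableAt 𝓘(ℝ, ℂ) (𝓡 m) (u ∘ σ) q) :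
    (IntegrableOn (planeIntegrand β u) (σ '' U) ↔ IntegrableOn (planeIntegrand β (u ∘ σ)) U) ∧
    ∫ z in σ '' U, planeIntegrand β u z = - ∫ q in U, planeIntegrand β (u ∘ σ) q := by
  have key : ∀ q ∈ U, |(A q).det| • planeIntegrand β u (σ q) = -planeIntegrand β (u ∘ σ) q := by
    intro q hq
    have hinj : Function.Injective (A q) :=
      (LinearMap.isUnit_iff_ker_eq_bot _ |>.1
        ((LinearMap.isUnit_iff_isUnit_det _).2 (isUnit_iff_ne_zero.2 (hA q hq).ne)) |>
          LinearMap.ker_eq_bot.1)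
    simp only [smul_eq_mul]
    rw [planeIntegrand_comp β (hσ q hq) hinj (hu q hq), abs_of_neg (hA q hq)]
    ring
  have hd : ∀ q ∈ U, HasFDerivWithinAt σ (A q) U q :=
    fun q hq => (hσ q hq).hasFDerivAt.hasFDerivWithinAt
  constructor
  · rw [integrableOn_image_iff_integrableOn_abs_det_fderiv_smul volume hU.measurableSet hd hi,
      integrableOn_congr_fun key hU.measurableSet]
    exact integrable_neg_iff
  · rw [integral_image_eq_integral_abs_det_fderiv_smul volume hU.measurableSet hd hi,
      ← integral_neg]
    exact setIntegral_congr_fun hU.measurableSet key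

lemma interior_unitSquare : interior unitSquare = Ioo (0 : ℝ) 1 ×ˢ Ioo (0 : ℝ) 1 := by
  rw [unitSquare, interior_prod_eq, interior_Icc]

lemma uniqueDiffOn_unitSquare : UniqueDiffOn ℝ unitSquare :=
  (uniqueDiffOn_Icc zero_lt_one).prod (uniqueDiffOn_Icc zero_lt_one)

/-- The identification of the complex plane with `ℝ²`. -/
abbrev toPlane : ℂ ≃L[ℝ] ℝ × ℝ := Complex.equivRealProdCLM

lemma volume_toPlane_preimage (s : Set (ℝ × ℝ)) (hs : volume s = 0) :
    volume (toPlane ⁻¹' s) = 0 :=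
  (Complex.volume_preserving_equiv_real_prod.quasiMeasurePreserving).preimage_null hs

lemma volume_unitSquare_diff_interior : volume (unitSquare \ interior unitSquare) = 0 := by
  have hc : Convex ℝ unitSquare := (convex_Icc 0 1).prod (convex_Icc 0 1)
  have h := hc.addHaar_frontier (volume : Measure (ℝ × ℝ))
  refine measure_mono_null ?_ h
  exact sdiff_subset_sdiff_left subset_closure

lemma planeIntegrand_comp_toPlane (β : DForm m X 2) {c : ℝ × ℝ → X} {K : Set (ℝ × ℝ)} {q : ℂ}
    (hc : MDifferentiableWithinAt 𝓘(ℝ, ℝ × ℝ) (𝓡 m) c K (toPlane q)) (hq : K ∈ 𝓝 (toPlane q)) :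
    planeIntegrand β (c ∘ toPlane) q = β.pullOn c K (toPlane q) ![(1, 0), (0, 1)] := by
  have h1 := (hc.mdifferentiableAt hq).hasMFDerivAt
  have h2 : HasMFDerivAt 𝓘(ℝ, ℂ) 𝓘(ℝ, ℝ × ℝ) toPlane q (toPlane : ℂ →L[ℝ] ℝ × ℝ) :=
    toPlane.hasFDerivAt.hasMFDerivAt
  have h3 := (HasMFDerivAt.comp q h1 h2).mfderiv
  have h4 : mfderivWithin 𝓘(ℝ, ℝ × ℝ) (𝓡 m) c K (toPlane q) =
    mfderiv 𝓘(ℝ, ℝ × ℝ) (𝓡 m) c (toPlane q) := mfderivWithin_of_mem_nhds hq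
  let T : ℝ × ℝ →L[ℝ] EuclideanSpace ℝ (Fin m) := mfderiv 𝓘(ℝ, ℝ × ℝ) (𝓡 m) c (toPlane q)
  let T' : ℂ →L[ℝ] EuclideanSpace ℝ (Fin m) := mfderiv 𝓘(ℝ, ℂ) (𝓡 m) (c ∘ toPlane) q
  have h5 : T' = T.comp (toPlane : ℂ →L[ℝ] ℝ × ℝ) := h3
  have h6 : derivOn c K (toPlane q) = T := h4
  change β.toModel (c (toPlane q)) ![T' 1, T' Complex.I] =
    (β.toModel (c (toPlane q))).compContinuousLinearMap (derivOn c K (toPlane q)) _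
  rw [h5, h6]
  refine congrArg (β.toModel _) ?_
  funext i
  fin_cases i <;> simp [Complex.equivRealProdCLM_apply]

variable [IsManifold (𝓡 m) ∞ X]

/-- The pullback of a smooth 2-form is integrable over a cell on which the map is smooth. -/
lemma IsSmoothCell.integrableOn_planeIntegrand {β : DForm m X 2} (hβ : β.IsSmooth) {u : ℂ → X}
    {σ : ℝ × ℝ → ℂ} (hσ : IsSmoothCell σ)
    (hu : ContMDiffOn 𝓘(ℝ, ℝ × ℝ) (𝓡 m) ∞ (u ∘ σ) unitSquare) :
    IntegrableOn (planeIntegrand β u) (σ '' unitSquare) := by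
  set U : Set ℂ := toPlane ⁻¹' interior unitSquare with hUdef
  have hU : IsOpen U := isOpen_interior.preimage toPlane.continuous
  have hnhds : ∀ q ∈ U, unitSquare ∈ 𝓝 (toPlane q) := fun q hq => mem_interior_iff_mem_nhds.1 hq
  have hstrict : ∀ q ∈ U, HasStrictFDerivAt (σ ∘ toPlane)
      ((fderivWithin ℝ σ unitSquare (toPlane q)).comp (toPlane : ℂ →L[ℝ] ℝ × ℝ)) q := by
    intro q hq
    have h1 := (hσ.smooth.contDiffAt (hnhds q hq)).hasStrictFDerivAt (by simp)
    rw [← fderivWithin_of_mem_nhds (hnhds q hq)] at h1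
    exact h1.comp q toPlane.hasStrictFDerivAt
  have hinj : ∀ q ∈ U, Function.Injective
      ((fderivWithin ℝ σ unitSquare (toPlane q)).comp (toPlane : ℂ →L[ℝ] ℝ × ℝ)) := fun q hq =>
    (hσ.immersion _ (interior_subset hq)).comp toPlane.injective
  have hmd : ∀ q ∈ U, MDifferentiableWithinAt 𝓘(ℝ, ℝ × ℝ) (𝓡 m) (u ∘ σ) unitSquare (toPlane q) :=
    fun q hq => (hu _ (interior_subset hq)).mdifferentiableWithinAt (by simp)
  have hmd' : ∀ q ∈ U, MDifferentiableAt 𝓘(ℝ, ℂ) (𝓡 m) (u ∘ (σ ∘ toPlane)) q := fun q hq => by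
    have h1 : MDifferentiableAt 𝓘(ℝ, ℂ) 𝓘(ℝ, ℝ × ℝ) toPlane q :=
      toPlane.differentiableAt.mdifferentiableAt
    exact MDifferentiableAt.comp (g := u ∘ σ) (f := toPlane) q
      ((hmd q hq).mdifferentiableAt (hnhds q hq)) h1
  have hinjOn : InjOn (σ ∘ toPlane) U := fun a ha b hb hab =>
    toPlane.injective (hσ.injOn (interior_subset ha) (interior_subset hb) hab)
  -- on the open square, the integrand times the absolute value of the Jacobian is, up to sign, a
  -- continuous function on the closed square
  have h0 : IntegrableOn (planeIntegrand β u) ((σ ∘ toPlane) '' U) := by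
    rw [integrableOn_image_iff_integrableOn_abs_det_fderiv_smul volume hU.measurableSet
      (fun q hq => (hstrict q hq).hasFDerivAt.hasFDerivWithinAt) hinjOn]
    have hcont : ContinuousOn
        (fun q : ℂ => β.pullOn (u ∘ σ) unitSquare (toPlane q) ![(1, 0), (0, 1)])
        (toPlane ⁻¹' unitSquare) :=
      (DForm.contDiffOn_pullOn_apply hβ uniqueDiffOn_unitSquare hu _).continuousOn.comp
        toPlane.continuous.continuousOn (fun q hq => hq)
    have hcomp : IsCompact (toPlane ⁻¹' unitSquare) :=
      toPlane.toHomeomorph.isCompact_preimage.2 (isCompact_Icc.prod isCompact_Icc)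
    have hint := (hcont.integrableOn_compact hcomp (μ := volume)).mono_set
      (preimage_mono interior_subset : U ⊆ _)
    have hs : ∀ q ∈ U, β.pullOn (u ∘ σ) unitSquare (toPlane q) ![(1, 0), (0, 1)] =
        ((fderivWithin ℝ σ unitSquare (toPlane q)).comp (toPlane : ℂ →L[ℝ] ℝ × ℝ)).det *
          planeIntegrand β u ((σ ∘ toPlane) q) := fun q hq => by
      rw [← planeIntegrand_comp β (hstrict q hq) (hinj q hq) (hmd' q hq)]
      exact (planeIntegrand_comp_toPlane β (hmd q hq) (hnhds q hq)).symm
    have h1 := hint.congr_fun hs hU.measurableSet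
    have hdet : ContinuousOn (fun q => ((fderivWithin ℝ σ unitSquare (toPlane q)).comp
        (toPlane : ℂ →L[ℝ] ℝ × ℝ)).det) U := by
      refine ContinuousLinearMap.continuous_det.comp_continuousOn ?_
      refine ContinuousOn.clm_comp ?_ continuousOn_const
      exact (hσ.smooth.continuousOn_fderivWithin uniqueDiffOn_unitSquare (by simp)).comp
        toPlane.continuous.continuousOn (fun q hq => interior_subset hq)
    have hne : ∀ q ∈ U, ((fderivWithin ℝ σ unitSquare (toPlane q)).comp
        (toPlane : ℂ →L[ℝ] ℝ × ℝ)).det ≠ 0 := fun q hq h => by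
      have h2 := LinearMap.bot_lt_ker_of_det_eq_zero h
      rw [LinearMap.ker_eq_bot.2 (hinj q hq)] at h2
      exact lt_irrefl _ h2
    have hsign := (hdet.abs.div hdet hne).aestronglyMeasurable hU.measurableSet (μ := volume)
    refine (Integrable.bdd_mul h1 hsign (c := 1) (ae_of_all _ fun q => ?_)).congr ?_
    · rw [Pi.div_apply, Real.norm_eq_abs, abs_div, abs_abs]
      exact div_self_le_one _
    · refine (ae_restrict_mem hU.measurableSet).mono fun q hq => ?_
      have := hne q hq
      simp only [smul_eq_mul, Pi.div_apply, Function.comp_apply]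
      field_simp
  -- the image of the boundary of the square is a null set
  have hsub : σ '' unitSquare ⊆ (σ ∘ toPlane) '' U ∪
      (σ ∘ toPlane) '' (toPlane ⁻¹' (unitSquare \ interior unitSquare)) := by
    rw [← image_union, ← preimage_union, union_sdiff_cancel interior_subset, image_comp,
      image_preimage_eq _ toPlane.surjective]
  refine IntegrableOn.mono_set (h0.union ?_) hsub
  have hnull : volume ((σ ∘ toPlane) '' (toPlane ⁻¹' (unitSquare \ interior unitSquare))) = 0 := by
    refine addHaar_image_eq_zero_of_differentiableOn_of_addHaar_eq_zero volume ?_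
      (volume_toPlane_preimage _ volume_unitSquare_diff_interior)
    refine ((hσ.smooth.differentiableOn (by simp)).comp toPlane.differentiableOn
      (s := toPlane ⁻¹' unitSquare) (fun q hq => hq)).mono (preimage_mono sdiff_subset)
  rw [IntegrableOn, Measure.restrict_eq_zero.2 hnull]
  exact integrable_zero_measure

/-- The pullback of a smooth 2-form under a piecewise smooth map is integrable over the disc. -/
lemma IsPiecewiseSmoothOnDisc.integrableOn_planeIntegrand {β : DForm m X 2} (hβ : β.IsSmooth)
    {u : ℂ → X} (hu : IsPiecewiseSmoothOnDisc (m := m) u) :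
    IntegrableOn (planeIntegrand β u) (Metric.ball 0 1) := by
  obtain ⟨N, σ, hσ, hun, -, hs⟩ := hu
  refine IntegrableOn.mono_set ?_ Metric.ball_subset_closedBall
  rw [← hun, integrableOn_finite_iUnion]
  exact fun i => (hσ i).integrableOn_planeIntegrand hβ (hs i)

end PlaneIntegrand
end

/-! ### Partitions of the circle and polar coordinates -/

noncomputable section

section Partition

lemma partition_mono {a : ℕ → ℝ} {N : ℕ} (ha : ∀ i < N, a i < a (i + 1)) {i j : ℕ} (hij : i ≤ j)
    (hj : j ≤ N) : a i ≤ a j := by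
  induction j, hij using Nat.le_induction with
  | base => exact le_rfl
  | succ j _ ih => exact (ih (by omega)).trans (ha j (by omega)).le

lemma exists_mem_Icc_partition {a : ℕ → ℝ} {N : ℕ} (hN : 0 < N) {s : ℝ} (hs : s ∈ Icc (a 0) (a N)) :
    ∃ i < N, s ∈ Icc (a i) (a (i + 1)) := by
  induction N with
  | zero => omega
  | succ N ih =>
    rcases le_total (a N) s with h | h
    · exact ⟨N, by omega, h, hs.2⟩
    · rcases Nat.eq_zero_or_pos N with rfl | h0
      · exact ⟨0, by omega, by simpa using hs⟩
      · obtain ⟨i, hi, hi'⟩ := ih h0 ⟨hs.1, h⟩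
        exact ⟨i, by omega, hi'⟩

/-- The partition of a piecewise smooth loop may be chosen with intervals of length at most `π`. -/
lemma IsPiecewiseSmoothLoop.exists_partition {E : Type*} [NormedAddCommGroup E] [NormedSpace ℝ E]
    {H : Type*} [TopologicalSpace H] {J : ModelWithCorners ℝ E H} {M : Type*} [TopologicalSpace M]
    [ChartedSpace H M] {γ : C(Circle, M)} (hγ : IsPiecewiseSmoothLoop J γ) :
    ∃ (N : ℕ) (a : ℕ → ℝ), 0 < N ∧ a 0 = 0 ∧ a N = 2 * Real.pi ∧ (∀ i < N, a i < a (i + 1)) ∧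
      (∀ i < N, a (i + 1) - a i ≤ Real.pi) ∧
      ∀ i < N, ContMDiffOn 𝓘(ℝ, ℝ) J ∞ (fun s : ℝ => γ (Circle.exp s)) (Icc (a i) (a (i + 1))) := by
  obtain ⟨N, a, h0, hN, ha, hs⟩ := hγ
  have hpi := Real.pi_pos
  have hN0 : 0 < N := by
    rcases Nat.eq_zero_or_pos N with rfl | h
    · linarith
    · exact h
  -- insert the midpoints
  have hcase : ∀ i < 2 * N, ∃ j < N, (i = 2 * j ∨ i = 2 * j + 1) := fun i hi =>
    ⟨i / 2, by omega, by omega⟩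
  have key : ∀ i < 2 * N, ∃ j < N, a j ≤ (a (i / 2) + a ((i + 1) / 2)) / 2 ∧
      (a ((i + 1) / 2) + a ((i + 2) / 2)) / 2 ≤ a (j + 1) ∧
      (a ((i + 1) / 2) + a ((i + 2) / 2)) / 2 - (a (i / 2) + a ((i + 1) / 2)) / 2 =
        (a (j + 1) - a j) / 2 := by
    intro i hi
    obtain ⟨j, hj, rfl | rfl⟩ := hcase i hi
    · refine ⟨j, hj, ?_⟩
      have h1 : (2 * j) / 2 = j := by omega
      have h2 : (2 * j + 1) / 2 = j := by omega
      have h3 : (2 * j + 2) / 2 = j + 1 := by omega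
      rw [h1, h2, h3]
      have := ha j hj
      refine ⟨?_, ?_, ?_⟩ <;> linarith
    · refine ⟨j, hj, ?_⟩
      have h1 : (2 * j + 1) / 2 = j := by omega
      have h2 : (2 * j + 1 + 1) / 2 = j + 1 := by omega
      have h3 : (2 * j + 1 + 2) / 2 = j + 1 := by omega
      rw [h1, h2, h3]
      have := ha j hj
      refine ⟨?_, ?_, ?_⟩ <;> linarith
  refine ⟨2 * N, fun i => (a (i / 2) + a ((i + 1) / 2)) / 2, by omega, by simp [h0], ?_, ?_, ?_, ?_⟩
  · have h1 : (2 * N) / 2 = N := by omega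
    have h2 : (2 * N + 1) / 2 = N := by omega
    simp only [h1, h2, hN]; ring
  · intro i hi
    obtain ⟨j, hj, -, -, h⟩ := key i hi
    have := ha j hj
    simp only [add_assoc, one_add_one_eq_two]
    linarith
  · intro i hi
    obtain ⟨j, hj, -, -, h⟩ := key i hi
    have h1 := partition_mono ha (Nat.zero_le j) hj.le
    have h2 := partition_mono ha (Nat.succ_le_of_lt hj) le_rfl
    simp only [add_assoc, one_add_one_eq_two]
    simp only [Nat.succ_eq_add_one] at h2
    linarith
  · intro i hi
    obtain ⟨j, hj, h1, h2, h⟩ := key i hi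
    refine (hs j hj).mono (Icc_subset_Icc h1 ?_)
    simpa only [add_assoc, one_add_one_eq_two] using h2

lemma circle_exp_inj {s s' : ℝ} (h : Circle.exp s = Circle.exp s') (hs : |s - s'| < 2 * Real.pi) :
    s = s' := by
  obtain ⟨m, hm⟩ := Circle.exp_eq_exp.1 h
  have hpi := Real.pi_pos
  rw [hm, add_sub_cancel_left, abs_mul, abs_of_pos (by positivity : 0 < 2 * Real.pi)] at hs
  have h1 : |(m : ℝ)| < 1 := by
    by_contra h1
    push Not at h1
    nlinarith
  have h2 : m = 0 := by
    have : |m| < 1 := by exact_mod_cast h1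
    exact Int.abs_lt_one_iff.1 this
  rw [hm, h2]; simp

end Partition

section Polar

/-- Polar coordinates on the annulus `1/2 ≤ |z| ≤ 1`: the point of argument `s` and norm
`(1 + t) / 2`. -/
def polarMap (q : ℝ × ℝ) : ℂ := ((1 + q.2) / 2 : ℝ) * (Circle.exp q.1 : ℂ)

lemma polarMap_eq (q : ℝ × ℝ) :
    polarMap q = ((1 + q.2) / 2 : ℝ) * Complex.exp (q.1 * Complex.I) := by
  rw [polarMap, Circle.coe_exp]

lemma norm_polarMap {q : ℝ × ℝ} (hq : 0 ≤ q.2) : ‖polarMap q‖ = (1 + q.2) / 2 := by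
  rw [polarMap, norm_mul, Circle.norm_coe, mul_one, Complex.norm_real, Real.norm_of_nonneg]
  linarith

lemma exp_arg_polarMap {q : ℝ × ℝ} (hq : 0 ≤ q.2) :
    Circle.exp (Complex.arg (polarMap q)) = Circle.exp q.1 := by
  rw [polarMap, Complex.arg_real_mul _ (by linarith), Circle.exp_arg]

lemma exp_arg_coe (z : ℂ) (hz : z ≠ 0) : (Circle.exp (Complex.arg z) : ℂ) = z / ‖z‖ := by
  have h : (‖z‖ : ℂ) ≠ 0 := by simpa using hz
  rw [Circle.coe_exp, eq_div_iff h, mul_comm, Complex.norm_mul_exp_arg_mul_I]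

lemma contDiff_polarMap : ContDiff ℝ ∞ polarMap := by
  have h : polarMap = fun q : ℝ × ℝ => ((1 + q.2) / 2 : ℝ) * Complex.exp (q.1 * Complex.I) :=
    funext polarMap_eq
  rw [h]
  have h1 : ContDiff ℝ ∞ (fun q : ℝ × ℝ => (((1 + q.2) / 2 : ℝ) : ℂ)) :=
    Complex.ofRealCLM.contDiff.comp ((contDiff_const.add contDiff_snd).div_const 2)
  have h2 : ContDiff ℝ ∞ (fun q : ℝ × ℝ => (q.1 : ℂ)) :=
    Complex.ofRealCLM.contDiff.comp (by fun_prop)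
  exact h1.mul (h2.mul contDiff_const).cexp

/-- The derivative of `polarMap`. -/
def polarDeriv (q : ℝ × ℝ) : ℝ × ℝ →L[ℝ] ℂ :=
  (ContinuousLinearMap.fst ℝ ℝ ℝ).smulRight (Complex.I * polarMap q) +
    (ContinuousLinearMap.snd ℝ ℝ ℝ).smulRight ((1 / 2 : ℂ) * (Circle.exp q.1 : ℂ))

lemma hasStrictFDerivAt_polarMap (q : ℝ × ℝ) : HasStrictFDerivAt polarMap (polarDeriv q) q := by
  have h : polarMap = fun q : ℝ × ℝ => ((1 + q.2) / 2 : ℝ) * Complex.exp (q.1 * Complex.I) :=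
    funext polarMap_eq
  have h0 : HasStrictFDerivAt (fun q : ℝ × ℝ => (1 + q.2) / 2)
      ((1 / 2 : ℝ) • ContinuousLinearMap.snd ℝ ℝ ℝ) q := by
    have := (hasStrictFDerivAt_snd (𝕜 := ℝ) (p := q)).const_add 1 |>.const_mul (1 / 2 : ℝ)
    refine this.congr_of_eventuallyEq (Eventually.of_forall fun p => ?_)
    ring
  have h1 := Complex.ofRealCLM.hasStrictFDerivAt.comp q h0
  have h2 := Complex.ofRealCLM.hasStrictFDerivAt.comp q (hasStrictFDerivAt_fst (𝕜 := ℝ) (p := q))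
  have h3 := (Complex.hasStrictDerivAt_exp (q.1 * Complex.I)).hasStrictFDerivAt.restrictScalars ℝ
  have h4 := h3.comp q (h2.mul_const Complex.I)
  have h5 := h1.mul h4
  rw [h]
  refine h5.congr_fderiv ?_
  ext
  · simp [polarDeriv, polarMap_eq]
    ring
  · simp [polarDeriv, mul_comm]

lemma polarDeriv_injective {q : ℝ × ℝ} (hq : 0 ≤ q.2) : Function.Injective (polarDeriv q) := by
  rw [injective_iff_map_eq_zero]
  rintro ⟨a, b⟩ h
  have he : (Circle.exp q.1 : ℂ) ≠ 0 := Circle.coe_ne_zero _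
  have h1 : (((1 + q.2) / 2 * a : ℝ) * Complex.I + (b / 2 : ℝ)) * (Circle.exp q.1 : ℂ) = 0 := by
    rw [← h]
    simp only [polarDeriv, polarMap, add_apply, ContinuousLinearMap.smulRight_apply,
      ContinuousLinearMap.coe_fst', ContinuousLinearMap.coe_snd', Complex.real_smul]
    push_cast
    ring
  have h2 := (mul_eq_zero.1 h1).resolve_right he
  have hre := congrArg Complex.re h2
  have him := congrArg Complex.im h2
  simp at hre him
  have : a = 0 := by
    rcases him with h | h
    · linarith
    · exact h
  rw [this, hre]; rfl

lemma det_eq_re_im (A : ℂ →L[ℝ] ℂ) :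
    A.det = (A 1).re * (A Complex.I).im - (A Complex.I).re * (A 1).im := by
  change LinearMap.det (A : ℂ →ₗ[ℝ] ℂ) = _
  rw [← LinearMap.det_toMatrix Complex.basisOneI, Matrix.det_fin_two]
  simp [LinearMap.toMatrix_apply]

/-- Polar coordinates reverse the orientation, since the angle comes before the radius. -/
lemma det_polarDeriv_neg {q : ℝ × ℝ} (hq : 0 ≤ q.2) :
    ((polarDeriv q).comp (toPlane : ℂ →L[ℝ] ℝ × ℝ)).det < 0 := by
  rw [det_eq_re_im]
  have h1 : (polarDeriv q).comp (toPlane : ℂ →L[ℝ] ℝ × ℝ) 1 = Complex.I * polarMap q := by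
    simp [polarDeriv]
  have h2 : (polarDeriv q).comp (toPlane : ℂ →L[ℝ] ℝ × ℝ) Complex.I =
      (1 / 2 : ℂ) * (Circle.exp q.1 : ℂ) := by
    simp [polarDeriv]
  have h3 : (1 / 2 : ℂ) = ((1 / 2 : ℝ) : ℂ) := by push_cast; rfl
  have h4 : (Circle.exp q.1 : ℂ).re ^ 2 + (Circle.exp q.1 : ℂ).im ^ 2 = 1 := by
    have := Circle.normSq_coe (Circle.exp q.1)
    rw [Complex.normSq_apply] at this
    linarith
  rw [h1, h2, h3, polarMap]
  generalize (Circle.exp q.1 : ℂ) = e at h4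
  simp only [Complex.mul_re, Complex.mul_im, Complex.ofReal_re, Complex.ofReal_im, Complex.I_re,
    Complex.I_im]
  nlinarith

lemma polarMap_inj {q q' : ℝ × ℝ} (hq : 0 ≤ q.2) (hq' : 0 ≤ q'.2) (h : polarMap q = polarMap q')
    (hs : |q.1 - q'.1| < 2 * Real.pi) : q = q' := by
  have h1 := norm_polarMap hq
  rw [h, norm_polarMap hq'] at h1
  have h2 := exp_arg_polarMap hq
  rw [h, exp_arg_polarMap hq'] at h2
  exact Prod.ext (circle_exp_inj h2.symm hs) (by linarith)

lemma exists_polarMap_eq {z : ℂ} (h1 : 1 / 2 ≤ ‖z‖) (h2 : ‖z‖ ≤ 1) :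
    ∃ q ∈ Icc 0 (2 * Real.pi) ×ˢ Icc (0 : ℝ) 1, polarMap q = z := by
  have hpi := Real.pi_pos
  have hz : z ≠ 0 := by rintro rfl; norm_num at h1
  have key : ∃ s ∈ Icc 0 (2 * Real.pi), Circle.exp s = Circle.exp (Complex.arg z) := by
    have h3 := Complex.neg_pi_lt_arg z
    have h4 := Complex.arg_le_pi z
    rcases le_or_gt 0 (Complex.arg z) with h | h
    · exact ⟨_, ⟨h, by linarith⟩, rfl⟩
    · exact ⟨Complex.arg z + 2 * Real.pi, ⟨by linarith, by linarith⟩, by simp⟩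
  obtain ⟨s, hs, hs'⟩ := key
  refine ⟨(s, 2 * ‖z‖ - 1), ⟨hs, by simp only; constructor <;> linarith⟩, ?_⟩
  rw [polarMap]
  simp only
  rw [hs', exp_arg_coe z hz]
  have h : (‖z‖ : ℂ) ≠ 0 := by simpa using hz
  push_cast
  field_simp
  ring

end Polar
end

/-! ### The attached disc -/

noncomputable section

section Cells

variable {m : ℕ} {X : Type*} [TopologicalSpace X] [ChartedSpace (EuclideanSpace ℝ (Fin m)) X]

lemma IsPiecewiseSmoothOnDisc.of_fintype {ι : Type*} [Fintype ι] {u : ℂ → X}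
    (σ : ι → ℝ × ℝ → ℂ) (hσ : ∀ i, IsSmoothCell (σ i))
    (hun : (⋃ i, σ i '' unitSquare) = Metric.closedBall (0 : ℂ) 1)
    (hd : Pairwise (fun i j => Disjoint (σ i '' interior unitSquare) (σ j '' interior unitSquare)))
    (hu : ∀ i, ContMDiffOn 𝓘(ℝ, ℝ × ℝ) (𝓡 m) ∞ (u ∘ σ i) unitSquare) :
    IsPiecewiseSmoothOnDisc (m := m) u := by
  let e := (Fintype.equivFin ι).symm
  refine ⟨Fintype.card ι, fun i => σ (e i), fun i => hσ _, ?_, ?_, fun i => hu _⟩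
  · rw [← hun]
    exact e.surjective.iUnion_comp (fun i => σ i '' unitSquare)
  · exact fun i j hij => hd (e.injective.ne hij)

lemma IsSmoothCell.half_smul {σ : ℝ × ℝ → ℂ} (hσ : IsSmoothCell σ) :
    IsSmoothCell (fun q => (1 / 2 : ℂ) * σ q) where
  smooth := contDiffOn_const.mul hσ.smooth
  injOn := fun a ha b hb hab => hσ.injOn ha hb (by simpa using hab)
  immersion := fun q hq => by
    have h : fderivWithin ℝ (fun q => (1 / 2 : ℂ) * σ q) unitSquare q =
        (1 / 2 : ℂ) • fderivWithin ℝ σ unitSquare q :=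
      (((hσ.smooth.differentiableOn (by simp) q hq).hasFDerivWithinAt).const_mul
        (1 / 2 : ℂ)).fderivWithin (uniqueDiffOn_unitSquare q hq)
    rw [h]
    intro v w hvw
    refine hσ.immersion q hq ?_
    simpa using hvw

/-- The part of the annulus `1/2 ≤ |z| ≤ 1` with argument between `a` and `a + d`, as a smoothly
embedded square. -/
def polarCell (a d : ℝ) (q : ℝ × ℝ) : ℂ := polarMap (a + q.1 * d, q.2)

lemma isSmoothCell_polarCell {a d : ℝ} (hd : 0 < d) (hd' : d < 2 * Real.pi) :
    IsSmoothCell (polarCell a d) where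
  smooth := by
    have : ContDiff ℝ ∞ (fun q : ℝ × ℝ => (a + q.1 * d, q.2)) :=
      (contDiff_const.add (contDiff_fst.mul contDiff_const)).prodMk contDiff_snd
    exact (contDiff_polarMap.comp this).contDiffOn
  injOn := by
    intro p hp q hq h
    have h1 := polarMap_inj (q := (a + p.1 * d, p.2)) (q' := (a + q.1 * d, q.2)) hp.2.1 hq.2.1 h (by
      have : a + p.1 * d - (a + q.1 * d) = (p.1 - q.1) * d := by ring
      simp only
      rw [this, abs_mul, abs_of_pos hd]
      have : |p.1 - q.1| ≤ 1 := by
        rw [abs_le]; constructor <;> linarith [hp.1.1, hp.1.2, hq.1.1, hq.1.2]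
      nlinarith)
    have h2 := congrArg Prod.fst h1
    have h3 := congrArg Prod.snd h1
    simp only at h2 h3
    refine Prod.ext (mul_right_cancel₀ hd.ne' (by linarith)) h3
  immersion := by
    intro q hq
    have h1 : HasFDerivAt (fun q : ℝ × ℝ => (a + q.1 * d, q.2))
        ((d • ContinuousLinearMap.fst ℝ ℝ ℝ).prod (ContinuousLinearMap.snd ℝ ℝ ℝ)) q :=
      ((hasFDerivAt_fst.mul_const d).const_add a).prodMk hasFDerivAt_snd
    have h2 := (hasStrictFDerivAt_polarMap (a + q.1 * d, q.2)).hasFDerivAt.comp q h1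
    have h3 : fderivWithin ℝ (polarCell a d) unitSquare q = _ :=
      h2.hasFDerivWithinAt.fderivWithin (uniqueDiffOn_unitSquare q hq)
    rw [h3]
    refine (polarDeriv_injective (q := (a + q.1 * d, q.2)) hq.2.1).comp ?_
    rintro ⟨x, y⟩ ⟨x', y'⟩ h
    have h2 := congrArg Prod.fst h
    have h3 := congrArg Prod.snd h
    simp at h2 h3
    exact Prod.ext (h2.resolve_right hd.ne') h3

end Cells

universe v v'

variable {n : ℕ} {X : Type*} [TopologicalSpace X]
  [ChartedSpace (EuclideanSpace ℝ (Fin (2 * n))) X]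
  {S : SymplecticBField n X} {L : Type*} [TopologicalSpace L]
  [ChartedSpace (EuclideanSpace ℝ (Fin n)) L] [IsManifold (𝓡 n) ∞ L] {L' : Type*}
  [TopologicalSpace L'] [ChartedSpace (EuclideanSpace ℝ (Fin n)) L'] [IsManifold (𝓡 n) ∞ L']
  {O : LagObject.{v} S L} {O' : LagObject.{v'} S L'}

namespace LagIsotopy

/-- The annulus swept out by the boundary of a disc, as a map of the angle and the time. -/
def annulus (Ψ : LagIsotopy O O') (γ : C(Circle, L)) : ℝ × ℝ → X :=
  Ψ.ψ ∘ sweep (fun s : ℝ => γ (Circle.exp s))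

lemma contMDiffOn_annulus (Ψ : LagIsotopy O O') {γ : C(Circle, L)} {K : Set ℝ}
    (hγ : ContMDiffOn 𝓘(ℝ, ℝ) (𝓡 n) ∞ (fun s : ℝ => γ (Circle.exp s)) K) :
    ContMDiffOn 𝓘(ℝ, ℝ × ℝ) (𝓡 (2 * n)) ∞ (Ψ.annulus γ) (K ×ˢ Icc 0 1) :=
  Ψ.smooth.comp_contMDiffOn (contMDiffOn_sweep hγ)

lemma attach_of_norm_ge (Ψ : LagIsotopy O O') (u : LagDisc n (2 * n) O.ι) {z : ℂ}
    (hz : 1 / 2 ≤ ‖z‖) : Ψ.attach u z =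
      Ψ.ψ (u.bdry (Circle.exp (Complex.arg z)), projIcc 0 1 zero_le_one (2 * ‖z‖ - 1)) := by
  unfold attach
  split_ifs with h
  · have hz' : ‖z‖ = 1 / 2 := le_antisymm h hz
    have h1 : (Circle.exp (Complex.arg z) : ℂ) = 2 * z := by
      rw [exp_arg_coe z (by rintro rfl; norm_num at hz), hz']
      push_cast
      field_simp
    have h2 : projIcc (0 : ℝ) 1 zero_le_one (2 * ‖z‖ - 1) = 0 := by
      rw [hz']; norm_num
    rw [h2, Ψ.start_eq, u.bdry_eq, h1]
  · rfl

lemma attach_polarMap (Ψ : LagIsotopy O O') (u : LagDisc n (2 * n) O.ι) {q : ℝ × ℝ}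
    (hq : 0 ≤ q.2) : Ψ.attach u (polarMap q) = Ψ.annulus u.bdry q := by
  rw [attach_of_norm_ge Ψ u (by rw [norm_polarMap hq]; linarith), exp_arg_polarMap hq,
    norm_polarMap hq]
  have : 2 * ((1 + q.2) / 2) - 1 = q.2 := by ring
  rw [this]
  rfl

lemma continuousOn_attach (Ψ : LagIsotopy O O') (u : LagDisc n (2 * n) O.ι) :
    ContinuousOn (Ψ.attach u) (Metric.closedBall 0 1) := by
  have h1 : ContinuousOn (Ψ.attach u) {z | ‖z‖ ≤ 1 / 2} := by
    have h : ContinuousOn (fun z : ℂ => u.toFun (2 * z)) {z | ‖z‖ ≤ 1 / 2} :=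
      u.continuousOn.comp (by fun_prop) (fun z hz => by
        simp only [mem_ofPred_eq] at hz
        simp; linarith)
    refine h.congr fun z hz => ?_
    simp only [attach]
    exact if_pos hz
  have h2 : ContinuousOn (Ψ.attach u) {z | 1 / 2 ≤ ‖z‖} := by
    have h : ContinuousOn (fun z : ℂ => Circle.exp (Complex.arg z)) {z | 1 / 2 ≤ ‖z‖} := by
      have hind : Topology.IsInducing (fun z : Circle => (z : ℂ)) := ⟨rfl⟩
      refine hind.continuousOn_iff.2 ?_
      have hne : ∀ z ∈ {z : ℂ | 1 / 2 ≤ ‖z‖}, z ≠ 0 := by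
        rintro z hz rfl
        norm_num at hz
      have h : ContinuousOn (fun z : ℂ => z / (‖z‖ : ℂ)) {z | 1 / 2 ≤ ‖z‖} :=
        continuousOn_id.div (Complex.continuous_ofReal.comp continuous_norm).continuousOn
          fun z hz => by simpa using hne z hz
      exact h.congr fun z hz => exp_arg_coe z (hne z hz)
    have h' : ContinuousOn (fun z : ℂ => Ψ.ψ (u.bdry (Circle.exp (Complex.arg z)),
        projIcc 0 1 zero_le_one (2 * ‖z‖ - 1))) {z | 1 / 2 ≤ ‖z‖} :=
      Ψ.smooth.continuous.comp_continuousOn ((u.bdry.continuous.comp_continuousOn h).prodMk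
        (continuous_projIcc.comp (by fun_prop)).continuousOn)
    exact h'.congr fun z hz => Ψ.attach_of_norm_ge u hz
  have h3 := h1.union_of_isClosed h2 (isClosed_le continuous_norm continuous_const)
    (isClosed_le continuous_const continuous_norm)
  exact h3.mono fun z _ => le_total ‖z‖ (1 / 2)

/-- The cells of the attached disc are those of `u`, shrunk by the factor `1/2`, and the polar cells
over a partition of the boundary loop. -/
lemma isPiecewiseSmoothOnDisc_attach (Ψ : LagIsotopy O O') (u : LagDisc n (2 * n) O.ι) :
    IsPiecewiseSmoothOnDisc (m := 2 * n) (Ψ.attach u) := by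
  obtain ⟨N, σ, hσ, hun, hd, hs⟩ := u.piecewiseSmooth
  obtain ⟨M, a, hM, h0, hM', ha, hlen, hγ⟩ := u.bdry_piecewiseSmooth.exists_partition
  have hpi := Real.pi_pos
  have hσ1 : ∀ i, ∀ q ∈ unitSquare, ‖σ i q‖ ≤ 1 := fun i q hq => by
    have : σ i q ∈ ⋃ i, σ i '' unitSquare := mem_iUnion.2 ⟨i, q, hq, rfl⟩
    rw [hun] at this
    simpa using this
  -- the angle on a cell
  have hangle : ∀ j < M, ∀ x ∈ Icc (0 : ℝ) 1, a j + x * (a (j + 1) - a j) ∈ Icc (a j) (a (j + 1)) :=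
    fun j hj x hx => by
      have := ha j hj
      constructor <;> nlinarith [hx.1, hx.2]
  refine IsPiecewiseSmoothOnDisc.of_fintype (ι := Fin N ⊕ Fin M)
    (Sum.elim (fun i q => (1 / 2 : ℂ) * σ i q) (fun j => polarCell (a j) (a (j + 1) - a j)))
    ?_ ?_ ?_ ?_
  · rintro (i | j)
    · exact (hσ i).half_smul
    · exact isSmoothCell_polarCell (sub_pos.2 (ha j j.2)) (by linarith [hlen j j.2])
  · apply Subset.antisymm
    · refine iUnion_subset ?_
      rintro (i | j) _ ⟨q, hq, rfl⟩
      · have := hσ1 i q hq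
        simp only [Sum.elim_inl, mem_closedBall_zero_iff, norm_mul]
        norm_num
        linarith
      · simp only [Sum.elim_inr, mem_closedBall_zero_iff, polarCell]
        rw [norm_polarMap (q := (a j + q.1 * (a (j + 1) - a j), q.2)) hq.2.1]
        have := hq.2.2
        simp only at this ⊢
        linarith
    · intro z hz
      rw [mem_closedBall_zero_iff] at hz
      rcases le_total ‖z‖ (1 / 2) with h | h
      · have : 2 * z ∈ ⋃ i, σ i '' unitSquare := by
          rw [hun]
          simp
          linarith
        obtain ⟨i, q, hq, hqz⟩ := mem_iUnion.1 this
        refine mem_iUnion.2 ⟨Sum.inl i, q, hq, ?_⟩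
        simp [hqz]
      · obtain ⟨q, hq, rfl⟩ := exists_polarMap_eq h hz
        obtain ⟨j, hj, hj'⟩ := exists_mem_Icc_partition (a := a) (s := q.1) hM
          (by rw [h0, hM']; exact hq.1)
        refine mem_iUnion.2 ⟨Sum.inr ⟨j, hj⟩, ((q.1 - a j) / (a (j + 1) - a j), q.2),
          ⟨⟨?_, ?_⟩, hq.2⟩, ?_⟩
        · exact div_nonneg (by linarith [hj'.1]) (by linarith [ha j hj])
        · exact div_le_one_of_le₀ (by linarith [hj'.2]) (by linarith [ha j hj])
        · simp only [Sum.elim_inr, polarCell]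
          rw [div_mul_cancel₀ _ (sub_pos.2 (ha j hj)).ne']
          simp
  · -- cells of different kinds are separated by the norm, polar cells by the argument
    have hmix : ∀ i j, Disjoint ((fun q => (1 / 2 : ℂ) * σ i q) '' interior unitSquare)
        (polarCell (a j) (a (j + 1) - a j) '' interior unitSquare) := by
      intro i j
      rw [Set.disjoint_left]
      rintro _ ⟨q, hq, rfl⟩ ⟨p, hp, h⟩
      have h1 := hσ1 i q (interior_subset hq)
      rw [interior_unitSquare] at hp
      have h2 := congrArg norm h
      rw [polarCell, norm_polarMap (q := (a j + p.1 * (a (j + 1) - a j), p.2)) hp.2.1.le,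
        norm_mul] at h2
      norm_num at h2
      linarith [hp.2.1]
    have hpol : ∀ i j, i < j → j < M →
        Disjoint (polarCell (a i) (a (i + 1) - a i) '' interior unitSquare)
        (polarCell (a j) (a (j + 1) - a j) '' interior unitSquare) := by
      intro i j hij hj
      rw [Set.disjoint_left]
      rintro _ ⟨q, hq, rfl⟩ ⟨p, hp, h⟩
      rw [interior_unitSquare] at hp hq
      have e1 := partition_mono ha (Nat.zero_le i) (by omega)
      have e2 := partition_mono ha (Nat.succ_le_of_lt hij) hj.le
      have e3 := partition_mono ha (Nat.succ_le_of_lt hj) le_rfl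
      simp only [Nat.succ_eq_add_one] at e2 e3
      have e4 := ha i (by omega)
      have e5 := ha j hj
      have f1 : a i + q.1 * (a (i + 1) - a i) < a (i + 1) := by nlinarith [hq.1.2]
      have f2 : a i < a i + q.1 * (a (i + 1) - a i) := by nlinarith [hq.1.1]
      have f3 : a j + p.1 * (a (j + 1) - a j) < a (j + 1) := by nlinarith [hp.1.2]
      have f4 : a j < a j + p.1 * (a (j + 1) - a j) := by nlinarith [hp.1.1]
      have h2 := polarMap_inj (q := (a j + p.1 * (a (j + 1) - a j), p.2))
        (q' := (a i + q.1 * (a (i + 1) - a i), q.2)) hp.2.1.le hq.2.1.le h (by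
        simp only
        rw [abs_lt]; constructor <;> linarith)
      have h3 := congrArg Prod.fst h2
      simp only at h3
      linarith
    rintro (i | i) (j | j) hij
    · have : Disjoint (σ i '' interior unitSquare) (σ j '' interior unitSquare) :=
        hd (show i ≠ j by rintro rfl; exact hij rfl)
      simp only [Sum.elim_inl]
      rw [Set.disjoint_left] at this ⊢
      rintro _ ⟨q, hq, rfl⟩ ⟨p, hp, h⟩
      exact this ⟨q, hq, rfl⟩ ⟨p, hp, by simpa using h⟩
    · exact hmix i j
    · exact (hmix j i).symm
    · have hne : (i : ℕ) ≠ j := fun h => hij (by rw [Fin.ext h])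
      rcases lt_or_gt_of_ne hne with h | h
      · exact hpol i j h j.2
      · exact (hpol j i h i.2).symm
  · rintro (i | j)
    · refine (hs i).congr fun q hq => ?_
      have h1 : ‖(1 / 2 : ℂ) * σ i q‖ ≤ 1 / 2 := by
        rw [norm_mul]
        norm_num
        linarith [hσ1 i q hq]
      simp only [Sum.elim_inl, Function.comp_apply, attach]
      rw [if_pos h1]
      congr 1
      ring
    · have h1 : ContMDiffOn 𝓘(ℝ, ℝ × ℝ) 𝓘(ℝ, ℝ × ℝ) ∞
          (fun q : ℝ × ℝ => (a j + q.1 * (a (j + 1) - a j), q.2)) unitSquare :=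
        ((contDiff_const.add (contDiff_fst.mul contDiff_const)).prodMk
          contDiff_snd).contMDiff.contMDiffOn
      refine ((Ψ.contMDiffOn_annulus (hγ j j.2)).comp h1 ?_).congr ?_
      · exact fun q hq => ⟨hangle j j.2 q.1 hq.1, hq.2⟩
      · exact fun q hq => Ψ.attach_polarMap u (q := (a j + q.1 * (a (j + 1) - a j), q.2)) hq.2.1

/-- The disc `u'` with boundary on the end of the isotopy. -/
def attachDisc (Ψ : LagIsotopy O O') (u : LagDisc n (2 * n) O.ι) : LagDisc n (2 * n) O'.ι where
  toFun := Ψ.attach u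
  continuousOn := Ψ.continuousOn_attach u
  piecewiseSmooth := Ψ.isPiecewiseSmoothOnDisc_attach u
  bdry := ⟨fun z => Ψ.endDiffeo (u.bdry z), Ψ.endDiffeo.continuous.comp u.bdry.continuous⟩
  bdry_eq := fun z => by
    have h1 : projIcc (0 : ℝ) 1 zero_le_one (2 * ‖(z : ℂ)‖ - 1) = 1 := by
      rw [Circle.norm_coe]; norm_num
    rw [Ψ.attach_of_norm_ge u (by rw [Circle.norm_coe]; norm_num), h1, Circle.exp_arg, Ψ.end_eq]
    rfl
  bdry_piecewiseSmooth := by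
    obtain ⟨N, a, h0, hN, ha, hs⟩ := u.bdry_piecewiseSmooth
    exact ⟨N, a, h0, hN, ha, fun i hi => Ψ.endDiffeo.contMDiff.comp_contMDiffOn (hs i hi)⟩

end LagIsotopy
end

/-! ### The integral over the attached annulus -/

noncomputable section

universe v v'

variable {n : ℕ} {X : Type*} [TopologicalSpace X]
  [ChartedSpace (EuclideanSpace ℝ (Fin (2 * n))) X]
  {S : SymplecticBField n X} {L : Type*} [TopologicalSpace L]
  [ChartedSpace (EuclideanSpace ℝ (Fin n)) L] [IsManifold (𝓡 n) ∞ L] {L' : Type*}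
  [TopologicalSpace L'] [ChartedSpace (EuclideanSpace ℝ (Fin n)) L'] [IsManifold (𝓡 n) ∞ L']
  {O : LagObject.{v} S L} {O' : LagObject.{v'} S L'}

namespace LagIsotopy

open MeasureTheory

/-- The value of `ψ^* β` on the pair `(γ', ∂/∂t)` along the cylinder over a loop `γ`. -/
def annulusIntegrand (Ψ : LagIsotopy O O') (β : DForm (2 * n) X 2) (γ : C(Circle, L)) (s t : ℝ) :
    ℝ :=
  let p : L × Icc (0 : ℝ) 1 := (γ (Circle.exp s), projIcc 0 1 zero_le_one t)
  β.pullback (cylModel n) Ψ.ψ p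
    ![((loopVelocity (𝓡 n) γ s, (0 : EuclideanSpace ℝ (Fin 1))) : TangentSpace (cylModel n) p),
      timeVector p]

lemma pullOn_annulus (Ψ : LagIsotopy O O') (β : DForm (2 * n) X 2) {γ : C(Circle, L)} {a b : ℝ}
    (hγ : ContMDiffOn 𝓘(ℝ, ℝ) (𝓡 n) ∞ (fun s : ℝ => γ (Circle.exp s)) (Icc a b)) {s t : ℝ}
    (hs : s ∈ Ioo a b) (ht : t ∈ Icc (0 : ℝ) 1) :
    β.pullOn (Ψ.annulus γ) (Icc a b ×ˢ Icc 0 1) (s, t) ![(1, 0), (0, 1)] =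
      Ψ.annulusIntegrand β γ s t := by
  have hK : Icc a b ∈ 𝓝 s := Icc_mem_nhds hs.1 hs.2
  have h1 : HasMFDerivWithinAt 𝓘(ℝ, ℝ) (𝓡 n) (fun s : ℝ => γ (Circle.exp s)) (Icc a b) s _ :=
    (((hγ s (Ioo_subset_Icc_self hs)).mdifferentiableWithinAt
      (by simp)).mdifferentiableAt hK).hasMFDerivAt.hasMFDerivWithinAt
  have h2 : MDifferentiableAt (cylModel n) (𝓡 (2 * n)) Ψ.ψ
      (sweep (fun s : ℝ => γ (Circle.exp s)) (s, t)) :=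
    Ψ.smooth.mdifferentiable (by simp) _
  have h3 := derivOn_comp_sweep h1 (uniqueDiffWithinAt_of_mem_nhds hK) ht h2
  change (β.toModel _).compContinuousLinearMap (derivOn (Ψ.annulus γ) _ _) _ =
    (β.toModel _).compContinuousLinearMap (mfderiv (cylModel n) (𝓡 (2 * n)) Ψ.ψ
      (sweep (fun s : ℝ => γ (Circle.exp s)) (s, t)) :
      EuclideanSpace ℝ (Fin n) × EuclideanSpace ℝ (Fin 1) →L[ℝ] _) _
  refine congrArg (β.toModel _) ?_
  funext i
  fin_cases i
  · refine (h3 1 0).trans (congrArg _ ?_)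
    exact Prod.ext rfl (zero_smul ℝ _)
  · refine (h3 0 1).trans (congrArg _ ?_)
    exact Prod.ext (map_zero _) (one_smul ℝ _)

/-- On the inner half of the disc, `u'` is a rescaling of `u`; the factor `4` is the Jacobian of the
rescaling. -/
lemma planeIntegrand_attach_inner (Ψ : LagIsotopy O O') (β : DForm (2 * n) X 2)
    (u : LagDisc n (2 * n) O.ι) {z : ℂ} (hz : z ∈ Metric.ball (0 : ℂ) (1 / 2)) :
    planeIntegrand β (Ψ.attach u) z = 4 * planeIntegrand β u.toFun ((2 : ℝ) • z) := by
  let A : ℂ ≃L[ℝ] ℂ := ContinuousLinearEquiv.smulLeft (Units.mk0 (2 : ℝ) two_ne_zero)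
  have hA : HasStrictFDerivAt (fun z : ℂ => (2 : ℝ) • z) (A : ℂ →L[ℝ] ℂ) z :=
    A.hasStrictFDerivAt
  have h1 : Ψ.attach u =ᶠ[𝓝 z] u.toFun ∘ (fun z : ℂ => (2 : ℝ) • z) := by
    filter_upwards [Metric.isOpen_ball.mem_nhds hz] with w hw
    simp only [mem_ball_zero_iff] at hw
    simp only [attach, Function.comp_apply]
    rw [if_pos hw.le]
    simp
  have h2 : planeIntegrand β (Ψ.attach u) z =
      planeIntegrand β (u.toFun ∘ (fun z : ℂ => (2 : ℝ) • z)) z := by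
    have h3 := h1.mfderiv_eq (I := 𝓘(ℝ, ℂ)) (I' := 𝓡 (2 * n))
    let T : ℂ →L[ℝ] EuclideanSpace ℝ (Fin (2 * n)) :=
      mfderiv 𝓘(ℝ, ℂ) (𝓡 (2 * n)) (Ψ.attach u) z
    let T' : ℂ →L[ℝ] EuclideanSpace ℝ (Fin (2 * n)) :=
      mfderiv 𝓘(ℝ, ℂ) (𝓡 (2 * n)) (u.toFun ∘ (fun z : ℂ => (2 : ℝ) • z)) z
    have h4 : T = T' := h3
    change β.toModel _ ![T 1, T Complex.I] = β.toModel _ ![T' 1, T' Complex.I]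
    rw [h4, h1.eq_of_nhds]
  have hdet : (A : ℂ →L[ℝ] ℂ).det = 4 := by
    rw [det_eq_re_im]
    change ((2 : ℝ) • (1 : ℂ)).re * ((2 : ℝ) • Complex.I).im -
      ((2 : ℝ) • Complex.I).re * ((2 : ℝ) • (1 : ℂ)).im = 4
    norm_num
  rw [h2]
  by_cases hu : MDifferentiableAt 𝓘(ℝ, ℂ) (𝓡 (2 * n)) (u.toFun ∘ (fun z : ℂ => (2 : ℝ) • z)) z
  · rw [planeIntegrand_comp β hA A.injective hu, hdet]
  · -- where `u` is not differentiable, both sides vanish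
    have hu' : ¬ MDifferentiableAt 𝓘(ℝ, ℂ) (𝓡 (2 * n)) u.toFun ((2 : ℝ) • z) := fun h => by
      have h3 : MDifferentiableAt 𝓘(ℝ, ℂ) 𝓘(ℝ, ℂ) (fun z : ℂ => (2 : ℝ) • z) z :=
        hA.hasFDerivAt.differentiableAt.mdifferentiableAt
      exact hu (MDifferentiableAt.comp z h h3)
    have hz0 : ∀ {w : ℂ → X} {y : ℂ}, ¬ MDifferentiableAt 𝓘(ℝ, ℂ) (𝓡 (2 * n)) w y →
        planeIntegrand β w y = 0 := fun {w y} h => by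
      unfold planeIntegrand
      rw [mfderiv_zero_of_not_mdifferentiableAt h]
      exact (β.toModel (w y)).map_coord_zero 0 rfl
    rw [hz0 hu, hz0 hu', mul_zero]

variable [IsManifold (𝓡 (2 * n)) ∞ X]

/-- Attaching the annulus changes the integral of a 2-form by the integral over the annulus. -/
lemma discIntegral_attach (Ψ : LagIsotopy O O') {β : DForm (2 * n) X 2} (hβ : β.IsSmooth)
    (u : LagDisc n (2 * n) O.ι) :
    discIntegral β (Ψ.attach u) = discIntegral β u.toFun -
      ∫ s in (0 : ℝ)..(2 * Real.pi), ∫ t in (0 : ℝ)..1, Ψ.annulusIntegrand β u.bdry s t := by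
  obtain ⟨N, a, hN, h0, hN', ha, -, hγ⟩ := u.bdry_piecewiseSmooth.exists_partition
  have hpi := Real.two_pi_pos
  have hint := (Ψ.isPiecewiseSmoothOnDisc_attach u).integrableOn_planeIntegrand hβ
  -- away from the angles in `S₀`, the annulus is a smooth function of the angle and the time
  set S₀ : Set ℝ := a '' {i | i ≤ N} with hS₀
  have hfin : S₀.Finite := (finite_le_nat N).image a
  have hS : ∀ s ∈ Ioo 0 (2 * Real.pi) \ S₀, ∃ j < N, s ∈ Ioo (a j) (a (j + 1)) := by
    rintro s ⟨hs, hs'⟩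
    obtain ⟨j, hj, hj'⟩ := exists_mem_Icc_partition (a := a) (s := s) hN
      (by rw [h0, hN']; exact Ioo_subset_Icc_self hs)
    refine ⟨j, hj, lt_of_le_of_ne hj'.1 ?_, lt_of_le_of_ne hj'.2 ?_⟩
    · rintro rfl; exact hs' ⟨j, hj.le, rfl⟩
    · rintro rfl; exact hs' ⟨j + 1, hj, rfl⟩
  set U₀ : Set (ℝ × ℝ) := (Ioo 0 (2 * Real.pi) \ S₀) ×ˢ Ioo 0 1 with hU₀
  have hU₀' : IsOpen U₀ := (isOpen_Ioo.sdiff hfin.isClosed).prod isOpen_Ioo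
  set U : Set ℂ := toPlane ⁻¹' U₀ with hUdef
  have hU : IsOpen U := hU₀'.preimage toPlane.continuous
  set σ : ℂ → ℂ := polarMap ∘ toPlane with hσdef
  have hσ : ∀ q ∈ U, HasStrictFDerivAt σ
      ((polarDeriv (toPlane q)).comp (toPlane : ℂ →L[ℝ] ℝ × ℝ)) q := fun q hq =>
    (hasStrictFDerivAt_polarMap (toPlane q)).comp q toPlane.hasStrictFDerivAt
  have hev : ∀ q ∈ U, Ψ.attach u ∘ σ =ᶠ[𝓝 q] Ψ.annulus u.bdry ∘ toPlane := fun q hq => by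
    filter_upwards [hU.mem_nhds hq] with w hw
    exact Ψ.attach_polarMap u hw.2.1.le
  have hmd : ∀ q ∈ U, ∃ j < N, (toPlane q).1 ∈ Ioo (a j) (a (j + 1)) ∧
      Icc (a j) (a (j + 1)) ×ˢ Icc (0 : ℝ) 1 ∈ 𝓝 (toPlane q) ∧
      MDifferentiableWithinAt 𝓘(ℝ, ℝ × ℝ) (𝓡 (2 * n)) (Ψ.annulus u.bdry)
        (Icc (a j) (a (j + 1)) ×ˢ Icc 0 1) (toPlane q) := fun q hq => by
    obtain ⟨j, hj, hj'⟩ := hS _ hq.1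
    refine ⟨j, hj, hj', prod_mem_nhds (Icc_mem_nhds hj'.1 hj'.2) (Icc_mem_nhds hq.2.1 hq.2.2), ?_⟩
    exact (Ψ.contMDiffOn_annulus (hγ j hj) _ ⟨Ioo_subset_Icc_self hj',
      Ioo_subset_Icc_self hq.2⟩).mdifferentiableWithinAt (by simp)
  have hmd' : ∀ q ∈ U, MDifferentiableAt 𝓘(ℝ, ℂ) (𝓡 (2 * n)) (Ψ.attach u ∘ σ) q := fun q hq => by
    obtain ⟨j, hj, hj', hK, h⟩ := hmd q hq
    have h1 : MDifferentiableAt 𝓘(ℝ, ℂ) 𝓘(ℝ, ℝ × ℝ) toPlane q :=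
      toPlane.differentiableAt.mdifferentiableAt
    exact (MDifferentiableAt.comp (g := Ψ.annulus u.bdry) (f := toPlane) q
      (h.mdifferentiableAt hK) h1).congr_of_eventuallyEq (hev q hq)
  have hinj : InjOn σ U := fun p hp q hq h => toPlane.injective <|
    polarMap_inj hp.2.1.le hq.2.1.le h (by
      rw [abs_lt]; constructor <;> linarith [hp.1.1.1, hp.1.1.2, hq.1.1.1, hq.1.1.2])
  obtain ⟨hcv, hcv'⟩ := planeIntegrand_change_of_variables β hU hσ
    (fun q hq => det_polarDeriv_neg hq.2.1.le) hinj hmd'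
  have hval : ∀ q ∈ U, planeIntegrand β (Ψ.attach u ∘ σ) q =
      Ψ.annulusIntegrand β u.bdry (toPlane q).1 (toPlane q).2 := fun q hq => by
    obtain ⟨j, hj, hj', hK, h⟩ := hmd q hq
    rw [← Ψ.pullOn_annulus β (hγ j hj) hj' (Ioo_subset_Icc_self hq.2)]
    refine Eq.trans ?_ (planeIntegrand_comp_toPlane β h hK)
    have h3 := (hev q hq).mfderiv_eq (I := 𝓘(ℝ, ℂ)) (I' := 𝓡 (2 * n))
    let T : ℂ →L[ℝ] EuclideanSpace ℝ (Fin (2 * n)) :=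
      mfderiv 𝓘(ℝ, ℂ) (𝓡 (2 * n)) (Ψ.attach u ∘ σ) q
    let T' : ℂ →L[ℝ] EuclideanSpace ℝ (Fin (2 * n)) :=
      mfderiv 𝓘(ℝ, ℂ) (𝓡 (2 * n)) (Ψ.annulus u.bdry ∘ toPlane) q
    have h4 : T = T' := h3
    change β.toModel _ ![T 1, T Complex.I] = β.toModel _ ![T' 1, T' Complex.I]
    rw [h4, (hev q hq).eq_of_nhds]
  -- up to a null set, the outer annulus is the image of `U`
  have himg : σ '' U ⊆ Metric.ball 0 1 \ Metric.ball 0 (1 / 2) := by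
    rintro _ ⟨q, hq, rfl⟩
    have h1 : ‖σ q‖ = _ := norm_polarMap hq.2.1.le
    have h2 := hq.2.1
    have h3 := hq.2.2
    constructor
    · rw [mem_ball_zero_iff, h1]; linarith
    · rw [mem_ball_zero_iff, h1]; linarith
  have hnull : volume ((Metric.ball (0 : ℂ) 1 \ Metric.ball 0 (1 / 2)) \ σ '' U) = 0 := by
    have hV : volume ((Icc 0 (2 * Real.pi) ×ˢ Icc (0 : ℝ) 1) \ U₀) = 0 := by
      have h1 : (Icc 0 (2 * Real.pi) ×ˢ Icc (0 : ℝ) 1) \ U₀ ⊆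
          ((insert 0 (insert (2 * Real.pi) S₀)) ×ˢ univ) ∪ univ ×ˢ {0, 1} := by
        rintro ⟨x, y⟩ ⟨⟨hx, hy⟩, h⟩
        simp only at hx hy
        simp only [mem_union, mem_prod, mem_insert_iff, mem_univ, and_true, true_and,
          mem_singleton_iff]
        by_contra hc
        push Not at hc
        refine h ⟨⟨⟨lt_of_le_of_ne hx.1 (Ne.symm hc.1.1), lt_of_le_of_ne hx.2 hc.1.2.1⟩,
          hc.1.2.2⟩, lt_of_le_of_ne hy.1 (Ne.symm hc.2.1), lt_of_le_of_ne hy.2 hc.2.2⟩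
      refine measure_mono_null h1 (measure_union_null ?_ ?_)
      · rw [Measure.volume_eq_prod, Measure.prod_prod,
          ((hfin.insert _).insert _).measure_zero volume, zero_mul]
      · rw [Measure.volume_eq_prod, Measure.prod_prod,
          ((finite_singleton (1 : ℝ)).insert 0).measure_zero volume, mul_zero]
    refine measure_mono_null ?_ (addHaar_image_eq_zero_of_differentiableOn_of_addHaar_eq_zero volume
      (f := σ) ?_ (volume_toPlane_preimage _ hV))
    · rintro z ⟨⟨h1, h2⟩, h3⟩
      rw [mem_ball_zero_iff] at h1 h2
      obtain ⟨q, hq, rfl⟩ := exists_polarMap_eq (not_lt.1 h2) h1.le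
      refine ⟨toPlane.symm q, ⟨by simpa using hq, fun h => h3 ⟨toPlane.symm q, h, ?_⟩⟩, ?_⟩ <;>
        simp [hσdef]
    · exact ((contDiff_polarMap.differentiable (by simp)).comp
        toPlane.differentiable).differentiableOn
  have hae : (Metric.ball (0 : ℂ) 1 \ Metric.ball 0 (1 / 2) : Set ℂ) =ᵐ[volume] σ '' U :=
    (ae_le_set.2 hnull).antisymm (LE.le.eventuallyLE himg)
  have hinner : ∫ z in Metric.ball (0 : ℂ) 1 ∩ Metric.ball 0 (1 / 2),
      planeIntegrand β (Ψ.attach u) z = discIntegral β u.toFun := by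
    rw [inter_eq_self_of_subset_right (Metric.ball_subset_ball (by norm_num)),
      setIntegral_congr_fun measurableSet_ball (fun z hz => Ψ.planeIntegrand_attach_inner β u hz),
      integral_const_mul, Measure.setIntegral_comp_smul_of_pos volume _ _ two_pos,
      smul_ball two_ne_zero, discIntegral_eq, Complex.finrank_real_complex]
    norm_num
    rw [← mul_assoc]
    norm_num
  have houter : ∫ z in σ '' U, planeIntegrand β (Ψ.attach u) z =
      - ∫ s in (0 : ℝ)..(2 * Real.pi), ∫ t in (0 : ℝ)..1, Ψ.annulusIntegrand β u.bdry s t := by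
    have hi : IntegrableOn (fun q : ℂ =>
        Ψ.annulusIntegrand β u.bdry (toPlane q).1 (toPlane q).2) U :=
      (hcv.1 (hint.mono_set (himg.trans sdiff_subset))).congr_fun hval hU.measurableSet
    have hmp := Complex.volume_preserving_equiv_real_prod
    have hemb := Complex.measurableEquivRealProd.measurableEmbedding
    have hi' : IntegrableOn (fun q : ℝ × ℝ => Ψ.annulusIntegrand β u.bdry q.1 q.2) U₀ :=
      (hmp.integrableOn_comp_preimage hemb).1 hi
    have he := hmp.setIntegral_preimage_emb hemb
      (fun q : ℝ × ℝ => Ψ.annulusIntegrand β u.bdry q.1 q.2) U₀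
    rw [hcv', setIntegral_congr_fun hU.measurableSet hval]
    refine congrArg Neg.neg (he.trans ?_)
    rw [hU₀, Measure.volume_eq_prod, setIntegral_prod _ hi',
      intervalIntegral.integral_of_le hpi.le]
    have hae1 : (Ioo 0 (2 * Real.pi) \ S₀ : Set ℝ) =ᵐ[volume] Ioc 0 (2 * Real.pi) :=
      (sdiff_null_ae_eq_self (hfin.measure_zero volume)).trans Ioo_ae_eq_Ioc
    rw [setIntegral_congr_set hae1]
    refine setIntegral_congr_fun measurableSet_Ioc fun s _ => ?_
    simp only
    rw [intervalIntegral.integral_of_le zero_le_one, integral_Ioc_eq_integral_Ioo]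
  rw [discIntegral_eq, ← integral_inter_add_sdiff measurableSet_ball hint
    (t := Metric.ball (0 : ℂ) (1 / 2)), hinner, setIntegral_congr_set hae, houter, sub_eq_add_neg]

/-- For the symplectic form, the integral over the annulus is the integral of `θ_ψ` over the
boundary. -/
lemma integral_annulusIntegrand_symp (Ψ : LagIsotopy O O') (γ : C(Circle, L)) :
    ∫ s in (0 : ℝ)..(2 * Real.pi), ∫ t in (0 : ℝ)..1, Ψ.annulusIntegrand S.symp γ s t =
      loopIntegral Ψ.theta γ := by
  refine intervalIntegral.integral_congr fun s _ => ?_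
  refine Eq.trans ?_ (Ψ.theta_apply (γ (Circle.exp s)) ![loopVelocity (𝓡 n) γ s]).symm
  refine intervalIntegral.integral_congr fun t _ => ?_
  exact (Ψ.b_apply _ _ _).symm

end LagIsotopy
end

/-! ### Primitives of closed 1-forms along maps -/

noncomputable section

section Primitives

variable {m : ℕ} {M : Type*} [TopologicalSpace M] [ChartedSpace (EuclideanSpace ℝ (Fin m)) M]

/-- A 1-form as a family of linear functionals on the model space. -/
def DForm.dual (α : DForm m M 1) (x : M) : EuclideanSpace ℝ (Fin m) →L[ℝ] ℝ :=
  (ContinuousAlternatingMap.ofSubsingletonLIE (𝕜 := ℝ) (E := EuclideanSpace ℝ (Fin m)) (F := ℝ)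
    (0 : Fin 1)).symm (α.toModel x)

lemma DForm.dual_apply (α : DForm m M 1) (x : M) (v : EuclideanSpace ℝ (Fin m)) :
    α.dual x v = α.toModel x ![v] := by
  rw [apply_fin_one]; rfl

/-- `f` is a primitive of the 1-form `α` on the set `U`. -/
def IsPrimitiveOn (α : DForm m M 1) (f : M → ℝ) (U : Set M) : Prop :=
  ∀ x ∈ U, HasMFDerivAt (𝓡 m) 𝓘(ℝ, ℝ) f x (α.dual x)

variable [IsManifold (𝓡 m) ∞ M]

/-- The Poincaré lemma, on a ball in a chart. -/
lemma exists_isPrimitiveOn {α : DForm m M 1} (hα : α.IsSmooth) (hα' : α.IsClosed) (x₀ : M) :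
    ∃ U : Set M, IsOpen U ∧ x₀ ∈ U ∧ ∃ f, IsPrimitiveOn α f U := by
  set φ := extChartAt (𝓡 m) x₀ with hφ
  obtain ⟨r, hr, hB⟩ := Metric.isOpen_iff.1 (isOpen_extChartAt_target (I := 𝓡 m) x₀) (φ x₀)
    (mem_extChartAt_target x₀)
  set e := ContinuousAlternatingMap.ofSubsingletonLIE (𝕜 := ℝ) (E := EuclideanSpace ℝ (Fin m))
    (F := ℝ) (0 : Fin 1) with he
  have hd : ∀ y ∈ Metric.ball (φ x₀) r, DifferentiableAt ℝ (α.inChart x₀) y := fun y hy =>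
    hα.differentiableAt x₀ (hB hy)
  have hfd : ∀ y ∈ Metric.ball (φ x₀) r, ∀ v w,
      fderiv ℝ (fun z => e.symm (α.inChart x₀ z)) y v w =
        fderiv ℝ (fun z => α.inChart x₀ z ![w]) y v := by
    intro y hy v w
    have h1 : HasFDerivAt (fun z => e.symm (α.inChart x₀ z)) _ y :=
      (e.symm.toContinuousLinearEquiv.hasFDerivAt (x := α.inChart x₀ y)).comp y
        (hd y hy).hasFDerivAt
    have h2 := (h1.clm_apply (hasFDerivAt_const w y)).fderiv
    have h3 : (fun z => α.inChart x₀ z ![w]) = fun z => e.symm (α.inChart x₀ z) w := by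
      funext z; rw [apply_fin_one]; rfl
    rw [h3, h2, h1.fderiv]
    simp
  have hdo : DifferentiableOn ℝ (fun y => e.symm (α.inChart x₀ y)) (Metric.ball (φ x₀) r) :=
    fun y hy => (e.symm.toContinuousLinearEquiv.differentiableAt.comp y
      (hd y hy)).differentiableWithinAt
  obtain ⟨g, hg⟩ := (convex_ball (φ x₀) r).exists_forall_hasFDerivAt_of_fderiv_symmetric
    Metric.isOpen_ball hdo (by
      intro y hy v w
      have h := hα' x₀ y (hB hy)
      have h1 := extDeriv_oneForm_apply (hd y hy) ![v, w]
      rw [h] at h1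
      simp only [Matrix.cons_val_zero, Matrix.cons_val_one] at h1
      rw [hfd y hy, hfd y hy]
      exact sub_eq_zero.1 h1.symm)
  refine ⟨φ.source ∩ φ ⁻¹' Metric.ball (φ x₀) r, ?_, ⟨mem_extChartAt_source x₀,
    Metric.mem_ball_self hr⟩, g ∘ φ, ?_⟩
  · exact (continuousOn_extChartAt x₀).isOpen_inter_preimage (isOpen_extChartAt_source x₀)
      Metric.isOpen_ball
  · rintro x ⟨hx, hx'⟩
    have h1 : HasMFDerivAt (𝓡 m) 𝓘(ℝ, EuclideanSpace ℝ (Fin m)) φ x _ :=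
      (mdifferentiableAt_extChartAt (I := 𝓡 m) (by simpa [hφ] using hx)).hasMFDerivAt
    have h2 : HasMFDerivAt 𝓘(ℝ, EuclideanSpace ℝ (Fin m)) 𝓘(ℝ, ℝ) g (φ x)
      (e.symm (α.inChart x₀ (φ x))) := (hg _ hx').hasMFDerivAt
    have h3 := HasMFDerivAt.comp x h2 h1
    let T : EuclideanSpace ℝ (Fin m) →L[ℝ] EuclideanSpace ℝ (Fin m) :=
      mfderiv (𝓡 m) 𝓘(ℝ, EuclideanSpace ℝ (Fin m)) φ x
    have h4 : (e.symm (α.inChart x₀ (φ x))).comp T = α.dual x := by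
      refine ContinuousLinearMap.ext fun v => ?_
      rw [DForm.dual_apply, ← α.inChart_extChartAt hx]
      change _ = α.inChart x₀ (φ x) (fun i => T (![v] i))
      rw [apply_fin_one]
      rfl
    rw [← h4]
    exact h3

/-- Two primitives of a 1-form differ by a locally constant function. -/
lemma IsPrimitiveOn.eventually_sub_eq {α : DForm m M 1} {f g : M → ℝ} {U : Set M} (hU : IsOpen U)
    (hf : IsPrimitiveOn α f U) (hg : IsPrimitiveOn α g U) {x₀ : M} (hx₀ : x₀ ∈ U) :
    ∀ᶠ x in 𝓝 x₀, g x - f x = g x₀ - f x₀ := by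
  set φ := extChartAt (𝓡 m) x₀ with hφ
  have hV : IsOpen (φ.target ∩ φ.symm ⁻¹' U) :=
    (continuousOn_extChartAt_symm x₀).isOpen_inter_preimage (isOpen_extChartAt_target x₀) hU
  obtain ⟨r, hr, hB⟩ := Metric.isOpen_iff.1 hV (φ x₀)
    ⟨mem_extChartAt_target x₀, by simpa [hφ] using hx₀⟩
  have hzero : ∀ y ∈ Metric.ball (φ x₀) r,
      HasFDerivAt (𝕜 := ℝ) (fun y : EuclideanSpace ℝ (Fin m) => g (φ.symm y) - f (φ.symm y))
        (0 : EuclideanSpace ℝ (Fin m) →L[ℝ] ℝ) y := by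
    intro y hy
    have h1 : HasMFDerivAt 𝓘(ℝ, EuclideanSpace ℝ (Fin m)) (𝓡 m) φ.symm y _ :=
      (((contMDiffOn_extChartAt_symm (n := ∞) x₀).contMDiffAt
        ((isOpen_extChartAt_target x₀).mem_nhds (hB hy).1)).mdifferentiableAt
          (by simp)).hasMFDerivAt
    have h2 : HasFDerivAt (fun y => f (φ.symm y)) _ y :=
      (HasMFDerivAt.comp y (hf _ (hB hy).2) h1).hasFDerivAt
    have h3 : HasFDerivAt (fun y => g (φ.symm y)) _ y :=
      (HasMFDerivAt.comp y (hg _ (hB hy).2) h1).hasFDerivAt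
    have h4 := h3.sub h2
    refine h4.congr_fderiv ?_
    exact sub_self _
  have hconst : ∀ y ∈ Metric.ball (φ x₀) r,
      g (φ.symm y) - f (φ.symm y) = g (φ.symm (φ x₀)) - f (φ.symm (φ x₀)) := fun y hy =>
    Metric.isOpen_ball.is_const_of_fderiv_eq_zero (convex_ball _ _).isPreconnected
      (fun z hz => (hzero z hz).differentiableAt.differentiableWithinAt)
      (fun z hz => (hzero z hz).fderiv) hy (Metric.mem_ball_self hr)
  have h1 : ∀ᶠ x in 𝓝 x₀, x ∈ φ.source := extChartAt_source_mem_nhds x₀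
  have h2 : ∀ᶠ x in 𝓝 x₀, φ x ∈ Metric.ball (φ x₀) r :=
    (continuousAt_extChartAt x₀).preimage_mem_nhds (Metric.ball_mem_nhds _ hr)
  filter_upwards [h1, h2] with x hx hx'
  have h3 := hconst _ hx'
  rwa [φ.left_inv hx, φ.left_inv (mem_extChartAt_source x₀)] at h3

/-- `F` is a primitive of the 1-form `α` along the map `c`: locally, `F = f ∘ c` for a primitive `f`
of `α`. -/
def IsPrimitiveAlong {Y : Type*} [TopologicalSpace Y] (α : DForm m M 1) (c : Y → M) (F : Y → ℝ) :
    Prop :=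
  ∀ y, ∃ (U : Set M) (f : M → ℝ), IsOpen U ∧ c y ∈ U ∧ IsPrimitiveOn α f U ∧
    ∀ᶠ z in 𝓝 y, F z = f (c z)

section Along

variable {Y Z : Type*} [TopologicalSpace Y] [TopologicalSpace Z] {α : DForm m M 1} {c : Y → M}
  {F G : Y → ℝ}

omit [IsManifold (𝓡 m) ∞ M] in
lemma IsPrimitiveAlong.comp (h : IsPrimitiveAlong α c F) {g : Z → Y} (hg : Continuous g) :
    IsPrimitiveAlong α (c ∘ g) (F ∘ g) := fun z => by
  obtain ⟨U, f, hU, hy, hf, hF⟩ := h (g z)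
  exact ⟨U, f, hU, hy, hf, hg.continuousAt.eventually hF⟩

omit [IsManifold (𝓡 m) ∞ M] in
lemma IsPrimitiveAlong.continuous (h : IsPrimitiveAlong α c F) (hc : Continuous c) :
    Continuous F := by
  refine continuous_iff_continuousAt.2 fun y => ?_
  obtain ⟨U, f, hU, hy, hf, hF⟩ := h y
  exact ((hf _ hy).continuousAt.comp hc.continuousAt).congr (hF.mono fun z hz => hz.symm)

/-- Two primitives along a map from a connected space differ by a constant. -/
lemma IsPrimitiveAlong.sub_eq [PreconnectedSpace Y] (hc : Continuous c)
    (hF : IsPrimitiveAlong α c F) (hG : IsPrimitiveAlong α c G) (y z : Y) :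
    G y - F y = G z - F z := by
  have h : IsLocallyConstant fun y => G y - F y := by
    rw [IsLocallyConstant.iff_eventually_eq]
    intro y
    obtain ⟨U, f, hU, hy, hf, hFf⟩ := hF y
    obtain ⟨V, g, hV, hy', hg, hGg⟩ := hG y
    have h1 := IsPrimitiveOn.eventually_sub_eq (hU.inter hV) (f := f) (g := g)
      (fun x hx => hf x hx.1) (fun x hx => hg x hx.2) ⟨hy, hy'⟩
    filter_upwards [hFf, hGg, hc.continuousAt.eventually h1] with z h2 h3 h4
    rw [h2, h3, h4, hFf.self_of_nhds, hGg.self_of_nhds]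
  exact h.apply_eq_of_preconnectedSpace y z

end Along

section Covering

/-- The real numbers with the discrete topology. -/
def DiscreteReal : Type := ℝ

/-- The real number underlying a point of `DiscreteReal`. -/
def DiscreteReal.toReal (r : DiscreteReal) : ℝ := r

/-- A real number as a point of `DiscreteReal`. -/
def DiscreteReal.ofReal (r : ℝ) : DiscreteReal := r

instance : TopologicalSpace DiscreteReal := ⊥

instance : DiscreteTopology DiscreteReal := ⟨rfl⟩

/-- The covering space of `M` of the germs of primitives of a closed 1-form, up to sign: over the
domain of a primitive `f`, the point with coordinate `r` stands for the germ of `f - r`. -/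
def primitiveCore {α : DForm m M 1} (hα : α.IsSmooth) (hα' : α.IsClosed) :
    FiberBundleCore {p : Set M × (M → ℝ) // IsOpen p.1 ∧ IsPrimitiveOn α p.2 p.1} M
      DiscreteReal where
  baseSet i := i.1.1
  isOpen_baseSet i := i.2.1
  indexAt x := ⟨((exists_isPrimitiveOn hα hα' x).choose,
    (exists_isPrimitiveOn hα hα' x).choose_spec.2.2.choose),
    (exists_isPrimitiveOn hα hα' x).choose_spec.1,
    (exists_isPrimitiveOn hα hα' x).choose_spec.2.2.choose_spec⟩
  mem_baseSet_at x := (exists_isPrimitiveOn hα hα' x).choose_spec.2.1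
  coordChange i j x r := .ofReal (r.toReal + (j.1.2 x - i.1.2 x))
  coordChange_self i x _ r := by
    rw [sub_self, add_zero]; rfl
  continuousOn_coordChange i j := by
    rintro ⟨x, r⟩ ⟨hx, -⟩
    refine ContinuousAt.continuousWithinAt ?_
    rw [ContinuousAt, nhds_discrete DiscreteReal, tendsto_pure, nhds_prod_eq,
      nhds_discrete DiscreteReal]
    have h := IsPrimitiveOn.eventually_sub_eq (i.2.1.inter j.2.1)
      (fun x hx => i.2.2 x hx.1) (fun x hx => j.2.2 x hx.2) hx
    have h2 : ∀ᶠ s in (pure r : Filter DiscreteReal), s = r := rfl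
    filter_upwards [h.prod_mk h2] with p hp
    rw [hp.1, hp.2]
  coordChange_comp i j k x _ r := by
    refine congrArg DiscreteReal.ofReal ?_
    change r.toReal + (j.1.2 x - i.1.2 x) + (k.1.2 x - j.1.2 x) = _
    ring

/-- A closed 1-form has a primitive along any map from a contractible space: lift a contraction to
the covering space of primitives. -/
lemma exists_isPrimitiveAlong {α : DForm m M 1} (hα : α.IsSmooth) (hα' : α.IsClosed) {Y : Type*}
    [TopologicalSpace Y] [ContractibleSpace Y] (c : C(Y, M)) : ∃ F, IsPrimitiveAlong α c F := by
  set Z := primitiveCore hα hα' with hZ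
  have cov : IsCoveringMap (π DiscreteReal Z.Fiber) := FiberBundle.isCoveringMap
  obtain ⟨y₀, ⟨H⟩⟩ := id_nullhomotopic Y
  let K : C(unitInterval × Y, M) := c.comp H.symm.toContinuousMap
  let f₀ : C(Y, TotalSpace DiscreteReal Z.Fiber) := .const Y ⟨c y₀, DiscreteReal.ofReal 0⟩
  have hK : ∀ y, K (0, y) = π DiscreteReal Z.Fiber (f₀ y) := fun y =>
    congrArg c (H.symm.apply_zero y)
  let T := cov.liftHomotopy K f₀ hK
  let ℓ : Y → TotalSpace DiscreteReal Z.Fiber := fun y => T (1, y)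
  have hℓ : Continuous ℓ := T.continuous.comp (by fun_prop)
  have hproj : ∀ y, (ℓ y).1 = c y := fun y => by
    refine (congrFun (cov.liftHomotopy_lifts K f₀ hK) (1, y)).trans ?_
    exact congrArg c (H.symm.apply_one y)
  refine ⟨fun y => (Z.indexAt (ℓ y).1).1.2 (ℓ y).1 - DiscreteReal.toReal (ℓ y).2, fun y => ?_⟩
  set i := Z.indexAt (c y) with hi
  -- the fibre coordinate of the lift is locally constant
  let ρ : Y → DiscreteReal := fun z => (Z.localTriv i (ℓ z)).2
  have hsrc : ℓ y ∈ (Z.localTriv i).source := by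
    rw [Z.mem_localTriv_source, hproj]
    exact Z.mem_baseSet_at _
  have hρ : ContinuousAt ρ y := by
    have h1 : ContinuousAt (fun w => (Z.localTriv i w).2) (ℓ y) :=
      continuousAt_snd.comp (((Z.localTriv i).continuousOn_toFun).continuousAt
        ((Z.localTriv i).open_source.mem_nhds hsrc))
    exact ContinuousAt.comp (g := fun w => (Z.localTriv i w).2) h1 hℓ.continuousAt
  rw [ContinuousAt, nhds_discrete DiscreteReal, tendsto_pure] at hρ
  refine ⟨i.1.1, fun x => i.1.2 x - (ρ y).toReal, i.2.1, Z.mem_baseSet_at _, ?_, ?_⟩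
  · intro x hx
    have h := (i.2.2 x hx).sub (hasMFDerivAt_const (I := 𝓡 m) (I' := 𝓘(ℝ, ℝ))
      (ρ y).toReal x)
    exact h.congr_mfderiv (sub_zero _)
  · filter_upwards [hρ] with z hz
    have h1 : (ρ z).toReal = DiscreteReal.toReal (ℓ z).2 +
      (i.1.2 (ℓ z).1 - (Z.indexAt (ℓ z).1).1.2 (ℓ z).1) := rfl
    rw [hz] at h1
    rw [h1, ← hproj z]
    ring

end Covering

end Primitives
end

/-! ### Periods of closed 1-forms on singular chains -/

noncomputable section

section Periods

open CategoryTheory AlgebraicTopology Simplicial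

variable {m : ℕ} {M : Type w} [TopologicalSpace M] [ChartedSpace (EuclideanSpace ℝ (Fin m)) M]
  [IsManifold (𝓡 m) ∞ M] {α : DForm m M 1}

instance contractibleSpace_stdSimplex (k : ℕ) : ContractibleSpace (stdSimplex ℝ (Fin (k + 1))) :=
  (convex_stdSimplex ℝ (Fin (k + 1))).contractibleSpace
    ⟨_, (stdSimplex.vertex (S := ℝ) (0 : Fin (k + 1))).2⟩

/-- The integral of a closed 1-form over a singular 1-simplex, which is only continuous: the
difference of the values at its ends of a primitive along it. -/
def simplexIntegral (hα : α ∈ closedOneForms m M) (c : C(stdSimplex ℝ (Fin 2), M)) : ℝ :=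
  (exists_isPrimitiveAlong hα.1 hα.2 c).choose (stdSimplex.vertex 1) -
    (exists_isPrimitiveAlong hα.1 hα.2 c).choose (stdSimplex.vertex 0)

lemma simplexIntegral_eq (hα : α ∈ closedOneForms m M) {c : C(stdSimplex ℝ (Fin 2), M)}
    {F : stdSimplex ℝ (Fin 2) → ℝ} (hF : IsPrimitiveAlong α c F) :
    simplexIntegral hα c = F (stdSimplex.vertex 1) - F (stdSimplex.vertex 0) := by
  have h := IsPrimitiveAlong.sub_eq c.continuous hF
    (exists_isPrimitiveAlong hα.1 hα.2 c).choose_spec (stdSimplex.vertex 1) (stdSimplex.vertex 0)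
  unfold simplexIntegral
  linarith

/-- The face of a singular 2-simplex opposite to a vertex. -/
def face (τ : C(stdSimplex ℝ (Fin 3), M)) (k : Fin 3) : C(stdSimplex ℝ (Fin 2), M) :=
  τ.comp ⟨stdSimplex.map k.succAbove, stdSimplex.continuous_map _⟩

/-- A primitive along a 2-simplex restricts to primitives along its faces. -/
lemma simplexIntegral_boundary (hα : α ∈ closedOneForms m M) (τ : C(stdSimplex ℝ (Fin 3), M)) :
    simplexIntegral hα (face τ 0) - simplexIntegral hα (face τ 1) + simplexIntegral hα (face τ 2) =
      0 := by
  obtain ⟨F, hF⟩ := exists_isPrimitiveAlong hα.1 hα.2 τ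
  have h : ∀ k : Fin 3, simplexIntegral hα (face τ k) =
      F (stdSimplex.vertex (k.succAbove 1)) - F (stdSimplex.vertex (k.succAbove 0)) := fun k => by
    have h1 : IsPrimitiveAlong α (face τ k) (F ∘ stdSimplex.map k.succAbove) :=
      hF.comp (stdSimplex.continuous_map _)
    rw [simplexIntegral_eq hα h1]
    simp only [Function.comp_apply, stdSimplex.map_vertex]
  rw [h, h, h]
  have e0 : (0 : Fin 3).succAbove 0 = 1 := rfl
  have e1 : (0 : Fin 3).succAbove 1 = 2 := rfl
  have e2 : (1 : Fin 3).succAbove 0 = 0 := rfl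
  have e3 : (1 : Fin 3).succAbove 1 = 2 := rfl
  have e4 : (2 : Fin 3).succAbove 0 = 0 := rfl
  have e5 : (2 : Fin 3).succAbove 1 = 1 := rfl
  rw [e0, e1, e2, e3, e4, e5]
  ring

/-- Multiples of a real number, as a morphism of `ℤ`-modules. -/
def multiples (r : ℝ) : coeffZ.{w} ⟶ ModuleCat.of ℤ (ULift.{w} ℝ) :=
  ModuleCat.ofHom ((LinearMap.toSpanSingleton ℤ (ULift.{w} ℝ) ⟨r⟩).comp
    (ULift.moduleEquiv : ULift.{w} ℤ ≃ₗ[ℤ] ℤ).toLinearMap)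

lemma multiples_one (r : ℝ) : (multiples.{w} r).hom ⟨1⟩ = ⟨r⟩ := by
  change (1 : ℤ) • (⟨r⟩ : ULift.{w} ℝ) = _
  exact one_smul _ _

lemma multiples_boundary {r s t : ℝ} (h : r - s + t = 0) :
    (-1 : ℤ) ^ 0 • multiples.{w} r + (-1 : ℤ) ^ 1 • multiples s + (-1 : ℤ) ^ 2 • multiples t = 0 := by
  ext n
  have h1 : (-1 : ℤ) ^ 0 • (n.down • r) + (-1 : ℤ) ^ 1 • (n.down • s) +
      (-1 : ℤ) ^ 2 • (n.down • t) = 0 := by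
    simp only [zsmul_eq_mul]
    push_cast
    linear_combination (n.down : ℝ) * h
  exact h1

/-- The generator of the singular chains given by a singular simplex. -/
def simplexChain {k : ℕ} (σ : (TopCat.toSSet.obj (TopCat.of M)) _⦋k⦌) :
    coeffZ.{w} ⟶ (singularChains M).X k :=
  (TopCat.toSSet.obj (TopCat.of M)).ιChainComplex σ

lemma simplexChain_d (τ : (TopCat.toSSet.obj (TopCat.of M)) _⦋2⦌) :
    CategoryStruct.comp (simplexChain τ) ((singularChains M).d 2 1) =
      (-1 : ℤ) ^ 0 • simplexChain ((TopCat.toSSet.obj (TopCat.of M)).δ 0 τ) +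
      (-1 : ℤ) ^ 1 • simplexChain ((TopCat.toSSet.obj (TopCat.of M)).δ 1 τ) +
      (-1 : ℤ) ^ 2 • simplexChain ((TopCat.toSSet.obj (TopCat.of M)).δ 2 τ) := by
  refine (SSet.ιChainComplex_d (TopCat.toSSet.obj (TopCat.of M)) coeffZ.{w} τ).trans ?_
  rw [Fin.sum_univ_three]
  rfl

/-- A singular simplex as a continuous map. -/
def simplexMap {k : ℕ} (σ : (TopCat.toSSet.obj (TopCat.of M)) _⦋k⦌) :
    C(stdSimplex ℝ (Fin (k + 1)), M) :=
  TopCat.toSSetObjEquiv (TopCat.of M) (Opposite.op ⦋k⦌) σ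

lemma simplexMap_δ (τ : (TopCat.toSSet.obj (TopCat.of M)) _⦋2⦌) (k : Fin 3) :
    simplexMap ((TopCat.toSSet.obj (TopCat.of M)).δ k τ) = face (simplexMap τ) k :=
  ContinuousMap.ext fun z => TopCat.toSSetObjEquiv_δ_apply τ k z

/-- The integral of a closed 1-form over singular 1-chains. -/
def chainIntegral (hα : α ∈ closedOneForms m M) :
    (singularChains M).X 1 ⟶ ModuleCat.of ℤ (ULift.{w} ℝ) :=
  ((TopCat.toSSet.obj (TopCat.of M)).isColimitChainComplexXCofan coeffZ.{w} 1).desc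
    (Limits.Cofan.mk _ fun σ => multiples (simplexIntegral hα (simplexMap σ)))

lemma ι_chainIntegral (hα : α ∈ closedOneForms m M)
    (σ : (TopCat.toSSet.obj (TopCat.of M)) _⦋1⦌) :
    CategoryStruct.comp (simplexChain σ) (chainIntegral hα) =
      multiples (simplexIntegral hα (simplexMap σ)) :=
  ((TopCat.toSSet.obj (TopCat.of M)).isColimitChainComplexXCofan coeffZ.{w} 1).fac _ ⟨σ⟩

lemma d_chainIntegral (hα : α ∈ closedOneForms m M) :
    CategoryStruct.comp ((singularChains M).d 2 1) (chainIntegral hα) = 0 := by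
  refine SSet.chainComplex_hom_ext (X := TopCat.toSSet.obj (TopCat.of M)) (R := coeffZ.{w})
    fun τ => ?_
  have hb := simplexIntegral_boundary hα (simplexMap τ)
  rw [← simplexMap_δ, ← simplexMap_δ, ← simplexMap_δ] at hb
  have h : CategoryStruct.comp (simplexChain τ) (CategoryStruct.comp ((singularChains M).d 2 1)
      (chainIntegral hα)) = 0 := by
    rw [← Category.assoc, simplexChain_d, Preadditive.add_comp, Preadditive.add_comp,
      Preadditive.zsmul_comp, Preadditive.zsmul_comp, Preadditive.zsmul_comp, ι_chainIntegral,
      ι_chainIntegral, ι_chainIntegral]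
    exact multiples_boundary hb
  exact h.trans Limits.comp_zero.symm

/-- Integration of a closed 1-form over cycles, as a homomorphism on `H₁(M; ℤ)`. -/
def periodHom (hα : α ∈ closedOneForms m M) : SingularH1 M →+ ℝ :=
  (AddEquiv.ulift : ULift.{w} ℝ ≃+ ℝ).toAddMonoidHom.comp
    (CategoryStruct.comp ((singularChains M).homologyι 1)
      ((singularChains M).descOpcycles (chainIntegral hα) 2 (by simp)
        (d_chainIntegral hα))).hom.toAddMonoidHom

lemma periodHom_loopClass (hα : α ∈ closedOneForms m M) (γ : C(Circle, M)) :
    periodHom hα (loopClass γ) = simplexIntegral hα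
      (simplexMap (loopSimplex γ)) := by
  have h : CategoryStruct.comp (CategoryStruct.comp
      ((singularChains M).liftCycles (loopChain γ) 0 (by simp) (loopChain_d γ))
      ((singularChains M).homologyπ 1)) (CategoryStruct.comp ((singularChains M).homologyι 1)
      ((singularChains M).descOpcycles (chainIntegral hα) 2 (by simp) (d_chainIntegral hα))) =
      multiples (simplexIntegral hα
        (simplexMap (loopSimplex γ))) := by
    simp only [Category.assoc]
    rw [HomologicalComplex.homology_π_ι_assoc, HomologicalComplex.p_descOpcycles,
      HomologicalComplex.liftCycles_i_assoc]
    exact ι_chainIntegral hα _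
  have h2 := congrArg (fun f : coeffZ.{w} ⟶ ModuleCat.of ℤ (ULift.{w} ℝ) => f.hom ⟨1⟩) h
  exact (congrArg ULift.down h2).trans (congrArg ULift.down (multiples_one.{w} _))

end Periods
end

/-! ### The de Rham pairing and classes of loops -/

noncomputable section

section LoopIntegral

variable {m : ℕ} {M : Type w} [TopologicalSpace M] [ChartedSpace (EuclideanSpace ℝ (Fin m)) M]
  [IsManifold (𝓡 m) ∞ M] {α : DForm m M 1}

/-- The fundamental theorem of calculus along a piecewise smooth loop. -/
lemma loopIntegral_eq_sub (hα : α.IsSmooth) {γ : C(Circle, M)}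
    (hγ : IsPiecewiseSmoothLoop (𝓡 m) γ) {c : ℝ → M} (hc : Continuous c)
    (hcγ : ∀ s ∈ Icc 0 (2 * Real.pi), c s = γ (Circle.exp s)) {F : ℝ → ℝ}
    (hF : IsPrimitiveAlong α c F) : loopIntegral α γ = F (2 * Real.pi) - F 0 := by
  obtain ⟨N, a, h0, hN, ha, hs⟩ := hγ
  set g : ℝ → ℝ := fun s => α (γ (Circle.exp s)) ![loopVelocity (𝓡 m) γ s] with hg
  have hsub : ∀ i < N, Icc (a i) (a (i + 1)) ⊆ Icc 0 (2 * Real.pi) := fun i hi => by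
    rw [← h0, ← hN]
    exact Icc_subset_Icc (partition_mono ha (Nat.zero_le i) hi.le) (partition_mono ha hi le_rfl)
  have hint : ∀ i < N, IntervalIntegrable g MeasureTheory.volume (a i) (a (i + 1)) := by
    intro i hi
    have h1 := (DForm.contDiffOn_pullOn_apply hα (uniqueDiffOn_Icc (ha i hi)) (hs i hi)
      ![1]).continuousOn
    refine (h1.intervalIntegrable_of_Icc (ha i hi).le).congr_uIoo fun s hs' => ?_
    rw [uIoo_of_le (ha i hi).le] at hs'
    have h2 : mfderivWithin 𝓘(ℝ, ℝ) (𝓡 m) (fun s : ℝ => γ (Circle.exp s))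
        (Icc (a i) (a (i + 1))) s = mfderiv 𝓘(ℝ, ℝ) (𝓡 m) (fun s : ℝ => γ (Circle.exp s)) s :=
      mfderivWithin_of_mem_nhds (Icc_mem_nhds hs'.1 hs'.2)
    change α.toModel _ (fun j => derivOn _ _ _ ((![1] : Fin 1 → ℝ) j)) = α.toModel _ _
    refine congrArg (α.toModel _) ?_
    funext j
    rw [Subsingleton.elim j 0]
    exact congrArg (fun T : ℝ →L[ℝ] EuclideanSpace ℝ (Fin m) => T 1) h2
  have hpiece : ∀ i < N, ∫ s in (a i)..(a (i + 1)), g s = F (a (i + 1)) - F (a i) := by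
    intro i hi
    refine intervalIntegral.integral_eq_sub_of_hasDerivAt_of_le (ha i hi).le
      (hF.continuous hc).continuousOn (fun s hs' => ?_) (hint i hi)
    obtain ⟨U, f, hU, hy, hf, hFf⟩ := hF s
    have hK : Icc (a i) (a (i + 1)) ∈ 𝓝 s := Icc_mem_nhds hs'.1 hs'.2
    have h1 : HasMFDerivAt 𝓘(ℝ, ℝ) (𝓡 m) (fun s : ℝ => γ (Circle.exp s)) s _ :=
      (((hs i hi s (Ioo_subset_Icc_self hs')).mdifferentiableWithinAt
        (by simp)).mdifferentiableAt hK).hasMFDerivAt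
    have hcs := hcγ s (hsub i hi (Ioo_subset_Icc_self hs'))
    have h2 := hf _ hy
    rw [hcs] at h2
    let T : ℝ →L[ℝ] EuclideanSpace ℝ (Fin m) :=
      mfderiv 𝓘(ℝ, ℝ) (𝓡 m) (fun s : ℝ => γ (Circle.exp s)) s
    have h3' : HasFDerivAt (f ∘ fun s : ℝ => γ (Circle.exp s))
        ((α.dual (γ (Circle.exp s))).comp T) s := (HasMFDerivAt.comp s h2 h1).hasFDerivAt
    have h3 := h3'.hasDerivAt
    have h4 : F =ᶠ[𝓝 s] f ∘ fun s : ℝ => γ (Circle.exp s) := by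
      filter_upwards [hFf, hK] with r hr hr'
      rw [hr, hcγ r (hsub i hi hr')]; rfl
    refine (h3.congr_of_eventuallyEq h4).congr_deriv ?_
    exact α.dual_apply _ _
  change ∫ s in (0 : ℝ)..(2 * Real.pi), g s = _
  rw [← h0, ← hN, ← intervalIntegral.sum_integral_adjacent_intervals hint,
    Finset.sum_congr rfl (fun i hi => hpiece i (Finset.mem_range.1 hi)),
    Finset.sum_range_sub (fun i => F (a i))]

/-- The angle as a parameter of the standard 1-simplex. -/
def angleSimplex (s : ℝ) : stdSimplex ℝ (Fin 2) :=
  ⟨![1 - (projIcc (0 : ℝ) 1 zero_le_one (s / (2 * Real.pi)) : ℝ),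
    projIcc (0 : ℝ) 1 zero_le_one (s / (2 * Real.pi))], by
    have h := (projIcc (0 : ℝ) 1 zero_le_one (s / (2 * Real.pi))).2
    refine ⟨fun i => ?_, by simp⟩
    fin_cases i
    · simpa using h.2
    · exact h.1⟩

lemma continuous_angleSimplex : Continuous angleSimplex := by
  refine Continuous.subtype_mk (continuous_pi fun i => ?_) _
  have h : Continuous fun s : ℝ => (projIcc (0 : ℝ) 1 zero_le_one (s / (2 * Real.pi)) : ℝ) :=
    continuous_subtype_val.comp (continuous_projIcc.comp (by fun_prop))
  fin_cases i
  · exact continuous_const.sub h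
  · exact h

lemma simplexIntegral_loopSimplex (hα : α ∈ closedOneForms m M) {γ : C(Circle, M)}
    (hγ : IsPiecewiseSmoothLoop (𝓡 m) γ) :
    simplexIntegral hα (simplexMap (loopSimplex γ)) = loopIntegral α γ := by
  have hpi := Real.two_pi_pos
  obtain ⟨F, hF⟩ := exists_isPrimitiveAlong hα.1 hα.2 (simplexMap (loopSimplex γ))
  rw [simplexIntegral_eq hα hF, loopIntegral_eq_sub hα.1 hγ
    ((simplexMap (loopSimplex γ)).continuous.comp continuous_angleSimplex) ?_
    (hF.comp continuous_angleSimplex)]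
  · have h1 : angleSimplex (2 * Real.pi) = stdSimplex.vertex 1 := by
      refine Subtype.ext (funext fun i => ?_)
      fin_cases i <;> simp [angleSimplex]
    have h2 : angleSimplex 0 = stdSimplex.vertex 0 := by
      refine Subtype.ext (funext fun i => ?_)
      fin_cases i <;> simp [angleSimplex]
    rw [Function.comp_apply, Function.comp_apply, h1, h2]
  · intro s hs
    change γ (Circle.exp (2 * Real.pi * (projIcc (0 : ℝ) 1 zero_le_one (s / (2 * Real.pi)) : ℝ))) = _
    rw [projIcc_of_mem zero_le_one ⟨div_nonneg hs.1 hpi.le, div_le_one_of_le₀ hs.2 hpi.le⟩]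
    congr 2
    field_simp

lemma continuous_loop (γ : C(Circle, M)) : Continuous fun s : ℝ => γ (Circle.exp s) :=
  γ.continuous.comp Circle.exp.continuous

/-- Cohomologous 1-forms have the same integrals along loops. -/
lemma loopIntegral_eq_of_sub_mem_exact {β : DForm m M 1} (hα : α ∈ closedOneForms m M)
    (hβ : β ∈ closedOneForms m M) (h : α - β ∈ exactOneForms m M) {γ : C(Circle, M)}
    (hγ : IsPiecewiseSmoothLoop (𝓡 m) γ) : loopIntegral α γ = loopIntegral β γ := by
  obtain ⟨f, hf, hf'⟩ := h
  obtain ⟨F, hF⟩ := exists_isPrimitiveAlong hβ.1 hβ.2 ⟨_, continuous_loop γ⟩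
  have hG : IsPrimitiveAlong α (fun s : ℝ => γ (Circle.exp s))
      (fun s => F s + f (γ (Circle.exp s))) := fun s => by
    obtain ⟨U, g, hU, hy, hg, hFg⟩ := hF s
    refine ⟨U, fun x => g x + f x, hU, hy, fun x hx => ?_,
      hFg.mono fun r hr => congrArg (· + f (γ (Circle.exp r))) hr⟩
    refine ((hg x hx).add (hf.mdifferentiable (by simp) x).hasMFDerivAt).congr_mfderiv ?_
    refine ContinuousLinearMap.ext fun v : EuclideanSpace ℝ (Fin m) => ?_
    refine Eq.trans ?_ (α.dual_apply x v).symm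
    have h1 := β.dual_apply x v
    have h2 : α.toModel x ![v] - β.toModel x ![v] = _ := hf' x v
    refine (congrArg₂ (· + ·) h1 h2.symm).trans ?_
    simp
  rw [loopIntegral_eq_sub hα.1 hγ (continuous_loop γ) (fun _ _ => rfl) hG,
    loopIntegral_eq_sub hβ.1 hγ (continuous_loop γ) (fun _ _ => rfl) hF]
  have : Circle.exp (2 * Real.pi) = Circle.exp 0 := by simp
  rw [this]
  ring

/-- The de Rham pairing of the class of a closed 1-form with the class of a loop is the integral.
The pairing is chosen among the homomorphisms with this property, and `periodHom` is one of them. -/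
lemma deRhamPairing_loopClass (hα : α ∈ closedOneForms m M) {γ : C(Circle, M)}
    (hγ : IsPiecewiseSmoothLoop (𝓡 m) γ) :
    deRhamPairing (deRhamClass α hα) (loopClass γ) = loopIntegral α γ := by
  have hex : ∃ φ : SingularH1 M →+ ℝ, ∀ (β : DForm m M 1) (hβ : β ∈ closedOneForms m M),
      deRhamClass β hβ = deRhamClass α hα → ∀ γ : C(Circle, M), IsPiecewiseSmoothLoop (𝓡 m) γ →
        φ (loopClass γ) = loopIntegral β γ := by
    refine ⟨periodHom hα, fun β hβ h γ hγ => ?_⟩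
    rw [periodHom_loopClass, simplexIntegral_loopSimplex hα hγ]
    have h1 : -(⟨β, hβ⟩ : (closedOneForms m M).toAddSubgroup) + ⟨α, hα⟩ ∈
        (exactOneForms m M).toAddSubgroup.addSubgroupOf (closedOneForms m M).toAddSubgroup :=
      QuotientAddGroup.eq.1 h
    have h2 : -β + α ∈ exactOneForms m M := h1
    rw [neg_add_eq_sub] at h2
    exact loopIntegral_eq_of_sub_mem_exact hα hβ h2 hγ
  exact Classical.epsilon_spec hex α hα rfl γ hγ

lemma loopIntegral_eq_zero_of_exact (hα : α ∈ closedOneForms m M) (h : α ∈ exactOneForms m M)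
    {γ : C(Circle, M)} (hγ : IsPiecewiseSmoothLoop (𝓡 m) γ) : loopIntegral α γ = 0 := by
  have h1 := loopIntegral_eq_of_sub_mem_exact hα (closedOneForms m M).zero_mem
    (by rwa [sub_zero]) hγ
  rw [h1]
  exact intervalIntegral.integral_zero

end LoopIntegral

section Cone

open CategoryTheory AlgebraicTopology Simplicial

variable {Y Z : Type w} [TopologicalSpace Y] [TopologicalSpace Z]

lemma singularH1Map_loopClass (f : C(Y, Z)) (γ : C(Circle, Y)) :
    singularH1Map f (loopClass γ) = loopClass (f.comp γ) := by
  let φ : singularChains Y ⟶ singularChains Z :=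
    ((singularChainComplexFunctor (ModuleCat.{w} ℤ)).obj coeffZ.{w}).map (TopCat.ofHom f)
  have h1 : CategoryStruct.comp (loopChain γ) (φ.f 1) = loopChain (f.comp γ) :=
    SSet.ι_chainComplexMap_f _ _ (TopCat.toSSet.map (TopCat.ofHom f)) coeffZ.{w} (loopSimplex γ)
  have h2 : CategoryStruct.comp (CategoryStruct.comp
      ((singularChains Y).liftCycles (loopChain γ) 0 (by simp) (loopChain_d γ))
      ((singularChains Y).homologyπ 1)) (HomologicalComplex.homologyMap φ 1) =
      CategoryStruct.comp ((singularChains Z).liftCycles (loopChain (f.comp γ)) 0 (by simp)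
        (loopChain_d (f.comp γ))) ((singularChains Z).homologyπ 1) := by
    rw [Category.assoc, HomologicalComplex.homologyπ_naturality,
      HomologicalComplex.liftCycles_comp_cyclesMap_assoc]
    congr 1
    rw [← cancel_mono ((singularChains Z).iCycles 1), HomologicalComplex.liftCycles_i,
      HomologicalComplex.liftCycles_i, h1]
  exact congrArg (fun g : coeffZ.{w} ⟶ (singularChains Z).homology 1 => g.hom ⟨1⟩) h2

/-- The standard 2-simplex as the cone over the circle, parametrized over the unit disc. -/
def coneMap (x : stdSimplex ℝ (Fin 3)) : ℂ :=
  ((x 1 + x 2 : ℝ) : ℂ) * (Circle.exp (2 * Real.pi * (x 2 / (x 1 + x 2))) : ℂ)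

lemma norm_coneMap (x : stdSimplex ℝ (Fin 3)) : ‖coneMap x‖ = x 1 + x 2 := by
  rw [coneMap, norm_mul, Circle.norm_coe, mul_one, Complex.norm_real, Real.norm_of_nonneg]
  exact add_nonneg (x.2.1 1) (x.2.1 2)

lemma continuous_coneMap : Continuous coneMap := by
  have hc : ∀ i, Continuous fun x : stdSimplex ℝ (Fin 3) => x i := fun i =>
    (continuous_apply i).comp continuous_subtype_val
  have h12 : Continuous fun x : stdSimplex ℝ (Fin 3) => x 1 + x 2 := (hc 1).add (hc 2)
  rw [continuous_iff_continuousAt]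
  intro x
  by_cases hx : x 1 + x 2 = 0
  · have h0 : coneMap x = 0 := by rw [← norm_eq_zero, norm_coneMap, hx]
    rw [ContinuousAt, h0, tendsto_zero_iff_norm_tendsto_zero]
    simp only [norm_coneMap]
    rw [← hx]
    exact h12.continuousAt
  · refine ContinuousAt.mul (Complex.continuous_ofReal.comp h12).continuousAt ?_
    exact (continuous_subtype_val.comp Circle.exp.continuous).continuousAt.comp
      (continuousAt_const.mul ((hc 2).continuousAt.div h12.continuousAt hx))

lemma map_succAbove_apply (k : Fin 3) (y : stdSimplex ℝ (Fin 2)) (i : Fin 3) :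
    stdSimplex.map k.succAbove y i =
      (if k.succAbove 0 = i then y 0 else 0) + (if k.succAbove 1 = i then y 1 else 0) := by
  rw [stdSimplex.map_coe, FunOnFinite.linearMap_apply_apply, Finset.sum_filter, Fin.sum_univ_two]

/-- A loop that bounds a disc is null-homologous. -/
lemma loopClass_eq_zero_of_disc {v : ℂ → Z} (hv : ContinuousOn v (Metric.closedBall 0 1))
    (γ : C(Circle, Z)) (hγ : ∀ z : Circle, γ z = v z) : loopClass γ = 0 := by
  have hmaps : ∀ x, coneMap x ∈ Metric.closedBall (0 : ℂ) 1 := fun x => by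
    rw [mem_closedBall_zero_iff, norm_coneMap]
    have h := x.2.2
    rw [Fin.sum_univ_three] at h
    have h0 := x.2.1 0
    change x 0 + x 1 + x 2 = 1 at h
    change 0 ≤ x 0 at h0
    linarith
  let τ' : C(stdSimplex ℝ (Fin 3), Z) := ⟨fun x => v (coneMap x), by
    have := hv.comp_continuous continuous_coneMap hmaps
    exact this⟩
  let τ : (TopCat.toSSet.obj (TopCat.of Z)) _⦋2⦌ :=
    (TopCat.toSSetObjEquiv (TopCat.of Z) (Opposite.op ⦋2⦌)).symm τ'
  have hτ : simplexMap τ = τ' := Equiv.apply_symm_apply _ _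
  have hinj : Function.Injective (simplexMap (M := Z) (k := 1)) := Equiv.injective _
  -- the values of the cone on a face
  have hval : ∀ (k : Fin 3) (y : stdSimplex ℝ (Fin 2)),
      face τ' k y = v (coneMap (stdSimplex.map k.succAbove y)) := fun _ _ => rfl
  have h1 : coneMap ∘ stdSimplex.map (Fin.succAbove (1 : Fin 3)) =
      coneMap ∘ stdSimplex.map (Fin.succAbove (2 : Fin 3)) := by
    funext y
    have e1 : stdSimplex.map (Fin.succAbove (1 : Fin 3)) y 1 = 0 := by
      rw [map_succAbove_apply]; simp [Fin.succAbove]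
    have e2 : stdSimplex.map (Fin.succAbove (1 : Fin 3)) y 2 = y 1 := by
      rw [map_succAbove_apply]; simp [Fin.succAbove]
    have e3 : stdSimplex.map (Fin.succAbove (2 : Fin 3)) y 1 = y 1 := by
      rw [map_succAbove_apply]; simp [Fin.succAbove]
    have e4 : stdSimplex.map (Fin.succAbove (2 : Fin 3)) y 2 = 0 := by
      rw [map_succAbove_apply]; simp [Fin.succAbove]
    simp only [Function.comp_apply, coneMap, e1, e2, e3, e4]
    by_cases hy : y 1 = 0
    · simp [hy]
    · simp [hy]
  have h0 : ∀ y : stdSimplex ℝ (Fin 2), coneMap (stdSimplex.map (Fin.succAbove (0 : Fin 3)) y) =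
      Circle.exp (2 * Real.pi * y 1) := by
    intro y
    have e1 : stdSimplex.map (Fin.succAbove (0 : Fin 3)) y 1 = y 0 := by
      rw [map_succAbove_apply]; simp [Fin.succAbove]
    have e2 : stdSimplex.map (Fin.succAbove (0 : Fin 3)) y 2 = y 1 := by
      rw [map_succAbove_apply]; simp [Fin.succAbove]
    have hs : y 0 + y 1 = 1 := by
      have h := y.2.2
      rw [Fin.sum_univ_two] at h
      exact h
    simp only [coneMap, e1, e2, hs, div_one, Complex.ofReal_one, one_mul]
  have hδ0 : (TopCat.toSSet.obj (TopCat.of Z)).δ (0 : Fin 3) τ = loopSimplex γ := by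
    apply hinj
    rw [simplexMap_δ, hτ]
    ext y
    rw [hval, h0, ← hγ]
    rfl
  have hδ12 : (TopCat.toSSet.obj (TopCat.of Z)).δ (1 : Fin 3) τ =
      (TopCat.toSSet.obj (TopCat.of Z)).δ (2 : Fin 3) τ := by
    apply hinj
    rw [simplexMap_δ, simplexMap_δ, hτ]
    ext y
    rw [hval, hval]
    exact congrArg v (congrFun h1 y)
  have hb : loopChain γ = CategoryStruct.comp (simplexChain τ) ((singularChains Z).d 2 1) := by
    rw [simplexChain_d, hδ0, hδ12]
    simp
    rfl
  have h := (singularChains Z).liftCycles_homologyπ_eq_zero_of_boundary (loopChain γ) 0 (by simp)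
    (simplexChain τ) hb
  exact congrArg (fun g : coeffZ.{w} ⟶ (singularChains Z).homology 1 => g.hom ⟨1⟩) h

end Cone
end

/-! ### Frames, parallel sections and holonomy -/

noncomputable section

section

universe v

variable {E : Type*} [NormedAddCommGroup E] [NormedSpace ℝ E] {H : Type*} [TopologicalSpace H]
  {J : ModelWithCorners ℝ E H} {M : Type*} [TopologicalSpace M] [ChartedSpace H M]
  [IsManifold J ∞ M]

namespace UnitaryLineBundle

/-- The local frame of `Λ` given by the preferred trivialization at `x₀`. -/
def frame (Λ : UnitaryLineBundle J M) (x₀ x : M) : Λ.fiber x :=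
  (trivializationAt ℂ Λ.fiber x₀).symm x 1

/-- The domain of the local frame at `x₀`. -/
def frameSet (Λ : UnitaryLineBundle J M) (x₀ : M) : Set M :=
  (trivializationAt ℂ Λ.fiber x₀).baseSet

/-- The coordinate of a vector of `Λ` with respect to the local frame at `x₀`. -/
def coord (Λ : UnitaryLineBundle J M) (x₀ x : M) : Λ.fiber x →L[ℂ] ℂ :=
  (trivializationAt ℂ Λ.fiber x₀).continuousLinearMapAt ℂ x

variable (Λ : UnitaryLineBundle J M) {x₀ x : M}

lemma isOpen_frameSet (x₀ : M) : IsOpen (Λ.frameSet x₀) :=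
  (trivializationAt ℂ Λ.fiber x₀).open_baseSet

lemma mem_frameSet (x₀ : M) : x₀ ∈ Λ.frameSet x₀ :=
  mem_baseSet_trivializationAt ℂ Λ.fiber x₀

lemma coord_eq (hx : x ∈ Λ.frameSet x₀) (v : Λ.fiber x) :
    Λ.coord x₀ x v = (trivializationAt ℂ Λ.fiber x₀ ⟨x, v⟩).2 := by
  have := Trivialization.coe_linearMapAt_of_mem (R := ℂ) (trivializationAt ℂ Λ.fiber x₀) hx
  exact congrFun this v

lemma coord_frame (hx : x ∈ Λ.frameSet x₀) : Λ.coord x₀ x (Λ.frame x₀ x) = 1 := by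
  rw [Λ.coord_eq hx]
  exact congrArg Prod.snd (Trivialization.apply_mk_symm (trivializationAt ℂ Λ.fiber x₀) hx (1 : ℂ))

lemma coord_injective (hx : x ∈ Λ.frameSet x₀) : Function.Injective (Λ.coord x₀ x) := by
  intro v w h
  rw [Λ.coord_eq hx, Λ.coord_eq hx] at h
  have hv := Trivialization.symm_apply_apply_mk (trivializationAt ℂ Λ.fiber x₀) hx v
  have hw := Trivialization.symm_apply_apply_mk (trivializationAt ℂ Λ.fiber x₀) hx w
  rw [← hv, ← hw, h]

lemma coord_smul_frame (hx : x ∈ Λ.frameSet x₀) (v : Λ.fiber x) :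
    Λ.coord x₀ x v • Λ.frame x₀ x = v := by
  apply Λ.coord_injective hx
  rw [map_smul, Λ.coord_frame hx, smul_eq_mul, mul_one]

lemma frame_ne_zero (hx : x ∈ Λ.frameSet x₀) : Λ.frame x₀ x ≠ 0 := by
  intro h
  have := Λ.coord_frame hx
  rw [h, map_zero] at this
  exact zero_ne_one this

/-- The fibres are one-dimensional. -/
lemma exists_eq_smul {v : Λ.fiber x} (hv : v ≠ 0) (w : Λ.fiber x) : ∃ z : ℂ, w = z • v := by
  have hx := Λ.mem_frameSet x
  have hv' : Λ.coord x x v ≠ 0 := fun h => hv (Λ.coord_injective hx (by rw [h, map_zero]))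
  refine ⟨Λ.coord x x w / Λ.coord x x v, Λ.coord_injective hx ?_⟩
  rw [map_smul, smul_eq_mul, div_mul_cancel₀ _ hv']

lemma smoothSectionAt_iff (hx : x ∈ Λ.frameSet x₀) (s : ∀ x, Λ.fiber x) :
    Λ.SmoothSectionAt s x ↔ ContMDiffAt J 𝓘(ℝ, ℂ) ∞ (fun y => Λ.coord x₀ y (s y)) x := by
  rw [SmoothSectionAt, Trivialization.contMDiffAt_section_iff (IB := J)
    (trivializationAt ℂ Λ.fiber x₀) hx]
  refine Filter.EventuallyEq.contMDiffAt_iff ?_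
  filter_upwards [(Λ.isOpen_frameSet x₀).mem_nhds hx] with y hy
  rw [Λ.coord_eq hy]

lemma smoothSectionAt_frame (hx : x ∈ Λ.frameSet x₀) : Λ.SmoothSectionAt (Λ.frame x₀) x := by
  rw [Λ.smoothSectionAt_iff hx]
  refine contMDiffAt_const (c := (1 : ℂ)) |>.congr_of_eventuallyEq ?_
  filter_upwards [(Λ.isOpen_frameSet x₀).mem_nhds hx] with y hy
  exact Λ.coord_frame hy

lemma continuousWithinAt_coord {Y : Type*} [TopologicalSpace Y] {c : Y → M}
    {τ : ∀ t, Λ.fiber (c t)} {K : Set Y} {t : Y}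
    (h : ContinuousWithinAt (fun t => (⟨c t, τ t⟩ : TotalSpace ℂ Λ.fiber)) K t)
    (ht : c t ∈ Λ.frameSet x₀) : ContinuousWithinAt (fun t => Λ.coord x₀ (c t) (τ t)) K t := by
  have hc : ContinuousWithinAt c K t :=
    (FiberBundle.continuous_proj ℂ Λ.fiber).continuousAt.comp_continuousWithinAt h
  have h1 : ContinuousAt (trivializationAt ℂ Λ.fiber x₀) (⟨c t, τ t⟩ : TotalSpace ℂ Λ.fiber) :=
    (trivializationAt ℂ Λ.fiber x₀).continuousAt
      ((trivializationAt ℂ Λ.fiber x₀).mem_source.2 ht)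
  have h2 : ContinuousWithinAt (fun r => (trivializationAt ℂ Λ.fiber x₀ ⟨c r, τ r⟩).2) K t :=
    continuous_snd.continuousAt.comp_continuousWithinAt
      (ContinuousAt.comp_continuousWithinAt (f := fun t => (⟨c t, τ t⟩ : TotalSpace ℂ Λ.fiber)) h1 h)
  refine h2.congr_of_eventuallyEq ?_ (Λ.coord_eq ht _)
  filter_upwards [hc.preimage_mem_nhdsWithin ((Λ.isOpen_frameSet x₀).mem_nhds ht)] with r hr
  exact Λ.coord_eq hr _

lemma continuousWithinAt_of_coord {Y : Type*} [TopologicalSpace Y] {c : Y → M}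
    {τ : ∀ t, Λ.fiber (c t)} {K : Set Y} {t : Y} (hc : ContinuousWithinAt c K t)
    (ht : c t ∈ Λ.frameSet x₀) (h : ContinuousWithinAt (fun t => Λ.coord x₀ (c t) (τ t)) K t) :
    ContinuousWithinAt (fun t => (⟨c t, τ t⟩ : TotalSpace ℂ Λ.fiber)) K t := by
  have h1 : ContinuousAt (trivializationAt ℂ Λ.fiber x₀).toOpenPartialHomeomorph.symm
      (c t, Λ.coord x₀ (c t) (τ t)) :=
    (trivializationAt ℂ Λ.fiber x₀).toOpenPartialHomeomorph.continuousAt_symm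
      ((trivializationAt ℂ Λ.fiber x₀).mem_target.2 ht)
  have h2 := h1.comp_continuousWithinAt (f := fun t => (c t, Λ.coord x₀ (c t) (τ t))) (hc.prodMk h)
  have key : ∀ r, c r ∈ Λ.frameSet x₀ → (⟨c r, τ r⟩ : TotalSpace ℂ Λ.fiber) =
      (trivializationAt ℂ Λ.fiber x₀).toOpenPartialHomeomorph.symm
        (c r, Λ.coord x₀ (c r) (τ r)) := by
    intro r hr
    rw [Λ.coord_eq hr, ← Trivialization.mk_symm _ hr, Trivialization.symm_apply_apply_mk _ hr]
  refine h2.congr_of_eventuallyEq ?_ (key t ht)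
  filter_upwards [hc.preimage_mem_nhdsWithin ((Λ.isOpen_frameSet x₀).mem_nhds ht)] with r hr
  exact key r hr

variable {Λ} {c : ℝ → M} {a b : ℝ} {τ τ₁ τ₂ : ∀ t, Λ.fiber (c t)}

lemma continuousOn_inner
    (h₁ : ContinuousOn (fun t => (⟨c t, τ₁ t⟩ : TotalSpace ℂ Λ.fiber)) (Icc a b))
    (h₂ : ContinuousOn (fun t => (⟨c t, τ₂ t⟩ : TotalSpace ℂ Λ.fiber)) (Icc a b)) :
    ContinuousOn (fun t => inner ℂ (τ₁ t) (τ₂ t)) (Icc a b) := by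
  intro t ht
  have hc : ContinuousWithinAt c (Icc a b) t :=
    (FiberBundle.continuous_proj ℂ Λ.fiber).continuousAt.comp_continuousWithinAt (h₁ t ht)
  have hx := Λ.mem_frameSet (c t)
  have k₁ := Λ.continuousWithinAt_coord (h₁ t ht) hx
  have k₂ := Λ.continuousWithinAt_coord (h₂ t ht) hx
  have k₃ : ContinuousWithinAt
      (fun t' => inner ℂ (Λ.frame (c t) (c t')) (Λ.frame (c t) (c t'))) (Icc a b) t :=
    (Λ.inner_smooth _ _ _ (Λ.smoothSectionAt_frame hx)
      (Λ.smoothSectionAt_frame hx)).continuousAt.comp_continuousWithinAt hc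
  have k₄ := ((Complex.continuous_conj.continuousAt.comp_continuousWithinAt k₁).mul k₂).mul k₃
  have key : ∀ r, c r ∈ Λ.frameSet (c t) → inner ℂ (τ₁ r) (τ₂ r) =
      (starRingEnd ℂ) (Λ.coord (c t) (c r) (τ₁ r)) * Λ.coord (c t) (c r) (τ₂ r) *
        inner ℂ (Λ.frame (c t) (c r)) (Λ.frame (c t) (c r)) := by
    intro r hr
    conv_lhs => rw [← Λ.coord_smul_frame hr (τ₁ r), ← Λ.coord_smul_frame hr (τ₂ r)]
    rw [inner_smul_left, inner_smul_right, mul_assoc]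
  refine k₄.congr_of_eventuallyEq ?_ (key t hx)
  filter_upwards [hc.preimage_mem_nhdsWithin ((Λ.isOpen_frameSet (c t)).mem_nhds hx)] with r hr
  exact key r hr

/-- A unitary connection preserves the inner product: its derivative along two parallel sections
vanishes. -/
lemma inner_eq_of_isParallelAlong (h₁ : Λ.IsParallelAlong c a b τ₁)
    (h₂ : Λ.IsParallelAlong c a b τ₂) {S : Set ℝ} (hS : S.Finite)
    (hc : ∀ t ∈ Ioo a b, t ∉ S → MDifferentiableAt 𝓘(ℝ, ℝ) J c t) {t : ℝ} (ht : t ∈ Icc a b) :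
    inner ℂ (τ₁ t) (τ₂ t) = inner ℂ (τ₁ a) (τ₂ a) := by
  obtain ⟨hc₁, S₁, hS₁, h₁⟩ := h₁
  obtain ⟨hc₂, S₂, hS₂, h₂⟩ := h₂
  have hcont := (continuousOn_inner hc₁ hc₂).mono (Icc_subset_Icc le_rfl ht.2)
  -- the metric condition on the connection, contracted with the two equations of parallel transport
  have hd : ∀ r ∈ Ioo a t \ (S₁ ∪ S₂ ∪ S), HasDerivAt (fun r => inner ℂ (τ₁ r) (τ₂ r)) 0 r := by
    rintro r ⟨hr, hrS⟩
    have hr' : r ∈ Ioo a b := ⟨hr.1, hr.2.trans_le ht.2⟩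
    obtain ⟨s₁, f₁, f₁', hs₁, -, he₁, hf₁, hp₁⟩ := h₁ r hr' fun h => hrS (.inl (.inl h))
    obtain ⟨s₂, f₂, f₂', hs₂, -, he₂, hf₂, hp₂⟩ := h₂ r hr' fun h => hrS (.inl (.inr h))
    have hcr := hc r hr' fun h => hrS (.inr h)
    have hin : MDifferentiableAt J 𝓘(ℝ, ℂ) (fun y => inner ℂ (s₁ y) (s₂ y)) (c r) :=
      (Λ.inner_smooth _ _ _ hs₁ hs₂).mdifferentiableAt (by simp)
    have hu := Λ.conn_unitary s₁ s₂ (c r) hs₁ hs₂ (mfderiv 𝓘(ℝ, ℝ) J c r (1 : ℝ))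
    let T : E →L[ℝ] ℂ := mfderiv J 𝓘(ℝ, ℂ) (fun y => inner ℂ (s₁ y) (s₂ y)) (c r)
    let V : ℝ →L[ℝ] E := mfderiv 𝓘(ℝ, ℝ) J c r
    have hder : HasDerivAt (fun r => inner ℂ (s₁ (c r)) (s₂ (c r))) (T (V 1)) r := by
      have h : HasFDerivAt (fun r => inner ℂ (s₁ (c r)) (s₂ (c r))) (T.comp V) r :=
        (HasMFDerivAt.comp r hin.hasMFDerivAt hcr.hasMFDerivAt).hasFDerivAt
      exact h.hasDerivAt
    change T (V 1) = _ at hu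
    have hconj : HasDerivAt (fun r => (starRingEnd ℂ) (f₁ r)) ((starRingEnd ℂ) f₁') r := by
      simpa using hf₁.star
    have hall := (hconj.mul hf₂).mul hder
    have hval : ((starRingEnd ℂ) f₁' * f₂ r + (starRingEnd ℂ) (f₁ r) * f₂') *
        inner ℂ (s₁ (c r)) (s₂ (c r)) + (starRingEnd ℂ) (f₁ r) * f₂ r * T (V 1) = 0 := by
      have e1 : inner ℂ (f₁' • s₁ (c r) + f₁ r • Λ.conn s₁ (c r) (mfderiv 𝓘(ℝ, ℝ) J c r (1 : ℝ)))
          (f₂ r • s₂ (c r)) + inner ℂ (f₁ r • s₁ (c r))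
          (f₂' • s₂ (c r) + f₂ r • Λ.conn s₂ (c r) (mfderiv 𝓘(ℝ, ℝ) J c r (1 : ℝ))) = 0 := by
        rw [hp₁, hp₂, inner_zero_left, inner_zero_right, add_zero]
      simp only [inner_add_left, inner_add_right, inner_smul_left, inner_smul_right] at e1
      rw [← e1, hu]
      ring
    refine (hall.congr_deriv hval).congr_of_eventuallyEq ?_
    filter_upwards [he₁, he₂] with r' h1 h2
    simp only [Pi.mul_apply]
    rw [h1, h2, inner_smul_left, inner_smul_right, mul_assoc]
  have := MeasureTheory.integral_eq_of_hasDerivAt_off_countable_of_le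
    (fun r => inner ℂ (τ₁ r) (τ₂ r)) (fun _ => (0 : ℂ)) ht.1
    ((hS₁.union hS₂).union hS).countable hcont hd intervalIntegrable_const
  rw [intervalIntegral.integral_zero] at this
  exact (sub_eq_zero.1 this.symm)

/-- Uniqueness of parallel transport. -/
lemma IsParallelAlong.eq_smul (h₁ : Λ.IsParallelAlong c a b τ₁) (h₂ : Λ.IsParallelAlong c a b τ₂)
    {S : Set ℝ} (hS : S.Finite) (hc : ∀ t ∈ Ioo a b, t ∉ S → MDifferentiableAt 𝓘(ℝ, ℝ) J c t)
    (h0 : τ₁ a ≠ 0) {z : ℂ} (hz : τ₂ a = z • τ₁ a) {t : ℝ} (ht : t ∈ Icc a b) :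
    τ₁ t ≠ 0 ∧ τ₂ t = z • τ₁ t := by
  have e₁ := inner_eq_of_isParallelAlong h₁ h₁ hS hc ht
  have e₂ := inner_eq_of_isParallelAlong h₁ h₂ hS hc ht
  have hn : τ₁ t ≠ 0 := by
    intro h
    rw [h, inner_zero_left] at e₁
    exact h0 (inner_self_eq_zero.1 e₁.symm)
  obtain ⟨k, hk⟩ := Λ.exists_eq_smul hn (τ₂ t)
  rw [hk, hz, inner_smul_right, inner_smul_right, e₁] at e₂
  refine ⟨hn, ?_⟩
  rw [hk, mul_right_cancel₀ (fun h => h0 (inner_self_eq_zero.1 h)) e₂]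

lemma IsParallelAlong.const_smul (h : Λ.IsParallelAlong c a b τ) (z : ℂ) :
    Λ.IsParallelAlong c a b (fun t => z • τ t) := by
  obtain ⟨hc, S, hS, h⟩ := h
  refine ⟨fun t ht => ?_, S, hS, fun t ht htS => ?_⟩
  · have hx := Λ.mem_frameSet (c t)
    have h1 := Λ.continuousWithinAt_coord (hc t ht) hx
    refine Λ.continuousWithinAt_of_coord ((FiberBundle.continuous_proj ℂ
      Λ.fiber).continuousAt.comp_continuousWithinAt (hc t ht)) hx ?_
    simp only [map_smul]
    exact h1.const_smul z
  · obtain ⟨s, f, f', hs, hs0, he, hf, hp⟩ := h t ht htS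
    refine ⟨s, fun r => z * f r, z * f', hs, hs0, ?_, hf.const_mul z, ?_⟩
    · filter_upwards [he] with r hr
      rw [hr, smul_smul]
    · rw [mul_smul, mul_smul, ← smul_add, hp, smul_zero]

lemma IsParallelAlong.congr (h : Λ.IsParallelAlong c a b τ₁) (he : ∀ t ∈ Icc a b, τ₁ t = τ₂ t) :
    Λ.IsParallelAlong c a b τ₂ := by
  obtain ⟨hc, S, hS, h⟩ := h
  refine ⟨hc.congr fun t ht => by simp only [he t ht], S, hS, fun t ht htS => ?_⟩
  obtain ⟨s, f, f', hs, hs0, hef, hf, hp⟩ := h t ht htS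
  refine ⟨s, f, f', hs, hs0, ?_, hf, hp⟩
  filter_upwards [hef, isOpen_Ioo.mem_nhds ht] with r hr hr'
  rw [← he r (Ioo_subset_Icc_self hr'), hr]

lemma IsParallelAlong.trans {d : ℝ} (h₁ : Λ.IsParallelAlong c a b τ)
    (h₂ : Λ.IsParallelAlong c b d τ) (hab : a ≤ b) (hbd : b ≤ d) : Λ.IsParallelAlong c a d τ := by
  obtain ⟨hc₁, S₁, hS₁, h₁⟩ := h₁
  obtain ⟨hc₂, S₂, hS₂, h₂⟩ := h₂
  refine ⟨?_, insert b (S₁ ∪ S₂), (hS₁.union hS₂).insert b, fun t ht htS => ?_⟩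
  · rw [← Icc_union_Icc_eq_Icc hab hbd]
    exact hc₁.union_of_isClosed hc₂ isClosed_Icc isClosed_Icc
  · simp only [mem_insert_iff, mem_union, not_or] at htS
    rcases lt_or_gt_of_ne htS.1 with h | h
    · exact h₁ t ⟨ht.1, h⟩ htS.2.1
    · exact h₂ t ⟨h, ht.2⟩ htS.2.2

/-- A multiple of a local frame along a curve is parallel if its coefficient solves the equation of
parallel transport. -/
lemma isParallelAlong_of_frame {x₀ : M} (hcc : ContinuousOn c (Icc a b))
    (hc : ∀ t ∈ Icc a b, c t ∈ Λ.frameSet x₀) {q : ℝ → ℂ} (hq : ContinuousOn q (Icc a b))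
    {S : Set ℝ} (hS : S.Finite) (hd : ∀ t ∈ Ioo a b, t ∉ S → ∃ q' : ℂ, HasDerivAt q q' t ∧
      q' • Λ.frame x₀ (c t) +
        q t • Λ.conn (Λ.frame x₀) (c t) (mfderiv 𝓘(ℝ, ℝ) J c t (1 : ℝ)) = 0) :
    Λ.IsParallelAlong c a b (fun t => q t • Λ.frame x₀ (c t)) := by
  refine ⟨fun t ht => ?_, S, hS, fun t ht htS => ?_⟩
  · refine Λ.continuousWithinAt_of_coord (hcc t ht) (hc t ht) ((hq t ht).congr ?_ ?_)
    · intro r hr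
      rw [map_smul, Λ.coord_frame (hc r hr), smul_eq_mul, mul_one]
    · rw [map_smul, Λ.coord_frame (hc t ht), smul_eq_mul, mul_one]
  · obtain ⟨q', h1, h2⟩ := hd t ht htS
    have hx := hc t (Ioo_subset_Icc_self ht)
    exact ⟨Λ.frame x₀, q, q', Λ.smoothSectionAt_frame hx, Λ.frame_ne_zero hx,
      Eventually.of_forall fun _ => rfl, h1, h2⟩

/-- The holonomy, which is chosen among the numbers `h` with the property of `hend` for some
parallel section, is computed by any nonzero parallel section. -/
lemma holonomy_eq {γ : C(Circle, M)} {S : Set ℝ} (hS : S.Finite)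
    (hc : ∀ t ∈ Ioo 0 (2 * Real.pi), t ∉ S →
      MDifferentiableAt 𝓘(ℝ, ℝ) J (fun s : ℝ => γ (Circle.exp s)) t)
    {τ : ∀ t : ℝ, Λ.fiber (γ (Circle.exp t))}
    (hτ : Λ.IsParallelAlong (fun t => γ (Circle.exp t)) 0 (2 * Real.pi) τ) (h0 : τ 0 ≠ 0) {h : ℂ}
    (hend : (⟨γ (Circle.exp (2 * Real.pi)), τ (2 * Real.pi)⟩ : TotalSpace ℂ Λ.fiber) =
      ⟨γ (Circle.exp 0), h • τ 0⟩) : Λ.holonomy γ = h := by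
  obtain ⟨τ', hτ', h0', hend'⟩ := Classical.epsilon_spec
    (p := fun h : ℂ => ∃ τ : ∀ t : ℝ, Λ.fiber (γ (Circle.exp t)),
      Λ.IsParallelAlong (fun t => γ (Circle.exp t)) 0 (2 * Real.pi) τ ∧ τ 0 ≠ 0 ∧
      (⟨γ (Circle.exp (2 * Real.pi)), τ (2 * Real.pi)⟩ : TotalSpace ℂ Λ.fiber) =
        ⟨γ (Circle.exp 0), h • τ 0⟩) ⟨h, τ, hτ, h0, hend⟩
  change (⟨γ (Circle.exp (2 * Real.pi)), τ' (2 * Real.pi)⟩ : TotalSpace ℂ Λ.fiber) =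
        ⟨γ (Circle.exp 0), Λ.holonomy γ • τ' 0⟩ at hend'
  obtain ⟨k, hk⟩ := Λ.exists_eq_smul h0 (τ' 0)
  have hk0 : k ≠ 0 := by
    rintro rfl
    exact h0' (by rw [hk, zero_smul])
  have h2 := (hτ.eq_smul hτ' hS hc h0 hk
    (right_mem_Icc.2 (by positivity : (0 : ℝ) ≤ 2 * Real.pi))).2
  have h3 := congrArg (fun w : TotalSpace ℂ Λ.fiber => (⟨w.1, k • w.2⟩ : TotalSpace ℂ Λ.fiber)) hend
  rw [h2, hk] at hend'
  have h4 := hend'.symm.trans h3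
  rw [TotalSpace.mk_inj] at h4
  rw [smul_smul, smul_smul] at h4
  have h5 := smul_left_injective ℂ h0 h4
  rw [mul_comm k h] at h5
  exact mul_right_cancel₀ hk0 h5

end UnitaryLineBundle

end

end

/-! ### Parallel sections of pullbacks -/

noncomputable section

section

universe v v'

variable {E : Type*} [NormedAddCommGroup E] [NormedSpace ℝ E] {H : Type*} [TopologicalSpace H]
  {J : ModelWithCorners ℝ E H} {M : Type*} [TopologicalSpace M] [ChartedSpace H M]
  [IsManifold J ∞ M]
  {E' : Type*} [NormedAddCommGroup E'] [NormedSpace ℝ E'] {H' : Type*} [TopologicalSpace H']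
  {J' : ModelWithCorners ℝ E' H'} {M' : Type*} [TopologicalSpace M'] [ChartedSpace H' M']
  [IsManifold J' ∞ M']
  {Λ : UnitaryLineBundle.{v} J M} {Λ' : UnitaryLineBundle.{v'} J' M'} {f : M → M'}

namespace PullbackIso

/-- The expression of an isomorphism in the local frames at `x` and `f x`: a function `ρ` such that
`Φ (e y) = ρ y • e' (f y)`. -/
def ratio (Φ : PullbackIso Λ Λ' f) (x y : M) : ℂ :=
  Λ'.coord (f x) (f y) (Φ.toEquiv y (Λ.frame x y))

lemma ratio_ne_zero (Φ : PullbackIso Λ Λ' f) {x y : M} (hy : y ∈ Λ.frameSet x)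
    (hy' : f y ∈ Λ'.frameSet (f x)) : Φ.ratio x y ≠ 0 := by
  intro h
  apply Λ.frame_ne_zero hy
  apply (Φ.toEquiv y).injective
  rw [map_zero]
  apply Λ'.coord_injective hy'
  rw [map_zero]
  exact h

lemma coord_symm (Φ : PullbackIso Λ Λ' f) {x y : M} (hy : y ∈ Λ.frameSet x)
    (hy' : f y ∈ Λ'.frameSet (f x)) (w : Λ'.fiber (f y)) :
    Λ.coord x y ((Φ.toEquiv y).symm w) = Λ'.coord (f x) (f y) w / Φ.ratio x y := by
  rw [eq_div_iff (Φ.ratio_ne_zero hy hy')]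
  have h := Λ.coord_smul_frame hy ((Φ.toEquiv y).symm w)
  have h2 := congrArg (fun v => Λ'.coord (f x) (f y) (Φ.toEquiv y v)) h
  simp only [map_smul, LinearEquiv.apply_symm_apply, smul_eq_mul] at h2
  exact h2

lemma contMDiffAt_ratio (Φ : PullbackIso Λ Λ' f) (x : M) :
    ContMDiffAt J 𝓘(ℝ, ℂ) ∞ (Φ.ratio x) x ∧ ContMDiffAt J J' ∞ f x := by
  have hx := Λ.mem_frameSet x
  have h1 : ContMDiffAt J (J'.prod 𝓘(ℝ, ℂ)) ∞
      (fun y => (⟨f y, Φ.toEquiv y (Λ.frame x y)⟩ : TotalSpace ℂ Λ'.fiber)) x :=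
    ContMDiffAt.comp (f := fun y => (⟨y, Λ.frame x y⟩ : TotalSpace ℂ Λ.fiber)) x
      (Φ.smooth.contMDiffAt) (Λ.smoothSectionAt_frame hx)
  rw [contMDiffAt_totalSpace] at h1
  refine ⟨h1.2.congr_of_eventuallyEq ?_, h1.1⟩
  filter_upwards [h1.1.continuousAt.preimage_mem_nhds ((Λ'.isOpen_frameSet (f x)).mem_nhds
    (Λ'.mem_frameSet (f x)))] with y hy
  exact Λ'.coord_eq hy _

/-- The pullback of a smooth section is smooth. -/
lemma smoothSectionAt_pullback (Φ : PullbackIso Λ Λ' f) {s' : ∀ x, Λ'.fiber x} {x : M}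
    (hs : Λ'.SmoothSectionAt s' (f x)) :
    Λ.SmoothSectionAt (fun y => (Φ.toEquiv y).symm (s' (f y))) x := by
  have hx := Λ.mem_frameSet x
  have hx' := Λ'.mem_frameSet (f x)
  obtain ⟨hρ, hf⟩ := Φ.contMDiffAt_ratio x
  rw [Λ.smoothSectionAt_iff hx]
  have h1 : ContMDiffAt J 𝓘(ℝ, ℂ) ∞ (fun y => Λ'.coord (f x) (f y) (s' (f y))) x :=
    ContMDiffAt.comp (g := fun y => Λ'.coord (f x) y (s' y)) x
      ((Λ'.smoothSectionAt_iff hx' s').1 hs) hf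
  have hinv : ContMDiffAt J 𝓘(ℝ, ℂ) ∞ (fun y => (Φ.ratio x y)⁻¹) x :=
    ContMDiffAt.comp (g := fun z : ℂ => z⁻¹) x
      (contDiffAt_inv ℝ (Φ.ratio_ne_zero hx hx')).contMDiffAt hρ
  have hmul : ContMDiffAt J 𝓘(ℝ, ℂ) ∞
      (fun y => Λ'.coord (f x) (f y) (s' (f y)) • (Φ.ratio x y)⁻¹) x := by
    have hm : ContDiff ℝ ∞ (fun p : ℂ × ℂ => p.1 • p.2) := contDiff_fst.smul contDiff_snd
    exact ContMDiffAt.comp (g := fun p : ℂ × ℂ => p.1 • p.2) x hm.contMDiff.contMDiffAt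
      (h1.prodMk_space hinv)
  refine hmul.congr_of_eventuallyEq ?_
  filter_upwards [(Λ.isOpen_frameSet x).mem_nhds hx, hf.continuousAt.preimage_mem_nhds
    ((Λ'.isOpen_frameSet (f x)).mem_nhds hx')] with y hy hy'
  rw [Φ.coord_symm hy hy', smul_eq_mul, div_eq_mul_inv]

/-- The pullback of a parallel section is parallel. -/
lemma isParallelAlong_pullback (Φ : PullbackIso Λ Λ' f) {c : ℝ → M} {a b : ℝ}
    (hcc : ContinuousOn c (Icc a b)) {S : Set ℝ} (hS : S.Finite)
    (hc : ∀ t ∈ Ioo a b, t ∉ S → MDifferentiableAt 𝓘(ℝ, ℝ) J c t)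
    {τ : ∀ t, Λ'.fiber (f (c t))} (h : Λ'.IsParallelAlong (fun t => f (c t)) a b τ) :
    Λ.IsParallelAlong c a b (fun t => (Φ.toEquiv (c t)).symm (τ t)) := by
  obtain ⟨hτ, S', hS', h⟩ := h
  refine ⟨fun t ht => ?_, S ∪ S', hS.union hS', fun t ht htS => ?_⟩
  · have hx := Λ.mem_frameSet (c t)
    have hx' := Λ'.mem_frameSet (f (c t))
    obtain ⟨hρ, hf⟩ := Φ.contMDiffAt_ratio (c t)
    have hct := hcc t ht
    refine Λ.continuousWithinAt_of_coord hct hx ?_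
    have h1 := Λ'.continuousWithinAt_coord (hτ t ht) hx'
    have h2 : ContinuousWithinAt (fun r => Φ.ratio (c t) (c r)) (Icc a b) t :=
      hρ.continuousAt.comp_continuousWithinAt hct
    refine (h1.div h2 (Φ.ratio_ne_zero hx hx')).congr_of_eventuallyEq ?_
      (Φ.coord_symm hx hx' _)
    filter_upwards [hct.preimage_mem_nhdsWithin ((Λ.isOpen_frameSet _).mem_nhds hx),
      (hf.continuousAt.comp_continuousWithinAt hct).preimage_mem_nhdsWithin
        ((Λ'.isOpen_frameSet _).mem_nhds hx')] with r hr hr'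
    exact Φ.coord_symm hr hr' _
  · obtain ⟨s, g, g', hs, hs0, he, hg, hp⟩ := h t ht fun h => htS (.inr h)
    have hct := hc t ht fun h => htS (.inl h)
    refine ⟨fun y => (Φ.toEquiv y).symm (s (f y)), g, g', Φ.smoothSectionAt_pullback hs, ?_, ?_, hg,
      ?_⟩
    · simpa using hs0
    · filter_upwards [he] with r hr
      rw [hr, map_smul]
    · rw [Φ.conn_eq s (c t) hs]
      have hf : MDifferentiableAt J J' f (c t) :=
        (Φ.contMDiffAt_ratio (c t)).2.mdifferentiableAt (by simp)
      have h1 : mfderiv J J' f (c t) (mfderiv 𝓘(ℝ, ℝ) J c t (1 : ℝ)) =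
          mfderiv 𝓘(ℝ, ℝ) J' (fun t => f (c t)) t (1 : ℝ) := by
        have := mfderiv_comp t hf hct
        exact (congrArg (fun T : ℝ →L[ℝ] E' => T 1) this).symm
      rw [h1, ← map_smul, ← map_smul, ← map_add, hp, map_zero]

end PullbackIso

end

end

/-! ### The connection form -/

noncomputable section

section

universe v

variable {E : Type*} [NormedAddCommGroup E] [NormedSpace ℝ E] {H : Type*} [TopologicalSpace H]
  {J : ModelWithCorners ℝ E H} {M : Type*} [TopologicalSpace M] [ChartedSpace H M]
  [IsManifold J ∞ M]

/-- A constant vector field on a vector space. -/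
def constField (w : E) : ∀ y : E, TangentSpace 𝓘(ℝ, E) y := fun _ => w

lemma contMDiffAt_constField (w y : E) : ContMDiffAt 𝓘(ℝ, E) 𝓘(ℝ, E).tangent ∞
    (fun y => (⟨y, constField w y⟩ : TangentBundle 𝓘(ℝ, E) E)) y := by
  rw [contMDiffAt_vectorSpace_iff_contDiffAt]
  exact contDiffAt_const

variable (J) in
/-- The coordinate vector field in the direction `w` of the preferred chart at `x₀`. -/
def coordField (x₀ : M) (w : E) : ∀ x : M, TangentSpace J x :=
  VectorField.mpullback J 𝓘(ℝ, E) (extChartAt J x₀) (constField w)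

section CoordField

variable {x₀ x : M}

lemma coordField_mfderiv_extChartAt (hx : x ∈ (extChartAt J x₀).source) (v : TangentSpace J x) :
    coordField J x₀ (mfderiv J 𝓘(ℝ, E) (extChartAt J x₀) x v) x = v :=
  have : IsManifold J 1 M := IsManifold.of_le (n := ∞) (by simp)
  (isInvertible_mfderiv_extChartAt hx).inverse_apply_self v

lemma contMDiffAt_coordField [CompleteSpace E] (hx : x ∈ (extChartAt J x₀).source) (w : E) :
    ContMDiffAt J J.tangent ∞ (fun y => (⟨y, coordField J x₀ w y⟩ : TangentBundle J M)) x := by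
  have : IsManifold J 1 M := IsManifold.of_le (n := ∞) (by simp)
  exact ContMDiffAt.mpullback_vectorField_preimage (n := ∞) (contMDiffAt_constField w _)
    (contMDiffAt_extChartAt' (by simpa using hx)) (isInvertible_mfderiv_extChartAt hx) (by simp)

/-- Coordinate vector fields commute. -/
lemma mlieBracket_coordField [CompleteSpace E] (hx : x ∈ (extChartAt J x₀).source) (v w : E) :
    VectorField.mlieBracket J (coordField J x₀ v) (coordField J x₀ w) x = 0 := by
  have : IsManifold J 1 M := IsManifold.of_le (n := ∞) (by simp)
  have : IsManifold J (minSmoothness ℝ 2) M := by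
    rw [minSmoothness_of_isRCLikeNormedField]
    exact IsManifold.of_le (n := ∞) two_le_infty
  have : IsManifold 𝓘(ℝ, E) (minSmoothness ℝ 2) E := inferInstance
  have hc : ∀ u : E, MDifferentiableAt 𝓘(ℝ, E) 𝓘(ℝ, E).tangent
      (fun y => (⟨y, constField u y⟩ : TangentBundle 𝓘(ℝ, E) E)) (extChartAt J x₀ x) :=
    fun u => (contMDiffAt_constField u _).mdifferentiableAt (by simp)
  have h := VectorField.mpullback_mlieBracket (n := ∞) (hc v) (hc w)
    (contMDiffAt_extChartAt' (I := J) (x := x₀) (x' := x) (by simpa using hx))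
    (by rw [minSmoothness_of_isRCLikeNormedField]; exact two_le_infty)
  have h0 : VectorField.mlieBracket 𝓘(ℝ, E) (constField v) (constField w) = 0 := by
    rw [← VectorField.mlieBracketWithin_univ,
      VectorField.mlieBracketWithin_eq_lieBracketWithin]
    funext y
    change fderivWithin ℝ (fun _ : E => w) univ y v - fderivWithin ℝ (fun _ : E => v) univ y w = 0
    simp
  rw [h0] at h
  refine h.symm.trans ?_
  rw [VectorField.mpullback_apply]
  exact map_zero _

end CoordField

namespace UnitaryLineBundle

variable (Λ : UnitaryLineBundle.{v} J M) {x₀ x : M}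

lemma smoothSectionAt_smul {f : M → ℂ} {s : ∀ x, Λ.fiber x} (hf : ContMDiffAt J 𝓘(ℝ, ℂ) ∞ f x)
    (hs : Λ.SmoothSectionAt s x) : Λ.SmoothSectionAt (fun y => f y • s y) x := by
  have hx := Λ.mem_frameSet x
  rw [Λ.smoothSectionAt_iff hx] at hs ⊢
  simp only [map_smul]
  have hm : ContDiff ℝ ∞ (fun p : ℂ × ℂ => p.1 • p.2) := contDiff_fst.smul contDiff_snd
  exact ContMDiffAt.comp (g := fun p : ℂ × ℂ => p.1 • p.2) x hm.contMDiff.contMDiffAt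
    (hf.prodMk_space hs)

/-- The Leibniz rule for complex valued functions. -/
lemma conn_smul {f : M → ℂ} {s : ∀ x, Λ.fiber x} (hf : ContMDiffAt J 𝓘(ℝ, ℂ) ∞ f x)
    (hs : Λ.SmoothSectionAt s x) (v : TangentSpace J x) :
    Λ.conn (fun y => f y • s y) x v =
      f x • Λ.conn s x v + mvfderiv J f x v • s x := by
  have hfd : MDifferentiableAt J 𝓘(ℝ, ℂ) f x := hf.mdifferentiableAt (by simp)
  have hre := HasMFDerivAt.comp x Complex.reCLM.hasMFDerivAt hfd.hasMFDerivAt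
  have him := HasMFDerivAt.comp x Complex.imCLM.hasMFDerivAt hfd.hasMFDerivAt
  have hIs : Λ.SmoothSectionAt (fun y => Complex.I • s y) x :=
    Λ.smoothSectionAt_smul (f := fun _ => Complex.I) contMDiffAt_const hs
  have hsd := ContMDiffAt.mdifferentiableAt hs (by simp)
  have hIsd := ContMDiffAt.mdifferentiableAt hIs (by simp)
  have hcov := Λ.conn.isCovariantDerivativeOnUniv
  have l1 := hcov.leibniz hsd hre.mdifferentiableAt
  have l2 := hcov.leibniz hIsd him.mdifferentiableAt
  have l3 := hcov.add (hre.mdifferentiableAt.smul_section hsd)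
    (him.mdifferentiableAt.smul_section hIsd)
  -- the axioms of a connection concern real functions: split `f` into real and imaginary parts
  have hsum : (fun y => f y • s y) = ((Complex.reCLM ∘ f) • s) +
      ((Complex.imCLM ∘ f) • fun y => Complex.I • s y) := by
    funext y
    change f y • s y = (f y).re • s y + (f y).im • Complex.I • s y
    rw [← Complex.coe_smul, ← Complex.coe_smul, smul_smul, ← add_smul, Complex.re_add_im]
  have e1 : mvfderiv J (Complex.reCLM ∘ f) x v = (mvfderiv J f x v).re := by
    rw [mvfderiv, hre.mfderiv]; rfl
  have e2 : mvfderiv J (Complex.imCLM ∘ f) x v = (mvfderiv J f x v).im := by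
    rw [mvfderiv, him.mfderiv]; rfl
  have l4 : Λ.conn (fun y => f y • s y) x v = ((f x).re • Λ.conn s x v +
      mvfderiv J (Complex.reCLM ∘ f) x v • s x) + ((f x).im •
      Λ.conn (fun y => Complex.I • s y) x v +
      mvfderiv J (Complex.imCLM ∘ f) x v • Complex.I • s x) := by
    rw [hsum]
    refine (congrArg (fun T : TangentSpace J x →L[ℝ] Λ.fiber x => T v) (l3.trans
      (congrArg₂ _ l1 l2))).trans ?_
    rfl
  rw [l4, e1, e2, Λ.conn_complexLinear s x hs v]
  conv_rhs => rw [← Complex.re_add_im (f x), ← Complex.re_add_im (mvfderiv J f x v)]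
  simp only [← Complex.coe_smul, add_smul, mul_smul]
  abel

/-- The connection form of `Λ` in the local frame at `x₀`, read in the chart at `x₀`. -/
def connForm (x₀ x : M) : E →L[ℝ] ℂ :=
  ((Λ.coord x₀ x).restrictScalars ℝ).comp ((Λ.conn (Λ.frame x₀) x).comp
    (mfderiv J 𝓘(ℝ, E) (extChartAt J x₀) x).inverse)

lemma connForm_apply_smul_frame (hx : x ∈ Λ.frameSet x₀) (w : E) :
    Λ.connForm x₀ x w • Λ.frame x₀ x = Λ.conn (Λ.frame x₀) x (coordField J x₀ w x) :=
  Λ.coord_smul_frame hx _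

lemma smoothSectionAt_conn_coordField [CompleteSpace E] (hx : x ∈ Λ.frameSet x₀)
    (hx' : x ∈ (extChartAt J x₀).source) (w : E) :
    Λ.SmoothSectionAt (fun y => Λ.conn (Λ.frame x₀) y (coordField J x₀ w y)) x := by
  have : IsManifold J 1 M := IsManifold.of_le (n := ∞) (by simp)
  have h1 := (Λ.conn_smooth (Λ.frameSet x₀) (Λ.isOpen_frameSet x₀)).contMDiff
    (σ := Λ.frame x₀) (fun y hy => (Λ.smoothSectionAt_frame hy).contMDiffWithinAt)
  have h2 := (h1 x hx).contMDiffAt ((Λ.isOpen_frameSet x₀).mem_nhds hx)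
  exact ContMDiffAt.clm_bundle_apply (F₁ := E) (F₂ := ℂ) h2 (contMDiffAt_coordField hx' w)

lemma contMDiffAt_connForm [CompleteSpace E] (hx : x ∈ Λ.frameSet x₀)
    (hx' : x ∈ (extChartAt J x₀).source) (w : E) :
    ContMDiffAt J 𝓘(ℝ, ℂ) ∞ (fun y => Λ.connForm x₀ y w) x :=
  (Λ.smoothSectionAt_iff hx _).1 (Λ.smoothSectionAt_conn_coordField hx hx' w)

/-- On coordinate vector fields, the exterior derivative of the connection form is the curvature:
the quadratic term vanishes for a line bundle, and the bracket term since the fields commute. -/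
lemma HasCurvature.connForm [CompleteSpace E] {Λ : UnitaryLineBundle.{v} J M}
    {β : ∀ x : M, TangentSpace J x [⋀^Fin 2]→L[ℝ] ℝ} (h : Λ.HasCurvature β)
    (hx : x ∈ Λ.frameSet x₀) (hx' : x ∈ (extChartAt J x₀).source) (v w : E) :
    mvfderiv J (fun y => Λ.connForm x₀ y w) x (coordField J x₀ v x) -
      mvfderiv J (fun y => Λ.connForm x₀ y v) x (coordField J x₀ w x) =
      2 * Real.pi * Complex.I * (β x ![coordField J x₀ v x, coordField J x₀ w x] : ℂ) := by
  have h1 := h x (coordField J x₀ v) (coordField J x₀ w) (Λ.frame x₀)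
    (contMDiffAt_coordField hx' v) (contMDiffAt_coordField hx' w) (Λ.smoothSectionAt_frame hx)
  have key : ∀ u v : E, Λ.conn (fun y => Λ.conn (Λ.frame x₀) y (coordField J x₀ u y)) x
      (coordField J x₀ v x) = (Λ.connForm x₀ x u * Λ.connForm x₀ x v) • Λ.frame x₀ x +
        mvfderiv J (fun y => Λ.connForm x₀ y u) x (coordField J x₀ v x) •
          Λ.frame x₀ x := by
    intro u v
    have hs := Λ.conn_smul (Λ.contMDiffAt_connForm hx hx' u) (Λ.smoothSectionAt_frame hx)
      (coordField J x₀ v x)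
    rw [← Λ.connForm_apply_smul_frame hx v, smul_smul] at hs
    rw [← hs]
    refine congrArg (fun T : TangentSpace J x →L[ℝ] Λ.fiber x => T (coordField J x₀ v x)) ?_
    refine Λ.conn.isCovariantDerivativeOnUniv.congr_of_eventuallyEq
      (ContMDiffAt.mdifferentiableAt (Λ.smoothSectionAt_conn_coordField hx hx' u) (by simp))
      (ContMDiffAt.mdifferentiableAt (Λ.smoothSectionAt_smul (Λ.contMDiffAt_connForm hx hx' u)
        (Λ.smoothSectionAt_frame hx)) (by simp)) univ_mem ?_
    filter_upwards [(Λ.isOpen_frameSet x₀).mem_nhds hx] with y hy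
    exact (Λ.connForm_apply_smul_frame hy u).symm
  rw [curvature, key, key, mlieBracket_coordField hx', map_zero, sub_zero] at h1
  apply smul_left_injective ℂ (Λ.frame_ne_zero hx)
  dsimp only
  rw [← h1, mul_comm (Λ.connForm x₀ x v), sub_smul]
  exact (add_sub_add_left_eq_sub _ _ _).symm

end UnitaryLineBundle

end

end

/-! ### The connection form along a map -/

noncomputable section

section

universe v

variable {E : Type*} [NormedAddCommGroup E] [NormedSpace ℝ E]
  {H : Type*} [TopologicalSpace H]
  {J : ModelWithCorners ℝ E H} {M : Type*} [TopologicalSpace M] [ChartedSpace H M]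
  [IsManifold J ∞ M] {V : Type*} [NormedAddCommGroup V] [NormedSpace ℝ V]

namespace UnitaryLineBundle

variable (Λ : UnitaryLineBundle.{v} J M) {x₀ x : M}

lemma conn_frame (hx : x ∈ Λ.frameSet x₀) (hx' : x ∈ (extChartAt J x₀).source)
    (v : TangentSpace J x) {w : E} (hw : mfderiv J 𝓘(ℝ, E) (extChartAt J x₀) x v = w) :
    Λ.conn (Λ.frame x₀) x v = Λ.connForm x₀ x w • Λ.frame x₀ x := by
  subst hw
  refine Eq.trans ?_ (Λ.connForm_apply_smul_frame hx _).symm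
  exact congrArg _ (coordField_mfderiv_extChartAt hx' v).symm

/-- The pullback of the connection form along a map `c` into the domain of the frame and chart at
`x₀`, evaluated on a constant vector field. -/
def pullConn (x₀ : M) (c : V → M) (K : Set V) (v q : V) : ℂ :=
  Λ.connForm x₀ (c q) (fderivWithin ℝ (extChartAt J x₀ ∘ c) K q v)

variable {c : V → M} {K : Set V}

lemma contDiffOn_extChartAt_comp (hc : ContMDiffOn 𝓘(ℝ, V) J ∞ c K)
    (hU' : MapsTo c K (extChartAt J x₀).source) :
    ContDiffOn ℝ ∞ (extChartAt J x₀ ∘ c) K := by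
  rw [← contMDiffOn_iff_contDiffOn]
  intro q hq
  exact (contMDiffAt_extChartAt' (by simpa using hU' hq)).comp_contMDiffWithinAt q (hc q hq)

lemma contDiffOn_connForm_comp [FiniteDimensional ℝ E]
    (hc : ContMDiffOn 𝓘(ℝ, V) J ∞ c K) (hU : MapsTo c K (Λ.frameSet x₀))
    (hU' : MapsTo c K (extChartAt J x₀).source) :
    ContDiffOn ℝ ∞ (fun q => Λ.connForm x₀ (c q)) K := by
  have := FiniteDimensional.complete ℝ E
  rw [contDiffOn_clm_apply]
  intro w
  rw [← contMDiffOn_iff_contDiffOn]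
  intro q hq
  exact ContMDiffAt.comp_contMDiffWithinAt q (g := fun y => Λ.connForm x₀ y w)
    (Λ.contMDiffAt_connForm (hU hq) (hU' hq) w) (hc q hq)

lemma contDiffOn_pullConn [FiniteDimensional ℝ E]
    (hc : ContMDiffOn 𝓘(ℝ, V) J ∞ c K) (hU : MapsTo c K (Λ.frameSet x₀))
    (hU' : MapsTo c K (extChartAt J x₀).source)
    (hK : UniqueDiffOn ℝ K) (v : V) :
    ContDiffOn ℝ ∞ (Λ.pullConn x₀ c K v) K :=
  (Λ.contDiffOn_connForm_comp hc hU hU').clm_apply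
    (((contDiffOn_extChartAt_comp hc hU').fderivWithin hK (by simp)).clm_apply contDiffOn_const)

lemma conn_frame_comp (hU : MapsTo c K (Λ.frameSet x₀))
    (hU' : MapsTo c K (extChartAt J x₀).source) {q : V} (hq : q ∈ K) (hK : UniqueDiffOn ℝ K)
    {C : V →L[ℝ] E}
    (hC : HasMFDerivWithinAt 𝓘(ℝ, V) J c K q C) (v : V) {w : E} (hw : w = C v) :
    Λ.conn (Λ.frame x₀) (c q) w = Λ.pullConn x₀ c K v q • Λ.frame x₀ (c q) := by
  have h1 : MDifferentiableAt J 𝓘(ℝ, E) (extChartAt J x₀) (c q) :=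
    (contMDiffAt_extChartAt' (n := ∞) (by simpa using hU' hq)).mdifferentiableAt (by simp)
  let T : E →L[ℝ] E := mfderiv J 𝓘(ℝ, E) (extChartAt J x₀) (c q)
  have h2 : HasFDerivWithinAt (extChartAt J x₀ ∘ c) (T.comp C) K q :=
    (h1.hasMFDerivAt.comp_hasMFDerivWithinAt q hC).hasFDerivWithinAt
  refine Λ.conn_frame (hU hq) (hU' hq) w ?_
  rw [h2.fderivWithin (hK q hq), hw]
  rfl

/-- The structure equation of the connection, along a map. -/
lemma HasCurvature.pullConn [FiniteDimensional ℝ E] {Λ : UnitaryLineBundle.{v} J M}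
    {β : ∀ x : M, TangentSpace J x [⋀^Fin 2]→L[ℝ] ℝ} (h : Λ.HasCurvature β)
    (hc : ContMDiffOn 𝓘(ℝ, V) J ∞ c K) (hU : MapsTo c K (Λ.frameSet x₀))
    (hU' : MapsTo c K (extChartAt J x₀).source)
    {q : V} (hq : K ∈ 𝓝 q) (v w : V) :
    fderiv ℝ (Λ.pullConn x₀ c K w) q v - fderiv ℝ (Λ.pullConn x₀ c K v) q w =
      2 * Real.pi * Complex.I *
        (β (c q) ![mfderiv 𝓘(ℝ, V) J c q v, mfderiv 𝓘(ℝ, V) J c q w] : ℂ) := by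
  have := FiniteDimensional.complete ℝ E
  have hq' := mem_of_mem_nhds hq
  set α : V → E := extChartAt J x₀ ∘ c with hα
  have hα1 : ContDiffAt ℝ ∞ α q := (contDiffOn_extChartAt_comp hc hU').contDiffAt hq
  have hcd : MDifferentiableAt 𝓘(ℝ, V) J c q := (hc.contMDiffAt hq).mdifferentiableAt (by simp)
  have hφ : MDifferentiableAt J 𝓘(ℝ, E) (extChartAt J x₀) (c q) :=
    (contMDiffAt_extChartAt' (n := ∞) (by simpa using hU' hq')).mdifferentiableAt (by simp)
  have hcoord : ∀ u : V, coordField J x₀ (fderiv ℝ α q u) (c q) = mfderiv 𝓘(ℝ, V) J c q u := by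
    intro u
    let T : E →L[ℝ] E := mfderiv J 𝓘(ℝ, E) (extChartAt J x₀) (c q)
    let C : V →L[ℝ] E := mfderiv 𝓘(ℝ, V) J c q
    have h2 : HasFDerivAt α (T.comp C) q :=
      (HasMFDerivAt.comp q hφ.hasMFDerivAt hcd.hasMFDerivAt).hasFDerivAt
    rw [h2.fderiv]
    exact coordField_mfderiv_extChartAt (hU' hq') (C u)
  have hH : DifferentiableAt ℝ (fun q => Λ.connForm x₀ (c q)) q :=
    ((Λ.contDiffOn_connForm_comp hc hU hU').contDiffAt hq).differentiableAt (by simp)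
  have hD : DifferentiableAt ℝ (fderiv ℝ α) q :=
    (hα1.fderiv_right (m := 1) (by exact two_le_infty)).differentiableAt (by simp)
  have hHd : ∀ (u : V) (e : E), fderiv ℝ (fun q => Λ.connForm x₀ (c q)) q u e =
      mvfderiv J (fun y => Λ.connForm x₀ y e) (c q) (mfderiv 𝓘(ℝ, V) J c q u) := by
    intro u e
    have h1 := (Λ.contMDiffAt_connForm (hU hq') (hU' hq') e).mdifferentiableAt (by simp)
    let T : E →L[ℝ] ℂ := mfderiv J 𝓘(ℝ, ℂ) (fun y => Λ.connForm x₀ y e) (c q)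
    let C : V →L[ℝ] E := mfderiv 𝓘(ℝ, V) J c q
    have h2 : HasFDerivAt (fun q => Λ.connForm x₀ (c q) e) (T.comp C) q :=
      (HasMFDerivAt.comp q h1.hasMFDerivAt hcd.hasMFDerivAt).hasFDerivAt
    have h3 : fderiv ℝ (fun q => Λ.connForm x₀ (c q) e) q u =
      fderiv ℝ (fun q => Λ.connForm x₀ (c q)) q u e := by
      rw [fderiv_clm_apply hH (differentiableAt_const e)]
      simp
    rw [← h3, h2.fderiv]
    rfl
  have hP : ∀ u u' : V, fderiv ℝ (Λ.pullConn x₀ c K u) q u' =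
      fderiv ℝ (fun q => Λ.connForm x₀ (c q)) q u' (fderiv ℝ α q u) +
        Λ.connForm x₀ (c q) (fderiv ℝ (fderiv ℝ α) q u' u) := by
    intro u u'
    have he : Λ.pullConn x₀ c K u =ᶠ[𝓝 q] fun q => Λ.connForm x₀ (c q) (fderiv ℝ α q u) := by
      filter_upwards [eventually_mem_nhds_iff.2 hq] with r hr
      rw [UnitaryLineBundle.pullConn, fderivWithin_of_mem_nhds hr]
    rw [he.fderiv_eq, fderiv_clm_apply hH (hD.clm_apply (differentiableAt_const u)),
      fderiv_clm_apply hD (differentiableAt_const u)]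
    simp [add_comm]
  -- the terms with second derivatives of the map cancel
  have hsymm : fderiv ℝ (fderiv ℝ α) q v w = fderiv ℝ (fderiv ℝ α) q w v :=
    (hα1.isSymmSndFDerivAt (by rw [minSmoothness_of_isRCLikeNormedField]; exact two_le_infty)).eq v w
  rw [hP, hP, hsymm, add_sub_add_right_eq_sub, hHd, hHd, ← hcoord, ← hcoord]
  exact h.connForm (hU hq') (hU' hq') _ _

end UnitaryLineBundle

end

end

/-! ### Transport over rectangles -/

noncomputable section

section

universe v

variable {E : Type*} [NormedAddCommGroup E] [NormedSpace ℝ E]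
  {H : Type*} [TopologicalSpace H]
  {J : ModelWithCorners ℝ E H} {M : Type*} [TopologicalSpace M] [ChartedSpace H M]
  [IsManifold J ∞ M]

/-- A curve is differentiable at all but finitely many parameters in the open interval. -/
def DiffOffFinite (J : ModelWithCorners ℝ E H) (c : ℝ → M) (a b : ℝ) : Prop :=
  ∃ S : Set ℝ, S.Finite ∧ ∀ t ∈ Ioo a b, t ∉ S → MDifferentiableAt 𝓘(ℝ, ℝ) J c t

namespace UnitaryLineBundle

/-- A nowhere vanishing section `τ` of `Λ` along the rectangle `c` such that `w₁ • τ` is parallel in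
the first variable and `w₂ • τ` is parallel in the second. In the applications one of the weights is
constant; both are present so that the notion is symmetric in the two variables. -/
structure IsTransport (Λ : UnitaryLineBundle.{v} J M) (c : ℝ → ℝ → M) (w₁ w₂ : ℝ → ℝ → ℂ)
    (s₁ s₂ t₁ t₂ : ℝ) (τ : ∀ s t, Λ.fiber (c s t)) : Prop where
  ne_zero : ∀ s ∈ Icc s₁ s₂, ∀ t ∈ Icc t₁ t₂, τ s t ≠ 0
  horizontal : ∀ t ∈ Icc t₁ t₂,
    Λ.IsParallelAlong (fun s => c s t) s₁ s₂ (fun s => w₁ s t • τ s t)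
  vertical : ∀ s ∈ Icc s₁ s₂,
    Λ.IsParallelAlong (fun t => c s t) t₁ t₂ (fun t => w₂ s t • τ s t)

variable {Λ : UnitaryLineBundle.{v} J M} {c : ℝ → ℝ → M} {w₁ w₂ : ℝ → ℝ → ℂ}
  {s₁ s₂ s₃ t₁ t₂ : ℝ}

lemma IsTransport.swap {τ : ∀ s t, Λ.fiber (c s t)} (h : Λ.IsTransport c w₁ w₂ s₁ s₂ t₁ t₂ τ) :
    Λ.IsTransport (fun t s => c s t) (fun t s => w₂ s t) (fun t s => w₁ s t) t₁ t₂ s₁ s₂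
      (fun t s => τ s t) :=
  ⟨fun t ht s hs => h.ne_zero s hs t ht, h.vertical, h.horizontal⟩

/-- Two adjacent rectangles: by uniqueness of parallel transport the two sections are proportional
along the common side. -/
lemma IsTransport.glue {τ₁ τ₂ : ∀ s t, Λ.fiber (c s t)}
    (h₁ : Λ.IsTransport c w₁ w₂ s₁ s₂ t₁ t₂ τ₁) (h₂ : Λ.IsTransport c w₁ w₂ s₂ s₃ t₁ t₂ τ₂)
    (h12 : s₁ ≤ s₂) (h23 : s₂ ≤ s₃) (ht : t₁ ≤ t₂) (hc : DiffOffFinite J (c s₂) t₁ t₂)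
    (hw : ∀ t ∈ Icc t₁ t₂, w₂ s₂ t ≠ 0) : ∃ τ, Λ.IsTransport c w₁ w₂ s₁ s₃ t₁ t₂ τ := by
  obtain ⟨S, hS, hc⟩ := hc
  have m₁ : s₂ ∈ Icc s₁ s₂ := right_mem_Icc.2 h12
  have m₂ : s₂ ∈ Icc s₂ s₃ := left_mem_Icc.2 h23
  have m₃ : t₁ ∈ Icc t₁ t₂ := left_mem_Icc.2 ht
  obtain ⟨k, hk⟩ := Λ.exists_eq_smul (h₂.ne_zero s₂ m₂ t₁ m₃) (τ₁ s₂ t₁)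
  have hk0 : k ≠ 0 := by
    rintro rfl
    exact h₁.ne_zero s₂ m₁ t₁ m₃ (by rw [hk, zero_smul])
  have hside : ∀ t ∈ Icc t₁ t₂, τ₁ s₂ t = k • τ₂ s₂ t := by
    intro t htm
    have h := ((h₂.vertical s₂ m₂).eq_smul (h₁.vertical s₂ m₁) hS hc
      (smul_ne_zero (hw t₁ m₃) (h₂.ne_zero s₂ m₂ t₁ m₃)) (z := k)
      (by rw [hk, smul_comm]) htm).2
    rw [smul_comm k] at h
    exact smul_right_injective _ (hw t htm) h
  let τ : ∀ s t, Λ.fiber (c s t) := fun s t => if s ≤ s₂ then τ₁ s t else k • τ₂ s t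
  have hτ₁ : ∀ s ∈ Icc s₁ s₂, ∀ t, τ s t = τ₁ s t := fun s hs t => if_pos hs.2
  have hτ₂ : ∀ s ∈ Icc s₂ s₃, ∀ t ∈ Icc t₁ t₂, τ s t = k • τ₂ s t := by
    intro s hs t htm
    rcases hs.1.eq_or_lt with rfl | h
    · rw [← hside t htm]; exact if_pos le_rfl
    · exact if_neg h.not_ge
  have hcase : ∀ s ∈ Icc s₁ s₃, s ∈ Icc s₁ s₂ ∨ s ∈ Icc s₂ s₃ := fun s hs =>
    (le_total s s₂).imp (fun h => ⟨hs.1, h⟩) (fun h => ⟨h, hs.2⟩)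
  refine ⟨τ, ⟨fun s hs t htm => ?_, fun t htm => ?_, fun s hs => ?_⟩⟩
  · rcases hcase s hs with h | h
    · rw [hτ₁ s h]; exact h₁.ne_zero s h t htm
    · rw [hτ₂ s h t htm]; exact smul_ne_zero hk0 (h₂.ne_zero s h t htm)
  · refine IsParallelAlong.trans (b := s₂) ?_ ?_ h12 h23
    · exact (h₁.horizontal t htm).congr fun s hs => by rw [hτ₁ s hs]
    · exact ((h₂.horizontal t htm).const_smul k).congr fun s hs => by
        rw [hτ₂ s hs t htm, smul_comm]
  · rcases hcase s hs with h | h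
    · exact (h₁.vertical s h).congr fun t htm => by rw [hτ₁ s h]
    · exact ((h₂.vertical s h).const_smul k).congr fun t htm => by
        rw [hτ₂ s h t htm, smul_comm]

/-- Rectangles over the intervals of a partition of the first variable. -/
lemma exists_isTransport_of_partition {N : ℕ} (hN : 0 < N) {a : ℕ → ℝ}
    (ha : ∀ i < N, a i ≤ a (i + 1)) (ht : t₁ ≤ t₂)
    (hc : ∀ i < N, DiffOffFinite J (c (a i)) t₁ t₂)
    (hw : ∀ i < N, ∀ t ∈ Icc t₁ t₂, w₂ (a i) t ≠ 0)
    (h : ∀ i < N, ∃ τ, Λ.IsTransport c w₁ w₂ (a i) (a (i + 1)) t₁ t₂ τ) :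
    ∃ τ, Λ.IsTransport c w₁ w₂ (a 0) (a N) t₁ t₂ τ := by
  have key : ∀ i < N, a 0 ≤ a (i + 1) ∧ ∃ τ, Λ.IsTransport c w₁ w₂ (a 0) (a (i + 1)) t₁ t₂ τ := by
    intro i
    induction i with
    | zero => intro hi; exact ⟨ha 0 hi, h 0 hi⟩
    | succ i ih =>
      intro hi
      obtain ⟨h0, τ₁, h₁⟩ := ih (by omega)
      obtain ⟨τ₂, h₂⟩ := h (i + 1) hi
      exact ⟨h0.trans (ha _ hi), h₁.glue h₂ h0 (ha _ hi) ht (hc _ hi) (hw _ hi)⟩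
  obtain ⟨M, rfl⟩ := Nat.exists_eq_succ_of_ne_zero hN.ne'
  exact (key M (by omega)).2

end UnitaryLineBundle
end
end

/-! ### Transport over small rectangles -/

noncomputable section

section Integrals

open MeasureTheory

lemma continuousOn_intervalIntegral_param {F : Type*} [NormedAddCommGroup F] [NormedSpace ℝ F]
    {s₁ s₂ t₁ t₂ t : ℝ} (hs : s₁ ≤ s₂) (ht : t ∈ Icc t₁ t₂) {f : ℝ × ℝ → F}
    (hf : ContinuousOn f (Icc s₁ s₂ ×ˢ Icc t₁ t₂)) :
    ContinuousOn (fun s => ∫ r in t₁..t, f (s, r)) (Icc s₁ s₂) := by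
  have ht12 := ht.1.trans ht.2
  let g : ℝ → ℝ → F := fun s r => f (projIcc s₁ s₂ hs s, projIcc t₁ t₂ ht12 r)
  have hg : Continuous (Function.uncurry g) := by
    refine hf.comp_continuous (f := fun q : ℝ × ℝ =>
      ((projIcc s₁ s₂ hs q.1 : ℝ), (projIcc t₁ t₂ ht12 q.2 : ℝ))) ?_ fun q => ?_
    · exact (continuous_subtype_val.comp (continuous_projIcc.comp continuous_fst)).prodMk
        (continuous_subtype_val.comp (continuous_projIcc.comp continuous_snd))
    · exact ⟨(projIcc s₁ s₂ hs q.1).2, (projIcc t₁ t₂ ht12 q.2).2⟩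
  refine (intervalIntegral.continuous_parametric_intervalIntegral_of_continuous'
    (μ := volume) hg t₁ t).continuousOn.congr fun s hsm => ?_
  refine intervalIntegral.integral_congr fun r hr => ?_
  rw [uIcc_of_le ht.1] at hr
  simp only [g, projIcc_of_mem hs hsm, projIcc_of_mem ht12 (Icc_subset_Icc_right ht.2 hr)]

lemma hasDerivAt_primitive_of_continuousOn {F : Type*} [NormedAddCommGroup F] [NormedSpace ℝ F]
    [CompleteSpace F] {a b : ℝ} {f : ℝ → F} (hf : ContinuousOn f (Icc a b)) {x : ℝ}
    (hx : x ∈ Ioo a b) : HasDerivAt (fun x => ∫ r in a..x, f r) (f x) x := by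
  refine intervalIntegral.integral_hasDerivAt_right ?_ ?_ (hf.continuousAt (Icc_mem_nhds hx.1 hx.2))
  · refine ContinuousOn.intervalIntegrable ?_
    rw [uIcc_of_le hx.1.le]
    exact hf.mono (Icc_subset_Icc_right hx.2.le)
  · exact (hf.mono Ioo_subset_Icc_self).stronglyMeasurableAtFilter isOpen_Ioo x hx

lemma continuousOn_primitive_of_continuousOn {F : Type*} [NormedAddCommGroup F] [NormedSpace ℝ F]
    {a b : ℝ} (hab : a ≤ b) {f : ℝ → F} (hf : ContinuousOn f (Icc a b)) :
    ContinuousOn (fun x => ∫ r in a..x, f r) (Icc a b) := by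
  have h := intervalIntegral.continuousOn_primitive_interval (μ := volume) (f := f) (a := a) (b := b)
    (by rw [uIcc_of_le hab]; exact hf.integrableOn_Icc)
  rwa [uIcc_of_le hab] at h

end Integrals

section

universe v

variable {E : Type*} [NormedAddCommGroup E] [NormedSpace ℝ E]
  {H : Type*} [TopologicalSpace H]
  {J : ModelWithCorners ℝ E H} {M : Type*} [TopologicalSpace M] [ChartedSpace H M]
  [IsManifold J ∞ M]

section Line

variable {V : Type*} [NormedAddCommGroup V] [NormedSpace ℝ V] {c : V → M} {K : Set V}
  {ℓ : ℝ → V} {v : V} {r : ℝ}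

omit [IsManifold J ∞ M] in
lemma hasMFDerivAt_comp_line (hc : ContMDiffOn 𝓘(ℝ, V) J ∞ c K) (hℓ : HasDerivAt ℓ v r)
    (hK : ∀ᶠ r' in 𝓝 r, ℓ r' ∈ K) :
    HasMFDerivAt 𝓘(ℝ, ℝ) J (fun r => c (ℓ r)) r
      ((mfderivWithin 𝓘(ℝ, V) J c K (ℓ r) : V →L[ℝ] E).comp
        (ContinuousLinearMap.toSpanSingleton ℝ v)) := by
  have h1 := ((hc (ℓ r) hK.self_of_nhds).mdifferentiableWithinAt (by simp)).hasMFDerivWithinAt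
  have h2 : HasMFDerivWithinAt 𝓘(ℝ, ℝ) 𝓘(ℝ, V) ℓ (ℓ ⁻¹' K) r
      (ContinuousLinearMap.toSpanSingleton ℝ v) :=
    hℓ.hasFDerivAt.hasMFDerivAt.hasMFDerivWithinAt
  exact (HasMFDerivWithinAt.comp r h1 h2 subset_rfl).hasMFDerivAt hK

omit [IsManifold J ∞ M] in
lemma diffOffFinite_comp_line (hc : ContMDiffOn 𝓘(ℝ, V) J ∞ c K) {a b : ℝ}
    (hℓ : ∀ t, HasDerivAt ℓ v t) (hK : ∀ t ∈ Ioo a b, ℓ t ∈ K) :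
    DiffOffFinite J (fun t => c (ℓ t)) a b := by
  refine ⟨∅, finite_empty, fun t ht _ => ?_⟩
  refine (hasMFDerivAt_comp_line hc (hℓ t) ?_).mdifferentiableAt
  filter_upwards [isOpen_Ioo.mem_nhds ht] with t' ht'
  exact hK t' ht'

lemma UnitaryLineBundle.conn_frame_line (Λ : UnitaryLineBundle.{v} J M) {x₀ : M}
    (hc : ContMDiffOn 𝓘(ℝ, V) J ∞ c K) (hU : MapsTo c K (Λ.frameSet x₀))
    (hU' : MapsTo c K (extChartAt J x₀).source) (hKu : UniqueDiffOn ℝ K) (hℓ : HasDerivAt ℓ v r)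
    (hK : ∀ᶠ r' in 𝓝 r, ℓ r' ∈ K) :
    Λ.conn (Λ.frame x₀) (c (ℓ r)) (mfderiv 𝓘(ℝ, ℝ) J (fun r => c (ℓ r)) r (1 : ℝ)) =
      Λ.pullConn x₀ c K v (ℓ r) • Λ.frame x₀ (c (ℓ r)) := by
  have h1 := ((hc (ℓ r) hK.self_of_nhds).mdifferentiableWithinAt (by simp)).hasMFDerivWithinAt
  refine Λ.conn_frame_comp hU hU' hK.self_of_nhds hKu h1 v ?_
  rw [(hasMFDerivAt_comp_line hc hℓ hK).mfderiv]
  exact congrArg (mfderivWithin 𝓘(ℝ, V) J c K (ℓ r) : V →L[ℝ] E) (one_smul ℝ v)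

end Line

namespace UnitaryLineBundle

open MeasureTheory

variable [FiniteDimensional ℝ E] {Λ : UnitaryLineBundle.{v} J M} {c : ℝ → ℝ → M}
  {s₁ s₂ t₁ t₂ : ℝ} {x₀ : M}

/-- Over a rectangle in the domain of a local frame, the transport is the exponential of integrals
of the connection form. The function `G` stands for the integral of the curvature over a larger
rectangle, whose lower side need not be at `t₁`; hence only increments of `G` in the second variable
are prescribed. -/
lemma exists_isTransport_of_mapsTo {β : ∀ x : M, TangentSpace J x [⋀^Fin 2]→L[ℝ] ℝ}
    (hΛ : Λ.HasCurvature β) (hs : s₁ < s₂) (ht : t₁ < t₂)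
    (hc : ContMDiffOn 𝓘(ℝ, ℝ × ℝ) J ∞ (fun q : ℝ × ℝ => c q.1 q.2) (Icc s₁ s₂ ×ˢ Icc t₁ t₂))
    (hU : MapsTo (fun q : ℝ × ℝ => c q.1 q.2) (Icc s₁ s₂ ×ˢ Icc t₁ t₂) (Λ.frameSet x₀))
    (hU' : MapsTo (fun q : ℝ × ℝ => c q.1 q.2) (Icc s₁ s₂ ×ˢ Icc t₁ t₂)
      (extChartAt J x₀).source) {G f : ℝ → ℝ → ℝ}
    (hf : ∀ s ∈ Ioo s₁ s₂, ContinuousOn (f s) (Icc t₁ t₂))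
    (hf' : ∀ s ∈ Ioo s₁ s₂, ∀ t ∈ Ioo t₁ t₂, f s t = β (c s t)
      ![mfderiv 𝓘(ℝ, ℝ × ℝ) J (fun q : ℝ × ℝ => c q.1 q.2) (s, t) ((1, 0) : ℝ × ℝ),
        mfderiv 𝓘(ℝ, ℝ × ℝ) J (fun q : ℝ × ℝ => c q.1 q.2) (s, t) ((0, 1) : ℝ × ℝ)])
    (hG : ∀ t ∈ Icc t₁ t₂, ContinuousOn (fun s => G s t) (Icc s₁ s₂))
    (hG' : ∀ t ∈ Icc t₁ t₂, ∀ s ∈ Ioo s₁ s₂,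
      HasDerivAt (fun s => G s t - G s t₁) (∫ r in t₁..t, f s r) s) :
    ∃ τ, Λ.IsTransport c (fun s t => Complex.exp (2 * Real.pi * Complex.I * G s t))
      (fun _ _ => 1) s₁ s₂ t₁ t₂ τ := by
  set K : Set (ℝ × ℝ) := Icc s₁ s₂ ×ˢ Icc t₁ t₂ with hKdef
  have hKu : UniqueDiffOn ℝ K := (uniqueDiffOn_Icc hs).prod (uniqueDiffOn_Icc ht)
  set κ : ℂ := 2 * Real.pi * Complex.I with hκ
  set c' : ℝ × ℝ → M := fun q => c q.1 q.2 with hc'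
  have hP := Λ.contDiffOn_pullConn hc hU hU' hKu (1, 0)
  have hQ := Λ.contDiffOn_pullConn hc hU hU' hKu (0, 1)
  set P : ℝ × ℝ → ℂ := Λ.pullConn x₀ c' K (1, 0) with hPdef
  set Q : ℝ × ℝ → ℂ := Λ.pullConn x₀ c' K (0, 1) with hQdef
  have m₁ : t₁ ∈ Icc t₁ t₂ := left_mem_Icc.2 ht.le
  have hPt : ∀ t ∈ Icc t₁ t₂, ContinuousOn (fun s => P (s, t)) (Icc s₁ s₂) := fun t htm =>
    hP.continuousOn.comp (by fun_prop) fun s hsm => ⟨hsm, htm⟩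
  have hQs : ∀ s ∈ Icc s₁ s₂, ContinuousOn (fun t => Q (s, t)) (Icc t₁ t₂) := fun s hsm =>
    hQ.continuousOn.comp (by fun_prop) fun t htm => ⟨hsm, htm⟩
  have hline₁ : ∀ s t : ℝ, HasDerivAt (fun s : ℝ => (s, t)) ((1, 0) : ℝ × ℝ) s := fun s t =>
    (hasDerivAt_id s).prodMk (hasDerivAt_const s t)
  have hline₂ : ∀ s t : ℝ, HasDerivAt (fun t : ℝ => (s, t)) ((0, 1) : ℝ × ℝ) t := fun s t =>
    (hasDerivAt_const t s).prodMk (hasDerivAt_id t)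
  have hev₁ : ∀ s ∈ Ioo s₁ s₂, ∀ t ∈ Icc t₁ t₂, ∀ᶠ s' in 𝓝 s, (s', t) ∈ K := by
    intro s hsm t htm
    filter_upwards [isOpen_Ioo.mem_nhds hsm] with s' hs'
    exact ⟨Ioo_subset_Icc_self hs', htm⟩
  have hev₂ : ∀ s ∈ Icc s₁ s₂, ∀ t ∈ Ioo t₁ t₂, ∀ᶠ t' in 𝓝 t, (s, t') ∈ K := by
    intro s hsm t htm
    filter_upwards [isOpen_Ioo.mem_nhds htm] with t' ht'
    exact ⟨hsm, Ioo_subset_Icc_self ht'⟩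
  -- differentiate `∫ Q(s, r) dr` under the integral sign, and integrate the structure equation
  -- `∂_s Q = ∂_t P + κ f` from `t₁` to `t`
  have hI₂ : ∀ t ∈ Icc t₁ t₂, ∀ s ∈ Ioo s₁ s₂, HasDerivAt (fun s => ∫ r in t₁..t, Q (s, r))
      (P (s, t) - P (s, t₁) + κ * ((∫ r in t₁..t, f s r : ℝ) : ℂ)) s := by
    intro t htm s hsm
    rcases htm.1.eq_or_lt with rfl | hlt
    · simpa using hasDerivAt_const s (0 : ℂ)
    have hsub : Ioo s₁ s₂ ×ˢ Icc t₁ t ⊆ K :=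
      prod_mono Ioo_subset_Icc_self (Icc_subset_Icc_right htm.2)
    have hQ1 : ContDiffOn ℝ 1 Q (Ioo s₁ s₂ ×ˢ Icc t₁ t) := (hQ.mono hsub).of_le (by simp)
    have hd := (hasFDerivAt_intervalIntegral_param isOpen_Ioo hlt hQ1 hsm).hasDerivAt
    have hud : UniqueDiffOn ℝ (Ioo s₁ s₂ ×ˢ Icc t₁ t) :=
      isOpen_Ioo.uniqueDiffOn.prod (uniqueDiffOn_Icc hlt)
    set D : ℝ → ℝ →L[ℝ] ℂ := fun r =>
      (fderivWithin ℝ Q (Ioo s₁ s₂ ×ˢ Icc t₁ t) (s, r)).comp (.inl ℝ ℝ ℝ) with hD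
    have hDc : ContinuousOn D (Icc t₁ t) := by
      refine ContinuousOn.clm_comp ?_ continuousOn_const
      exact (hQ1.continuousOn_fderivWithin hud le_rfl).comp (by fun_prop) fun r hr => ⟨hsm, hr⟩
    have hDi : IntervalIntegrable D volume t₁ t :=
      ContinuousOn.intervalIntegrable (by rwa [uIcc_of_le hlt.le])
    rw [ContinuousLinearMap.intervalIntegral_apply hDi] at hd
    refine hd.congr_deriv ?_
    have hfs := (hf s hsm).mono (Icc_subset_Icc_right htm.2)
    have hFc : ContinuousOn (fun r => P (s, r) + κ * ((∫ r' in t₁..r, f s r' : ℝ) : ℂ))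
        (Icc t₁ t) := by
      refine ContinuousOn.add ?_ (continuousOn_const.mul
        (Complex.continuous_ofReal.comp_continuousOn
          (continuousOn_primitive_of_continuousOn hlt.le hfs)))
      exact hP.continuousOn.comp (by fun_prop) fun r hr => hsub ⟨hsm, hr⟩
    have hFd : ∀ r ∈ Ioo t₁ t, HasDerivAt
        (fun r => P (s, r) + κ * ((∫ r' in t₁..r, f s r' : ℝ) : ℂ)) (D r 1) r := by
      intro r hr
      have hr' : r ∈ Ioo t₁ t₂ := ⟨hr.1, hr.2.trans_le htm.2⟩
      have hKn : K ∈ 𝓝 (s, r) := prod_mem_nhds (Icc_mem_nhds hsm.1 hsm.2)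
        (Icc_mem_nhds hr'.1 hr'.2)
      have hn : Ioo s₁ s₂ ×ˢ Icc t₁ t ∈ 𝓝 (s, r) :=
        prod_mem_nhds (isOpen_Ioo.mem_nhds hsm) (Icc_mem_nhds hr.1 hr.2)
      have hcurv := hΛ.pullConn hc hU hU' hKn (1, 0) (0, 1)
      have hPd : HasDerivAt (fun r => P (s, r)) (fderiv ℝ P (s, r) (0, 1)) r :=
        ((hP.contDiffAt hKn).differentiableAt (by simp)).hasFDerivAt.comp_hasDerivAt r
          (hline₂ s r)
      have hId := ((hasDerivAt_primitive_of_continuousOn hfs hr).ofReal_comp).const_mul κ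
      refine (hPd.add hId).congr_deriv ?_
      have hDr : D r 1 = fderiv ℝ Q (s, r) (1, 0) := by
        simp only [hD, fderivWithin_of_mem_nhds hn]
        rfl
      rw [hDr, hf' s hsm r hr', ← sub_eq_iff_eq_add'.1 hcurv]
    have := intervalIntegral.integral_eq_sub_of_hasDerivAt_of_le hlt.le hFc hFd
      (ContinuousOn.intervalIntegrable (by
        rw [uIcc_of_le hlt.le]; exact hDc.clm_apply continuousOn_const))
    rw [this, intervalIntegral.integral_same]
    push_cast
    ring
  -- integrate the connection form along the lower side and then upwards; the factor
  -- `exp (-κ G(s, t₁))` makes the weighted section parallel along the lower side, and by `hI₂` it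
  -- is then parallel along all horizontal lines
  let q : ℝ → ℝ → ℂ := fun s t => Complex.exp
    (-(κ * G s t₁ + (∫ r in s₁..s, P (r, t₁)) + ∫ r in t₁..t, Q (s, r)))
  refine ⟨fun s t => q s t • Λ.frame x₀ (c s t), ⟨fun s hsm t htm => ?_, fun t htm => ?_,
    fun s hsm => ?_⟩⟩
  · exact smul_ne_zero (Complex.exp_ne_zero _) (Λ.frame_ne_zero (hU (mk_mem_prod hsm htm)))
  · have hpar := isParallelAlong_of_frame (Λ := Λ) (c := fun s => c s t) (a := s₁) (b := s₂)
      (x₀ := x₀) (q := fun s => Complex.exp (κ * ((G s t - G s t₁ : ℝ) : ℂ) -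
        (∫ r in s₁..s, P (r, t₁)) - ∫ r in t₁..t, Q (s, r))) (S := ∅) ?_ ?_ ?_ finite_empty ?_
    · refine hpar.congr fun s hsm => ?_
      simp only [q]
      rw [smul_smul, ← Complex.exp_add]
      congr 2
      push_cast
      ring
    · exact hc.continuousOn.comp (f := fun s => (s, t)) (by fun_prop) fun s hsm => ⟨hsm, htm⟩
    · exact fun s hsm => hU (mk_mem_prod hsm htm)
    · refine Complex.continuous_exp.comp_continuousOn ?_
      refine ContinuousOn.sub (ContinuousOn.sub ?_ ?_) ?_
      · exact continuousOn_const.mul (Complex.continuous_ofReal.comp_continuousOn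
          ((hG t htm).sub (hG t₁ m₁)))
      · exact continuousOn_primitive_of_continuousOn hs.le (hPt t₁ m₁)
      · exact continuousOn_intervalIntegral_param hs.le htm hQ.continuousOn
    · intro s hsm _
      refine ⟨_, HasDerivAt.cexp (HasDerivAt.sub (HasDerivAt.sub
        ((hG' t htm s hsm).ofReal_comp.const_mul κ)
        (hasDerivAt_primitive_of_continuousOn (hPt t₁ m₁) hsm)) (hI₂ t htm s hsm)), ?_⟩
      have := Λ.conn_frame_line hc hU hU' hKu (hline₁ s t) (hev₁ s hsm t htm)
      refine (congrArg (fun w : Λ.fiber (c s t) => _ + _ • w) this).trans ?_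
      rw [smul_smul, ← add_smul]
      convert zero_smul ℂ _
      ring
  · have hpar := isParallelAlong_of_frame (Λ := Λ) (c := fun t => c s t) (a := t₁) (b := t₂)
      (x₀ := x₀) (q := fun t => q s t) (S := ∅) ?_ ?_ ?_ finite_empty ?_
    · exact hpar.congr fun t htm => (one_smul ℂ _).symm
    · exact hc.continuousOn.comp (f := fun t => (s, t)) (by fun_prop) fun t htm => ⟨hsm, htm⟩
    · exact fun t htm => hU (mk_mem_prod hsm htm)
    · exact Complex.continuous_exp.comp_continuousOn (ContinuousOn.neg
        (continuousOn_const.add (continuousOn_primitive_of_continuousOn ht.le (hQs s hsm))))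
    · intro t htm _
      refine ⟨_, HasDerivAt.cexp (HasDerivAt.neg (HasDerivAt.const_add _
        (hasDerivAt_primitive_of_continuousOn (hQs s hsm) htm))), ?_⟩
      have := Λ.conn_frame_line hc hU hU' hKu (hline₂ s t) (hev₂ s hsm t htm)
      refine (congrArg (fun w : Λ.fiber (c s t) => _ + _ • w) this).trans ?_
      rw [smul_smul, ← add_smul]
      convert zero_smul ℂ _
      ring

end UnitaryLineBundle
end
end

/-! ### Transport over large rectangles -/

noncomputable section

section

universe v

variable {E : Type*} [NormedAddCommGroup E] [NormedSpace ℝ E]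
  {H : Type*} [TopologicalSpace H]
  {J : ModelWithCorners ℝ E H} {M : Type*} [TopologicalSpace M] [ChartedSpace H M]
  [IsManifold J ∞ M]

/-- The `i`-th point of the partition of `[a, b]` into `N` equal parts. -/
def equipartition (a b : ℝ) (N i : ℕ) : ℝ := a + i * ((b - a) / N)

section Equipartition

variable {a b : ℝ} {N : ℕ}

lemma equipartition_zero : equipartition a b N 0 = a := by simp [equipartition]

lemma equipartition_self (hN : 0 < N) : equipartition a b N N = b := by
  have : (N : ℝ) ≠ 0 := by positivity
  rw [equipartition, mul_div_cancel₀ _ this]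
  ring

lemma equipartition_succ (i : ℕ) :
    equipartition a b N (i + 1) = equipartition a b N i + (b - a) / N := by
  simp only [equipartition]; push_cast; ring

lemma equipartition_lt (hab : a < b) (hN : 0 < N) (i : ℕ) :
    equipartition a b N i < equipartition a b N (i + 1) := by
  rw [equipartition_succ]
  have : 0 < (b - a) / N := by have := sub_pos.2 hab; positivity
  linarith

lemma equipartition_mem (hab : a < b) (hN : 0 < N) {i : ℕ} (hi : i ≤ N) :
    equipartition a b N i ∈ Icc a b := by
  have hN' : (0 : ℝ) < N := by positivity
  have h1 : 0 < (b - a) / N := by have := sub_pos.2 hab; positivity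
  have h2 : (i : ℝ) * ((b - a) / N) ≤ N * ((b - a) / N) := by gcongr
  rw [mul_div_cancel₀ _ hN'.ne'] at h2
  constructor
  · simp only [equipartition]; nlinarith [Nat.cast_nonneg (α := ℝ) i]
  · simp only [equipartition]; linarith

end Equipartition

namespace UnitaryLineBundle

open MeasureTheory

variable {Λ : UnitaryLineBundle.{v} J M} {c : ℝ → ℝ → M} {s₁ s₂ t₁ t₂ : ℝ}

/-- By Lebesgue's lemma, small rectangles lie in the domain of a frame and of a chart. -/
lemma exists_mesh (hc : ContinuousOn (fun q : ℝ × ℝ => c q.1 q.2) (Icc s₁ s₂ ×ˢ Icc t₁ t₂)) :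
    ∃ δ > 0, ∀ q ∈ Icc s₁ s₂ ×ˢ Icc t₁ t₂, ∃ x₀ : M, ∀ q' ∈ Icc s₁ s₂ ×ˢ Icc t₁ t₂,
      dist q' q < δ → c q'.1 q'.2 ∈ Λ.frameSet x₀ ∩ (extChartAt J x₀).source := by
  have hopen : ∀ x₀ : M, IsOpen (Λ.frameSet x₀ ∩ (extChartAt J x₀).source) := fun x₀ =>
    (Λ.isOpen_frameSet x₀).inter (isOpen_extChartAt_source x₀)
  choose W hW hW' using fun x₀ : M => (continuousOn_iff'.1 hc) _ (hopen x₀)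
  obtain ⟨δ, hδ, h⟩ := lebesgue_number_lemma_of_metric
    ((isCompact_Icc (a := s₁) (b := s₂)).prod (isCompact_Icc (a := t₁) (b := t₂))) hW (by
      intro q hq
      have : q ∈ (fun q : ℝ × ℝ => c q.1 q.2) ⁻¹' (Λ.frameSet (c q.1 q.2) ∩
          (extChartAt J (c q.1 q.2)).source) ∩ Icc s₁ s₂ ×ˢ Icc t₁ t₂ :=
        ⟨⟨Λ.mem_frameSet _, mem_extChartAt_source _⟩, hq⟩
      rw [hW'] at this
      exact mem_iUnion.2 ⟨_, this.1⟩)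
  refine ⟨δ, hδ, fun q hq => ?_⟩
  obtain ⟨x₀, hx₀⟩ := h q hq
  refine ⟨x₀, fun q' hq' hd => ?_⟩
  have : q' ∈ W x₀ ∩ Icc s₁ s₂ ×ˢ Icc t₁ t₂ := ⟨hx₀ hd, hq'⟩
  rw [← hW'] at this
  exact this.1

/-- Over a rectangle, parallel transport in the second variable intertwines parallel transport in
the first one up to a phase: the integral of the curvature. -/
lemma exists_isTransport [FiniteDimensional ℝ E]
    {β : ∀ x : M, TangentSpace J x [⋀^Fin 2]→L[ℝ] ℝ}
    (hΛ : Λ.HasCurvature β) (hs : s₁ < s₂) (ht : t₁ < t₂)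
    (hc : ContMDiffOn 𝓘(ℝ, ℝ × ℝ) J ∞ (fun q : ℝ × ℝ => c q.1 q.2) (Icc s₁ s₂ ×ˢ Icc t₁ t₂))
    {G f : ℝ → ℝ → ℝ}
    (hf : ∀ s ∈ Ioo s₁ s₂, ContinuousOn (f s) (Icc t₁ t₂))
    (hf' : ∀ s ∈ Ioo s₁ s₂, ∀ t ∈ Ioo t₁ t₂, f s t = β (c s t)
      ![mfderiv 𝓘(ℝ, ℝ × ℝ) J (fun q : ℝ × ℝ => c q.1 q.2) (s, t) ((1, 0) : ℝ × ℝ),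
        mfderiv 𝓘(ℝ, ℝ × ℝ) J (fun q : ℝ × ℝ => c q.1 q.2) (s, t) ((0, 1) : ℝ × ℝ)])
    (hG : ∀ t ∈ Icc t₁ t₂, ContinuousOn (fun s => G s t) (Icc s₁ s₂))
    (hG' : ∀ t ∈ Icc t₁ t₂, ∀ s ∈ Ioo s₁ s₂, HasDerivAt (fun s => G s t) (∫ r in t₁..t, f s r) s) :
    ∃ τ, Λ.IsTransport c (fun s t => Complex.exp (2 * Real.pi * Complex.I * G s t))
      (fun _ _ => 1) s₁ s₂ t₁ t₂ τ := by
  obtain ⟨δ, hδ, hmesh⟩ := exists_mesh (Λ := Λ) hc.continuousOn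
  obtain ⟨N, hN0, hN⟩ : ∃ N : ℕ, 0 < N ∧ ∀ d : ℝ, d ≤ max (s₂ - s₁) (t₂ - t₁) → d / N < δ := by
    obtain ⟨N, hN⟩ := exists_nat_gt (max (s₂ - s₁) (t₂ - t₁) / δ)
    have hm : 0 < max (s₂ - s₁) (t₂ - t₁) := lt_max_of_lt_left (sub_pos.2 hs)
    have hN0 : (0 : ℝ) < N := (div_pos hm hδ).trans hN
    refine ⟨N, by exact_mod_cast hN0, fun d hd => ?_⟩
    rw [div_lt_iff₀ hN0]
    rw [div_lt_iff₀ hδ] at hN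
    linarith [mul_comm (N : ℝ) δ]
  set a := equipartition s₁ s₂ N
  set b := equipartition t₁ t₂ N
  have ha : ∀ i, a i < a (i + 1) := equipartition_lt hs hN0
  have hb : ∀ i, b i < b (i + 1) := equipartition_lt ht hN0
  have ham : ∀ i ≤ N, a i ∈ Icc s₁ s₂ := fun i hi => equipartition_mem hs hN0 hi
  have hbm : ∀ i ≤ N, b i ∈ Icc t₁ t₂ := fun i hi => equipartition_mem ht hN0 hi
  have hda : ∀ i, a (i + 1) - a i < δ := fun i => by
    simp only [a, equipartition_succ, add_sub_cancel_left]; exact hN _ (le_max_left _ _)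
  have hdb : ∀ i, b (i + 1) - b i < δ := fun i => by
    simp only [b, equipartition_succ, add_sub_cancel_left]; exact hN _ (le_max_right _ _)
  have hvert : ∀ s ∈ Icc s₁ s₂, DiffOffFinite J (c s) t₁ t₂ := fun s hsm =>
    diffOffFinite_comp_line (ℓ := fun t : ℝ => (s, t)) hc
      (fun t => (hasDerivAt_const t s).prodMk (hasDerivAt_id t))
      fun t htm => ⟨hsm, Ioo_subset_Icc_self htm⟩
  have hhor : ∀ t ∈ Icc t₁ t₂, DiffOffFinite J (fun s => c s t) s₁ s₂ := fun t htm =>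
    diffOffFinite_comp_line (ℓ := fun s : ℝ => (s, t)) hc
      (fun s => (hasDerivAt_id s).prodMk (hasDerivAt_const s t))
      fun s hsm => ⟨Ioo_subset_Icc_self hsm, htm⟩
  -- transport over the cells of a grid, then over its rows, then over the whole rectangle
  have hcell : ∀ i < N, ∀ j < N, ∃ τ, Λ.IsTransport c
      (fun s t => Complex.exp (2 * Real.pi * Complex.I * G s t)) (fun _ _ => 1)
      (a i) (a (i + 1)) (b j) (b (j + 1)) τ := by
    intro i hi j hj
    have hsub₁ : Icc (a i) (a (i + 1)) ⊆ Icc s₁ s₂ :=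
      Icc_subset_Icc (ham i hi.le).1 (ham (i + 1) hi).2
    have hsub₂ : Icc (b j) (b (j + 1)) ⊆ Icc t₁ t₂ :=
      Icc_subset_Icc (hbm j hj.le).1 (hbm (j + 1) hj).2
    have hsub₁' : Ioo (a i) (a (i + 1)) ⊆ Ioo s₁ s₂ :=
      Ioo_subset_Ioo (ham i hi.le).1 (ham (i + 1) hi).2
    have hsub₂' : Ioo (b j) (b (j + 1)) ⊆ Ioo t₁ t₂ :=
      Ioo_subset_Ioo (hbm j hj.le).1 (hbm (j + 1) hj).2
    obtain ⟨x₀, hx₀⟩ := hmesh (a i, b j) ⟨ham i hi.le, hbm j hj.le⟩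
    have hmaps : ∀ q ∈ Icc (a i) (a (i + 1)) ×ˢ Icc (b j) (b (j + 1)),
        c q.1 q.2 ∈ Λ.frameSet x₀ ∩ (extChartAt J x₀).source := by
      intro q hq
      refine hx₀ q ⟨hsub₁ hq.1, hsub₂ hq.2⟩ ?_
      rw [Prod.dist_eq, max_lt_iff, Real.dist_eq, Real.dist_eq,
        abs_of_nonneg (sub_nonneg.2 hq.1.1), abs_of_nonneg (sub_nonneg.2 hq.2.1)]
      exact ⟨by linarith [hda i, hq.1.2], by linarith [hdb j, hq.2.2]⟩
    refine exists_isTransport_of_mapsTo hΛ (ha i) (hb j) (hc.mono (prod_mono hsub₁ hsub₂))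
      (fun q hq => (hmaps q hq).1) (fun q hq => (hmaps q hq).2) (f := f)
      (fun s hsm => (hf s (hsub₁' hsm)).mono hsub₂)
      (fun s hsm t htm => hf' s (hsub₁' hsm) t (hsub₂' htm))
      (fun t htm => (hG t (hsub₂ htm)).mono hsub₁) (fun t htm s hsm => ?_)
    have hint : ∀ r ∈ Icc t₁ t₂, IntervalIntegrable (f s) volume t₁ r := fun r hr =>
      ContinuousOn.intervalIntegrable (by
        rw [uIcc_of_le hr.1]
        exact (hf s (hsub₁' hsm)).mono (Icc_subset_Icc_right hr.2))
    have h1 := (hG' t (hsub₂ htm) s (hsub₁' hsm)).sub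
      (hG' (b j) (hbm j hj.le) s (hsub₁' hsm))
    rwa [intervalIntegral.integral_interval_sub_left (hint t (hsub₂ htm))
      (hint (b j) (hbm j hj.le))] at h1
  have hmono : ∀ {c : ℝ → M} {x y x' y' : ℝ}, DiffOffFinite J c x y → x ≤ x' → y' ≤ y →
      DiffOffFinite J c x' y' := fun ⟨S, hS, h⟩ hx hy =>
    ⟨S, hS, fun t ht => h t (Ioo_subset_Ioo hx hy ht)⟩
  have hrow : ∀ j < N, ∃ τ, Λ.IsTransport c
      (fun s t => Complex.exp (2 * Real.pi * Complex.I * G s t)) (fun _ _ => 1)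
      s₁ s₂ (b j) (b (j + 1)) τ := by
    intro j hj
    have := exists_isTransport_of_partition hN0 (fun i _ => (ha i).le) (hb j).le
      (fun i hi => hmono (hvert (a i) (ham i hi.le)) (hbm j hj.le).1 (hbm (j + 1) hj).2)
      (fun i _ t _ => one_ne_zero) (fun i hi => hcell i hi j hj)
    rwa [show a 0 = s₁ from equipartition_zero, show a N = s₂ from equipartition_self hN0] at this
  obtain ⟨τ, hτ⟩ := exists_isTransport_of_partition (Λ := Λ) (c := fun t s => c s t)
    (w₁ := fun _ _ => 1) (w₂ := fun t s => Complex.exp (2 * Real.pi * Complex.I * G s t)) hN0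
    (fun j _ => (hb j).le) hs.le (fun j hj => hhor (b j) (hbm j hj.le))
    (fun j _ s _ => Complex.exp_ne_zero _) (fun j hj =>
      let ⟨τ, hτ⟩ := hrow j hj; ⟨fun t s => τ s t, hτ.swap⟩)
  rw [show b 0 = t₁ from equipartition_zero, show b N = t₂ from equipartition_self hN0] at hτ
  exact ⟨fun s t => τ t s, hτ.swap⟩

end UnitaryLineBundle
end
end

/-! ### The holonomies at the ends of an isotopy -/

noncomputable section

section

universe v v'

variable {E : Type*} [NormedAddCommGroup E] [NormedSpace ℝ E] {H : Type*} [TopologicalSpace H]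
  {J : ModelWithCorners ℝ E H} {M : Type*} [TopologicalSpace M] [ChartedSpace H M]
  [IsManifold J ∞ M]
  {E' : Type*} [NormedAddCommGroup E'] [NormedSpace ℝ E'] {H' : Type*} [TopologicalSpace H']
  {J' : ModelWithCorners ℝ E' H'} {M' : Type*} [TopologicalSpace M'] [ChartedSpace H' M']
  [IsManifold J' ∞ M']
  {Λ : UnitaryLineBundle.{v} J M} {Λ' : UnitaryLineBundle.{v'} J' M'} {f : M → M'}

lemma PullbackIso.mk_symm_eq (Φ : PullbackIso Λ Λ' f) {x y : M} (hxy : x = y)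
    {v : Λ'.fiber (f x)} {w : Λ'.fiber (f y)}
    (h : (⟨f x, v⟩ : TotalSpace ℂ Λ'.fiber) = ⟨f y, w⟩) :
    (⟨x, (Φ.toEquiv x).symm v⟩ : TotalSpace ℂ Λ.fiber) = ⟨y, (Φ.toEquiv y).symm w⟩ := by
  subst hxy
  rw [TotalSpace.mk_inj] at h
  rw [h]

omit [IsManifold J ∞ M] in
lemma IsPiecewiseSmoothLoop.diffOffFinite {γ : C(Circle, M)} (hγ : IsPiecewiseSmoothLoop J γ) :
    DiffOffFinite J (fun s : ℝ => γ (Circle.exp s)) 0 (2 * Real.pi) := by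
  obtain ⟨N, a, hN0, h0, hN, -, -, hs⟩ := hγ.exists_partition
  refine ⟨a '' {i | i ≤ N}, (finite_le_nat N).image a, fun s hsm hsS => ?_⟩
  obtain ⟨i, hi, hsi⟩ := exists_mem_Icc_partition hN0
    (show s ∈ Icc (a 0) (a N) by rw [h0, hN]; exact Ioo_subset_Icc_self hsm)
  have h1 : a i ≠ s := fun h => hsS ⟨i, hi.le, h⟩
  have h2 : s ≠ a (i + 1) := fun h => hsS ⟨i + 1, hi, h.symm⟩
  exact ((hs i hi).contMDiffAt (Icc_mem_nhds (hsi.1.lt_of_ne h1)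
    (hsi.2.lt_of_ne h2))).mdifferentiableAt (by simp)

/-- The holonomy of a bundle isomorphic to a pullback is computed by parallel sections along the
image of the loop. -/
lemma PullbackIso.holonomy_eq (Φ : PullbackIso Λ Λ' f) {γ : C(Circle, M)}
    (hγ : IsPiecewiseSmoothLoop J γ) {c : ℝ → M'} (hc : ∀ s : ℝ, c s = f (γ (Circle.exp s)))
    {σ : ∀ s, Λ'.fiber (c s)} (hσ : Λ'.IsParallelAlong c 0 (2 * Real.pi) σ) (h0 : σ 0 ≠ 0) {h : ℂ}
    (hend : (⟨c (2 * Real.pi), σ (2 * Real.pi)⟩ : TotalSpace ℂ Λ'.fiber) = ⟨c 0, h • σ 0⟩) :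
    Λ.holonomy γ = h := by
  obtain rfl : c = fun s : ℝ => f (γ (Circle.exp s)) := funext hc
  obtain ⟨S, hS, hd⟩ := hγ.diffOffFinite
  refine UnitaryLineBundle.holonomy_eq hS hd (Φ.isParallelAlong_pullback (c := fun s : ℝ =>
    γ (Circle.exp s)) (by fun_prop) hS hd hσ) (by simpa using h0) ?_
  rw [← map_smul]
  exact Φ.mk_symm_eq (by rw [Circle.exp_two_pi, Circle.exp_zero]) hend

/-- Uniqueness of parallel transport, for sections along curves that are equal, but not by
definition, as the curves at the angles `0` and `2π` of a cylinder. -/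
lemma UnitaryLineBundle.IsParallelAlong.exists_mk_eq {a b : ℝ} {c₁ c₂ : ℝ → M}
    (hc : c₁ = c₂) {τ₁ : ∀ t, Λ.fiber (c₁ t)} {τ₂ : ∀ t, Λ.fiber (c₂ t)}
    (h₁ : Λ.IsParallelAlong c₁ a b τ₁) (h₂ : Λ.IsParallelAlong c₂ a b τ₂)
    (hd : DiffOffFinite J c₂ a b) (h0 : τ₂ a ≠ 0) :
    ∃ h : ℂ, ∀ t ∈ Icc a b,
      (⟨c₁ t, τ₁ t⟩ : TotalSpace ℂ Λ.fiber) = ⟨c₂ t, h • τ₂ t⟩ := by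
  subst hc
  obtain ⟨S, hS, hd⟩ := hd
  obtain ⟨h, hh⟩ := Λ.exists_eq_smul h0 (τ₁ a)
  exact ⟨h, fun t ht => by rw [(h₂.eq_smul h₁ hS hd h0 hh ht).2]⟩

end

universe v v'

variable {n : ℕ} {X : Type*} [TopologicalSpace X]
  [ChartedSpace (EuclideanSpace ℝ (Fin (2 * n))) X]
  {S : SymplecticBField n X} {L : Type*} [TopologicalSpace L]
  [ChartedSpace (EuclideanSpace ℝ (Fin n)) L] [IsManifold (𝓡 n) ∞ L] {L' : Type*}
  [TopologicalSpace L'] [ChartedSpace (EuclideanSpace ℝ (Fin n)) L'] [IsManifold (𝓡 n) ∞ L']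
  {O : LagObject.{v} S L} {O' : LagObject.{v'} S L'}

namespace LagIsotopy

open MeasureTheory

omit [IsManifold (𝓡 n) ∞ L] in
lemma mfderiv_sweep {f : ℝ → L} {s t : ℝ} (hf : MDifferentiableAt 𝓘(ℝ, ℝ) (𝓡 n) f s)
    (ht : t ∈ Ioo (0 : ℝ) 1) :
    mfderiv 𝓘(ℝ, ℝ × ℝ) (cylModel n) (sweep f) (s, t) ((1, 0) : ℝ × ℝ) =
        (mfderiv 𝓘(ℝ, ℝ) (𝓡 n) f s (1 : ℝ), (0 : EuclideanSpace ℝ (Fin 1))) ∧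
      mfderiv 𝓘(ℝ, ℝ × ℝ) (cylModel n) (sweep f) (s, t) ((0, 1) : ℝ × ℝ) =
        timeVector (sweep f (s, t)) := by
  have h := (hasMFDerivWithinAt_sweep (K := univ) hf.hasMFDerivAt.hasMFDerivWithinAt
    (Ioo_subset_Icc_self ht)).hasMFDerivAt (prod_mem_nhds univ_mem (Icc_mem_nhds ht.1 ht.2))
  let T : ℝ →L[ℝ] EuclideanSpace ℝ (Fin n) := mfderiv 𝓘(ℝ, ℝ) (𝓡 n) f s
  rw [h.mfderiv]
  exact ⟨Prod.ext rfl (zero_smul ℝ _), Prod.ext T.map_zero (one_smul ℝ _)⟩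

variable [IsManifold (𝓡 (2 * n)) ∞ X]

/-- The transport of the line bundle of the isotopy along the annulus swept out by a loop. -/
lemma exists_isTransport_annulus (Ψ : LagIsotopy O O') {γ : C(Circle, L)}
    (hγ : IsPiecewiseSmoothLoop (𝓡 n) γ) :
    ∃ τ, Ψ.bundle.IsTransport (fun s t => sweep (fun s : ℝ => γ (Circle.exp s)) (s, t))
      (fun s t => Complex.exp (2 * Real.pi * Complex.I *
        ((∫ s' in (0 : ℝ)..s, ∫ r in (0 : ℝ)..t, Ψ.annulusIntegrand S.B γ s' r : ℝ) : ℂ)))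
      (fun _ _ => 1) 0 (2 * Real.pi) 0 1 τ := by
  obtain ⟨N, a, hN0, h0, hN, ha, -, hs⟩ := hγ.exists_partition
  set f := Ψ.annulusIntegrand S.B γ with hf
  set γe : ℝ → L := fun s => γ (Circle.exp s) with hγe
  -- the integrand need not be continuous at the corners of the loop: `F i` extends it continuously
  -- from the `i`-th piece to its closure
  let F : ℕ → ℝ × ℝ → ℝ := fun i q =>
    S.B.pullOn (Ψ.annulus γ) (Icc (a i) (a (i + 1)) ×ˢ Icc 0 1) q ![(1, 0), (0, 1)]
  have hF : ∀ i < N, ContinuousOn (F i) (Icc (a i) (a (i + 1)) ×ˢ Icc 0 1) := fun i hi =>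
    (DForm.contDiffOn_pullOn_apply S.B_smooth ((uniqueDiffOn_Icc (ha i hi)).prod
      (uniqueDiffOn_Icc zero_lt_one)) (Ψ.contMDiffOn_annulus (hs i hi)) _).continuousOn
  have hFf : ∀ i < N, ∀ s ∈ Ioo (a i) (a (i + 1)), ∀ t ∈ Icc (0 : ℝ) 1, F i (s, t) = f s t :=
    fun i hi s hsm t ht => Ψ.pullOn_annulus S.B (hs i hi) hsm ht
  have hFs : ∀ i < N, ∀ t ∈ Icc (0 : ℝ) 1,
      ContinuousOn (fun s => ∫ r in (0 : ℝ)..t, F i (s, r)) (Icc (a i) (a (i + 1))) :=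
    fun i hi t ht => continuousOn_intervalIntegral_param (ha i hi).le ht (hF i hi)
  have hFg : ∀ i < N, ∀ t ∈ Icc (0 : ℝ) 1, EqOn (fun s => ∫ r in (0 : ℝ)..t, F i (s, r))
      (fun s => ∫ r in (0 : ℝ)..t, f s r) (Ioo (a i) (a (i + 1))) := fun i hi t ht s hsm =>
    intervalIntegral.integral_congr fun r hr => by
      rw [uIcc_of_le ht.1] at hr
      exact hFf i hi s hsm r (Icc_subset_Icc_right ht.2 hr)
  have hint : ∀ i < N, ∀ t ∈ Icc (0 : ℝ) 1,
      IntervalIntegrable (fun s => ∫ r in (0 : ℝ)..t, f s r) volume (a i) (a (i + 1)) := by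
    intro i hi t ht
    refine IntervalIntegrable.congr_uIoo (ContinuousOn.intervalIntegrable
      (by rw [uIcc_of_le (ha i hi).le]; exact hFs i hi t ht)) ?_
    rw [uIoo_of_le (ha i hi).le]
    exact hFg i hi t ht
  have hG : ∀ i < N, ∀ t ∈ Icc (0 : ℝ) 1,
      EqOn (fun s => ∫ s' in (0 : ℝ)..s, ∫ r in (0 : ℝ)..t, f s' r)
      (fun s => (∫ s' in (0 : ℝ)..a i, ∫ r in (0 : ℝ)..t, f s' r) +
        ∫ s' in a i..s, ∫ r in (0 : ℝ)..t, F i (s', r)) (Icc (a i) (a (i + 1))) := by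
    intro i hi t ht s hsm
    have h1 : IntervalIntegrable (fun s => ∫ r in (0 : ℝ)..t, f s r) volume 0 (a i) := by
      have := IntervalIntegrable.trans_iterate fun k (hk : k < i) => hint k (hk.trans hi) t ht
      rwa [h0] at this
    have h2 : IntervalIntegrable (fun s => ∫ r in (0 : ℝ)..t, f s r) volume (a i) s :=
      (hint i hi t ht).mono_set (by
        rw [uIcc_of_le hsm.1, uIcc_of_le (ha i hi).le]
        exact Icc_subset_Icc_right hsm.2)
    dsimp only
    rw [← intervalIntegral.integral_add_adjacent_intervals h1 h2]
    congr 1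
    exact intervalIntegral.integral_congr_Ioo_of_le hsm.1 fun s' hs' =>
      (hFg i hi t ht ⟨hs'.1, hs'.2.trans_le hsm.2⟩).symm
  have hsm : ∀ i < N, ContMDiffOn 𝓘(ℝ, ℝ × ℝ) (cylModel n) ∞ (sweep γe)
      (Icc (a i) (a (i + 1)) ×ˢ Icc 0 1) := fun i hi => contMDiffOn_sweep (hs i hi)
  suffices hkey : ∃ τ, Ψ.bundle.IsTransport (fun s t => sweep γe (s, t))
      (fun s t => Complex.exp (2 * Real.pi * Complex.I *
        ((∫ s' in (0 : ℝ)..s, ∫ r in (0 : ℝ)..t, f s' r : ℝ) : ℂ)))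
      (fun _ _ => 1) (a 0) (a N) 0 1 τ by
    rwa [h0, hN] at hkey
  refine UnitaryLineBundle.exists_isTransport_of_partition hN0 (fun i hi => (ha i hi).le)
    zero_le_one (fun i hi => ?_) (fun i _ t _ => one_ne_zero) fun i hi => ?_
  · exact diffOffFinite_comp_line (ℓ := fun t : ℝ => (a i, t)) (hsm i hi)
      (fun t => (hasDerivAt_const t (a i)).prodMk (hasDerivAt_id t))
      fun t ht => ⟨left_mem_Icc.2 (ha i hi).le, Ioo_subset_Icc_self ht⟩
  · refine UnitaryLineBundle.exists_isTransport Ψ.curvature_eq (ha i hi) zero_lt_one (hsm i hi)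
      (f := f) (fun s hsm => ?_) (fun s hsm t ht => ?_) (fun t ht => ?_) (fun t ht s hsm => ?_)
    · refine ContinuousOn.congr (f := fun t => F i (s, t)) ?_ fun t ht => (hFf i hi s hsm t ht).symm
      exact (hF i hi).comp (by fun_prop) fun t ht => ⟨Ioo_subset_Icc_self hsm, ht⟩
    · have hd := mfderiv_sweep (f := γe) (((hs i hi).contMDiffAt
        (Icc_mem_nhds hsm.1 hsm.2)).mdifferentiableAt (by simp)) ht
      refine Eq.trans ?_ (congrArg₂ (fun v w : EuclideanSpace ℝ (Fin n) × EuclideanSpace ℝ (Fin 1)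
        => (S.B.pullback (cylModel n) Ψ.ψ (sweep γe (s, t)) :
          (EuclideanSpace ℝ (Fin n) × EuclideanSpace ℝ (Fin 1)) [⋀^Fin 2]→L[ℝ] ℝ) ![v, w])
        hd.1.symm hd.2.symm)
      rfl
    · exact (continuousOn_const.add
        (continuousOn_primitive_of_continuousOn (ha i hi).le (hFs i hi t ht))).congr (hG i hi t ht)
    · have h1 := (hasDerivAt_primitive_of_continuousOn (hFs i hi t ht) hsm).const_add
        (∫ s' in (0 : ℝ)..a i, ∫ r in (0 : ℝ)..t, f s' r)
      refine (h1.congr_of_eventuallyEq ?_).congr_deriv (hFg i hi t ht hsm)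
      filter_upwards [isOpen_Ioo.mem_nhds hsm] with s' hs'
      exact hG i hi t ht (Ioo_subset_Icc_self hs')

/-- The holonomies at the two ends of the isotopy differ by the integral of `ψ^* B` over the
annulus. -/
lemma holonomy_end (Ψ : LagIsotopy O O') {γ : C(Circle, L)} (hγ : IsPiecewiseSmoothLoop (𝓡 n) γ)
    {γ' : C(Circle, L')} (hγ' : IsPiecewiseSmoothLoop (𝓡 n) γ')
    (h' : ∀ z, γ' z = Ψ.endDiffeo (γ z)) :
    O'.bundle.holonomy γ' = Complex.exp (2 * Real.pi * Complex.I *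
      ((∫ s in (0 : ℝ)..(2 * Real.pi), ∫ t in (0 : ℝ)..1, Ψ.annulusIntegrand S.B γ s t : ℝ) : ℂ)) *
      O.bundle.holonomy γ := by
  obtain ⟨τ, hτ⟩ := Ψ.exists_isTransport_annulus hγ
  set G : ℝ → ℝ → ℝ := fun s t =>
    ∫ s' in (0 : ℝ)..s, ∫ r in (0 : ℝ)..t, Ψ.annulusIntegrand S.B γ s' r with hGdef
  change Ψ.bundle.IsTransport _ (fun s t => Complex.exp (2 * Real.pi * Complex.I * G s t)) _ _ _ _ _
    τ at hτ
  change _ = Complex.exp (2 * Real.pi * Complex.I * G (2 * Real.pi) 1) * _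
  set c : ℝ → ℝ → L × Icc (0 : ℝ) 1 := fun s t => sweep (fun s : ℝ => γ (Circle.exp s)) (s, t)
    with hc
  have hpi := Real.two_pi_pos.le
  have m0 : (0 : ℝ) ∈ Icc 0 (2 * Real.pi) := left_mem_Icc.2 hpi
  have m1 : 2 * Real.pi ∈ Icc 0 (2 * Real.pi) := right_mem_Icc.2 hpi
  have k0 : (0 : ℝ) ∈ Icc (0 : ℝ) 1 := left_mem_Icc.2 zero_le_one
  have k1 : (1 : ℝ) ∈ Icc (0 : ℝ) 1 := right_mem_Icc.2 zero_le_one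
  have hcc : c (2 * Real.pi) = c 0 := by
    funext t
    simp only [hc, sweep, Circle.exp_two_pi, Circle.exp_zero]
  have hvert : DiffOffFinite (cylModel n) (c 0) 0 1 :=
    diffOffFinite_comp_line (ℓ := fun t : ℝ => ((0 : ℝ), t)) (v := ((0, 1) : ℝ × ℝ))
      (contMDiffOn_sweep (K := {0}) (f := fun s : ℝ => γ (Circle.exp s))
        (contMDiffOn_const (c := γ (Circle.exp 0)) |>.congr fun s hs => by
          rw [mem_singleton_iff.1 hs]))
      (fun t => (hasDerivAt_const t (0 : ℝ)).prodMk (hasDerivAt_id t))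
      fun t ht => ⟨rfl, Ioo_subset_Icc_self ht⟩
  -- the vertical sections at the angles `2π` and `0` are proportional, with the same factor `h` at
  -- all times
  obtain ⟨h, hh⟩ := UnitaryLineBundle.IsParallelAlong.exists_mk_eq hcc
    (hτ.vertical _ m1) (hτ.vertical _ m0) hvert (by
      rw [one_smul]; exact hτ.ne_zero 0 m0 0 k0)
  have hend : ∀ t ∈ Icc (0 : ℝ) 1, (⟨c (2 * Real.pi) t, Complex.exp (2 * Real.pi * Complex.I *
      G (2 * Real.pi) t) • τ (2 * Real.pi) t⟩ : TotalSpace ℂ Ψ.bundle.fiber) =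
      ⟨c 0 t, (Complex.exp (2 * Real.pi * Complex.I * G (2 * Real.pi) t) * h) •
        Complex.exp (2 * Real.pi * Complex.I * G 0 t) • τ 0 t⟩ := by
    intro t ht
    have h1 := congrArg (fun w : TotalSpace ℂ Ψ.bundle.fiber => (⟨w.1, Complex.exp (2 * Real.pi *
      Complex.I * G (2 * Real.pi) t) • w.2⟩ : TotalSpace ℂ Ψ.bundle.fiber)) (hh t ht)
    have hG0 : G 0 t = 0 := intervalIntegral.integral_same
    simp only [one_smul] at h1
    rw [h1, hG0, Complex.ofReal_zero, mul_zero, Complex.exp_zero, one_smul, mul_smul]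
  have hne : ∀ t ∈ Icc (0 : ℝ) 1,
      Complex.exp (2 * Real.pi * Complex.I * G 0 t) • τ 0 t ≠ 0 := fun t ht =>
    smul_ne_zero (Complex.exp_ne_zero _) (hτ.ne_zero 0 m0 t ht)
  obtain ⟨Φ₀⟩ := Ψ.restrict_start
  obtain ⟨Φ₁⟩ := Ψ.restrict_end
  have e0 : O.bundle.holonomy γ = Complex.exp (2 * Real.pi * Complex.I * G (2 * Real.pi) 0) * h :=
    Φ₀.holonomy_eq hγ (c := fun s => c s 0) (fun s => by simp [hc, sweep])
      (hτ.horizontal 0 k0) (hne 0 k0) (hend 0 k0)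
  have e1 : O'.bundle.holonomy γ' =
      Complex.exp (2 * Real.pi * Complex.I * G (2 * Real.pi) 1) * h :=
    Φ₁.holonomy_eq hγ' (c := fun s => c s 1) (fun s => by simp [hc, sweep, h'])
      (hτ.horizontal 1 k1) (hne 1 k1) (hend 1 k1)
  have hG1 : G (2 * Real.pi) 0 = 0 := by simp [hGdef]
  rw [e1, e0, hG1, Complex.ofReal_zero, mul_zero, Complex.exp_zero, one_mul]

end LagIsotopy
end

/-! ### The weight of the attached disc -/

noncomputable section

universe v v'

namespace LagIsotopy

variable {n : ℕ} {X : Type*} [TopologicalSpace X]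
  [ChartedSpace (EuclideanSpace ℝ (Fin (2 * n))) X] [IsManifold (𝓡 (2 * n)) ∞ X]
  {S : SymplecticBField n X} {L : Type*} [TopologicalSpace L]
  [ChartedSpace (EuclideanSpace ℝ (Fin n)) L] [IsManifold (𝓡 n) ∞ L] {L' : Type*}
  [TopologicalSpace L'] [ChartedSpace (EuclideanSpace ℝ (Fin n)) L'] [IsManifold (𝓡 n) ∞ L']
  {O : LagObject.{v} S L} {O' : LagObject.{v'} S L'}

/-- The `B`-field part of the annulus cancels against the change of holonomy, and the symplectic
part is the integral of `θ_ψ`. -/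
lemma weight_attachDisc (Ψ : LagIsotopy O O') (u : LagDisc n (2 * n) O.ι) :
    O'.weight (Ψ.attachDisc u) = O.weight u *
      Complex.exp ((2 * Real.pi * loopIntegral Ψ.theta u.bdry : ℝ) : ℂ) := by
  have hol := Ψ.holonomy_end u.bdry_piecewiseSmooth (Ψ.attachDisc u).bdry_piecewiseSmooth
    fun _ => rfl
  have hB : discIntegral S.B (Ψ.attachDisc u).toFun = _ := Ψ.discIntegral_attach S.B_smooth u
  have hω : discIntegral S.symp (Ψ.attachDisc u).toFun = _ := Ψ.discIntegral_attach S.symp_smooth u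
  rw [integral_annulusIntegrand_symp] at hω
  rw [LagObject.weight, LagObject.weight, hol, hB, hω, ← mul_assoc, ← Complex.exp_add,
    mul_right_comm (Complex.exp _) (O.bundle.holonomy _) (Complex.exp _), ← Complex.exp_add]
  congr 2
  push_cast
  linear_combination (-2 * Real.pi * loopIntegral Ψ.theta u.bdry : ℂ) * Complex.I_sq

end LagIsotopy

end

theorem mainTheorem3 {n : ℕ} {X L : Type w} {L' : Type*}
    [TopologicalSpace X] [T2Space X] [SecondCountableTopology X]
    [ChartedSpace (EuclideanSpace ℝ (Fin (2 * n))) X] [IsManifold (𝓡 (2 * n)) ∞ X]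
    [TopologicalSpace L] [T2Space L] [SecondCountableTopology L]
    [ChartedSpace (EuclideanSpace ℝ (Fin n)) L] [IsManifold (𝓡 n) ∞ L]
    [TopologicalSpace L'] [T2Space L'] [SecondCountableTopology L']
    [ChartedSpace (EuclideanSpace ℝ (Fin n)) L'] [IsManifold (𝓡 n) ∞ L']
    (S : SymplecticBField n X) (O : LagObject S L) (O' : LagObject S L')
    (Ψ : LagIsotopy O O') (u : LagDisc n (2 * n) O.ι) :
    ∃ u' : LagDisc n (2 * n) O'.ι, u'.toFun = Ψ.attach u ∧
      ∃ hθ : Ψ.theta ∈ closedOneForms n L,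
        O'.weight u' = O.weight u *
          Complex.exp ((2 * Real.pi * loopIntegral Ψ.theta u.bdry : ℝ) : ℂ) ∧
        O'.weight u' = O.weight u *
          Complex.exp ((2 * Real.pi *
            deRhamPairing (deRhamClass Ψ.theta hθ) (loopClass u.bdry) : ℝ) : ℂ) ∧
        singularH1Map ⟨O.ι, O.embedding.isEmbedding.continuous⟩ (loopClass u.bdry) = 0 ∧
        (Ψ.IsExact → deRhamClass Ψ.theta hθ = 0 ∧ O'.weight u' = O.weight u) := by
  have hθ : Ψ.theta ∈ closedOneForms n L := Ψ.theta_mem_closedOneForms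
  have hw := Ψ.weight_attachDisc u
  refine ⟨Ψ.attachDisc u, rfl, hθ, hw, ?_, ?_, fun hex => ?_⟩
  · rw [deRhamPairing_loopClass hθ u.bdry_piecewiseSmooth]
    exact hw
  · rw [singularH1Map_loopClass]
    exact loopClass_eq_zero_of_disc u.continuousOn _ fun z => u.bdry_eq z
  · have hexact : Ψ.theta ∈ exactOneForms n L := hex.theta_mem_exactOneForms
    refine ⟨(QuotientAddGroup.eq_zero_iff _).2 hexact, ?_⟩
    rw [hw, loopIntegral_eq_zero_of_exact hθ hexact u.bdry_piecewiseSmooth]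
    simp
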